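/- Let $\chi\in C^\infty(\mathbb R^2,[0,1])$ be a radial cut-off function with $\chi(x)=0$ for $|x|<1$ and $\chi(x)=1$ for $|x|>2$, and put $\langle x\rangle=(1+|x|^2)^{1/2}$ and $m(x)=|x|(1-\chi(x))+\chi(x)$, so that $m(x)=|x|$ near the origin and $m(x)=1$ for $|x|>2$. All functions are real-valued. Let $H^s_{r,\gamma}(\mathbb R^2)$ and $H^s_{r,\gamma,\sigma}(\mathbb R^2)$ denote the subspaces of radially symmetric functions in the completions of $C_0^\infty(\mathbb R^2)$ for the norms $$\sum_{|\alpha|\le s}\|\langle x\rangle^{\gamma}D^\alpha u\|_{L^2(\mathbb R^2)}\quad\text{and}\quad \sum_{|\alpha|\le s}\|m^{\sigma+|\alpha|}\langle x\rangle^{\gamma}D^\alpha u\|_{L^2(\mathbb R^2)},$$ respectively, and let $L^2_{r,\gamma,\sigma}(\mathbb R^2)$ be the space of radially symmetric functions with $\|m^\sigma\langle x\rangle^\gamma u\|_{L^2(\mathbb R^2)}<\infty$, with this norm. Write $S=|x|$. **Proposition.** Let $\gamma_1\in(-1,0)$, $\sigma_1\in(-2,-1)$ and $\beta<0$. Let $\phi_0:(0,\infty)\to\mathbb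 R$ be a differentiable function for which there are $\kappa>0$ and $\tilde\gamma\in(-1,1)$ such that - $\partial_S\phi_0(S)\to\kappa$ as $S\to\infty$, - $\partial_S\phi_0(S)-\kappa=O(1/S)$ as $S\to\infty$, - the radial function $x\mapsto\partial_S\phi_0(|x|)-\kappa$ belongs to $H^3_{r,\tilde\gamma}(\mathbb R^2)$. Then the sums $$Y=H^1_{r,\gamma_1,\sigma_1+1}(\mathbb R^2)\oplus\operatorname{span}_{\mathbb R}\{1/S\}\oplus\mathbb R,\qquad \tilde Z=L^2_{r,\gamma_1,\sigma_1+2}(\mathbb R^2)\oplus\mathbb R$$ are direct, and, when they are equipped with the norms $\|\varphi+a/S+c\|_Y=\|\varphi\|_{H^1_{r,\gamma_1,\sigma_1+1}}+|a|+|c|$ and $\|N+z\|_{\tilde Z}=\|N\|_{L^2_{r,\gamma_1,\sigma_1+2}}+|z|$, the map $$\mathcal L_\phi:Y\to\tilde Z,\qquad \mathcal L_\phi u=\partial_S u+\frac1S u+2\beta(\partial_S\phi_0)\,u$$ is a well-defined bounded linear bijection with bounded inverse. -/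

import Mathlib

open Set Filter Topology MeasureTheory
open scoped ContDiff ENNReal

noncomputable section

namespace RadialSobolev

/-- The plane `ℝ²` with its Euclidean norm. -/
abbrev Plane : Type := EuclideanSpace ℝ (Fin 2)

/-- The Japanese bracket `⟨x⟩ = (1 + |x|²)^{1/2}`. -/
def bracket (x : Plane) : ℝ := Real.sqrt (1 + ‖x‖ ^ 2)

/-- A smooth radial cut-off function on the plane, with values in `[0, 1]`, equal to `0` for
`|x| < 1` and to `1` for `|x| > 2`. -/
structure RadialCutoff where
  toFun : Plane → ℝ
  smooth : ContDiff ℝ ∞ toFun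
  radial : ∀ x y : Plane, ‖x‖ = ‖y‖ → toFun x = toFun y
  mem_Icc : ∀ x : Plane, toFun x ∈ Icc (0 : ℝ) 1
  eq_zero : ∀ x : Plane, ‖x‖ < 1 → toFun x = 0
  eq_one : ∀ x : Plane, 2 < ‖x‖ → toFun x = 1

/-- The function `m` of the weight at the origin: `m(x) = |x|` for `|x| < 1` and `m(x) = 1` for
`|x| > 2`, with a smooth positive transition in between. -/
def RadialCutoff.m (χ : RadialCutoff) (x : Plane) : ℝ :=
  ‖x‖ * (1 - χ.toFun x) + χ.toFun x

/-! ### Partial derivatives -/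

/-- The partial derivative `∂ᵢ u`. -/
def partialDeriv (i : Fin 2) (u : Plane → ℝ) : Plane → ℝ :=
  fun x => fderiv ℝ u x (EuclideanSpace.single i 1)

/-- The derivative `D^α u = ∂₀^{α₀} ∂₁^{α₁} u` for a multi-index `α = (α₀, α₁)`. -/
def multiDeriv (α : ℕ × ℕ) (u : Plane → ℝ) : Plane → ℝ :=
  (partialDeriv 0)^[α.1] ((partialDeriv 1)^[α.2] u)

theorem contDiff_partialDeriv (i : Fin 2) {u : Plane → ℝ} (hu : ContDiff ℝ ∞ u) :
    ContDiff ℝ ∞ (partialDeriv i u) := by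
  have h : ContDiff ℝ ∞ (fderiv ℝ u) := hu.fderiv_right (by simp)
  exact h.clm_apply contDiff_const

theorem contDiff_iterate_partialDeriv (i : Fin 2) (n : ℕ) :
    ∀ {u : Plane → ℝ}, ContDiff ℝ ∞ u → ContDiff ℝ ∞ ((partialDeriv i)^[n] u) := by
  induction n with
  | zero => intro u hu; exact hu
  | succ n ih => intro u hu; exact ih (contDiff_partialDeriv i hu)

theorem partialDeriv_add (i : Fin 2) {u v : Plane → ℝ} (hu : ContDiff ℝ ∞ u)
    (hv : ContDiff ℝ ∞ v) : partialDeriv i (u + v) = partialDeriv i u + partialDeriv i v := by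
  funext x
  have h1 : DifferentiableAt ℝ u x := (hu.differentiable (by simp)) x
  have h2 : DifferentiableAt ℝ v x := (hv.differentiable (by simp)) x
  simp [partialDeriv, fderiv_add h1 h2]

theorem partialDeriv_smul (i : Fin 2) (c : ℝ) {u : Plane → ℝ} (hu : ContDiff ℝ ∞ u) :
    partialDeriv i (c • u) = c • partialDeriv i u := by
  funext x
  have h1 : DifferentiableAt ℝ u x := (hu.differentiable (by simp)) x
  simp [partialDeriv, fderiv_const_smul h1 c]

theorem iterate_partialDeriv_add (i : Fin 2) (n : ℕ) :
    ∀ {u v : Plane → ℝ}, ContDiff ℝ ∞ u → ContDiff ℝ ∞ v →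
      (partialDeriv i)^[n] (u + v) = (partialDeriv i)^[n] u + (partialDeriv i)^[n] v := by
  induction n with
  | zero => intro u v _ _; rfl
  | succ n ih =>
    intro u v hu hv
    simp only [Function.iterate_succ, Function.comp_apply]
    rw [partialDeriv_add i hu hv, ih (contDiff_partialDeriv i hu) (contDiff_partialDeriv i hv)]

theorem iterate_partialDeriv_smul (i : Fin 2) (c : ℝ) (n : ℕ) :
    ∀ {u : Plane → ℝ}, ContDiff ℝ ∞ u →
      (partialDeriv i)^[n] (c • u) = c • (partialDeriv i)^[n] u := by
  induction n with
  | zero => intro u _; rfl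
  | succ n ih =>
    intro u hu
    simp only [Function.iterate_succ, Function.comp_apply]
    rw [partialDeriv_smul i c hu, ih (contDiff_partialDeriv i hu)]

theorem multiDeriv_add (α : ℕ × ℕ) {u v : Plane → ℝ} (hu : ContDiff ℝ ∞ u)
    (hv : ContDiff ℝ ∞ v) : multiDeriv α (u + v) = multiDeriv α u + multiDeriv α v := by
  unfold multiDeriv
  rw [iterate_partialDeriv_add 1 _ hu hv,
    iterate_partialDeriv_add 0 _ (contDiff_iterate_partialDeriv 1 _ hu)
      (contDiff_iterate_partialDeriv 1 _ hv)]

theorem multiDeriv_smul (α : ℕ × ℕ) (c : ℝ) {u : Plane → ℝ} (hu : ContDiff ℝ ∞ u) :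
    multiDeriv α (c • u) = c • multiDeriv α u := by
  unfold multiDeriv
  rw [iterate_partialDeriv_smul 1 c _ hu,
    iterate_partialDeriv_smul 0 c _ (contDiff_iterate_partialDeriv 1 _ hu)]

theorem multiDeriv_zero_fun (α : ℕ × ℕ) : multiDeriv α (0 : Plane → ℝ) = 0 := by
  have h := multiDeriv_smul α 0 (u := (0 : Plane → ℝ)) contDiff_const
  simpa using h

/-! ### Weighted Lebesgue and Sobolev spaces of real-valued functions -/

/-- The measure `w(x)² dx`. The space `Lp ℝ 2 (weightedMeasure w)` carries the norm
`‖u‖ = ‖w u‖_{L²(ℝ²)}`. -/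
def weightedMeasure (w : Plane → ℝ) : Measure Plane :=
  volume.withDensity fun x => ENNReal.ofReal (w x ^ 2)

/-- The multi-indices `α` with `|α| ≤ s`. -/
abbrev MultiIdx (s : ℕ) : Type :=
  ↥((Finset.range (s + 1) ×ˢ Finset.range (s + 1)).filter fun α : ℕ × ℕ => α.1 + α.2 ≤ s)

/-- The order `|α|`. -/
def MultiIdx.order {s : ℕ} (α : MultiIdx s) : ℕ := α.1.1 + α.1.2

def MultiIdx.zero (s : ℕ) : MultiIdx s := ⟨(0, 0), by simp⟩

/-- The multi-index of `∂ᵢ`. -/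
def MultiIdx.one (i : Fin 2) : MultiIdx 1 := ⟨(if i = 0 then 1 else 0, if i = 1 then 1 else 0), by
  fin_cases i <;> decide⟩

/-- Families `(F_α)_{|α| ≤ s}` with norm `∑_α ‖w_{|α|} F_α‖_{L²(ℝ²)}`. -/
abbrev Jet (s : ℕ) (w : ℕ → Plane → ℝ) : Type :=
  PiLp 1 fun α : MultiIdx s => Lp ℝ 2 (weightedMeasure (w α.order))

/-- The families `(D^α u)_{|α| ≤ s}` of test functions `u ∈ C₀^∞(ℝ²)`. -/
def testJets (s : ℕ) (w : ℕ → Plane → ℝ) : Submodule ℝ (Jet s w) where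
  carrier := {F | ∃ u : Plane → ℝ, ContDiff ℝ ∞ u ∧ HasCompactSupport u ∧
    ∀ α : MultiIdx s, (F α : Plane → ℝ) =ᵐ[weightedMeasure (w α.order)] multiDeriv α.1 u}
  zero_mem' := by
    refine ⟨0, contDiff_const, HasCompactSupport.zero, fun α => ?_⟩
    rw [multiDeriv_zero_fun]
    exact Lp.coeFn_zero _ _ _
  add_mem' := by
    rintro F G ⟨u, hu, hu', hF⟩ ⟨v, hv, hv', hG⟩
    refine ⟨u + v, hu.add hv, hu'.add hv', fun α => ?_⟩
    rw [multiDeriv_add _ hu hv]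
    exact (Lp.coeFn_add (F α) (G α)).trans ((hF α).add (hG α))
  smul_mem' := by
    rintro c F ⟨u, hu, hu', hF⟩
    refine ⟨c • u, contDiff_const.smul hu, hu'.smul_left (f := fun _ => c), fun α => ?_⟩
    rw [multiDeriv_smul _ c hu]
    exact (Lp.coeFn_smul c (F α)).trans ((hF α).const_smul c)

/-- The weighted Sobolev space: the completion of `C₀^∞(ℝ²)` for the norm
`∑_{|α| ≤ s} ‖w_{|α|} D^α u‖_{L²(ℝ²)}`, realized as the closure of the test functions in the
Banach space of jets. The component of index `α` is the derivative `D^α u`. -/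
def sobolev (s : ℕ) (w : ℕ → Plane → ℝ) : Submodule ℝ (Jet s w) :=
  (testJets s w).topologicalClosure

/-- The function `u` underlying a jet. -/
def Jet.val {s : ℕ} {w : ℕ → Plane → ℝ} (F : Jet s w) : Plane → ℝ := F (MultiIdx.zero s)

/-- The radially symmetric elements of a weighted Sobolev space. -/
def radialSobolev (s : ℕ) (w : ℕ → Plane → ℝ) : Submodule ℝ (Jet s w) where
  carrier := {F | F ∈ sobolev s w ∧ ∃ v : ℝ → ℝ, Measurable v ∧
    F.val =ᵐ[weightedMeasure (w (MultiIdx.zero s).order)] fun x => v ‖x‖}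
  zero_mem' := ⟨zero_mem _, 0, measurable_const, Lp.coeFn_zero _ _ _⟩
  add_mem' := by
    rintro F G ⟨hF, v, hm, hv⟩ ⟨hG, v', hm', hv'⟩
    exact ⟨add_mem hF hG, v + v', hm.add hm', (Lp.coeFn_add _ _).trans (hv.add hv')⟩
  smul_mem' := by
    rintro c F ⟨hF, v, hm, hv⟩
    exact ⟨Submodule.smul_mem _ c hF, c • v, hm.const_smul c, (Lp.coeFn_smul _ _).trans (hv.const_smul c)⟩

/-- The radially symmetric elements of the weighted Lebesgue space with norm `‖w u‖_{L²(ℝ²)}`. -/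
def radialL2 (w : Plane → ℝ) : Submodule ℝ (Lp ℝ 2 (weightedMeasure w)) where
  carrier := {f | ∃ v : ℝ → ℝ, Measurable v ∧
    (f : Plane → ℝ) =ᵐ[weightedMeasure w] fun x => v ‖x‖}
  zero_mem' := ⟨0, measurable_const, Lp.coeFn_zero _ _ _⟩
  add_mem' := by
    rintro f g ⟨v, hm, hv⟩ ⟨v', hm', hv'⟩
    exact ⟨v + v', hm.add hm', (Lp.coeFn_add _ _).trans (hv.add hv')⟩
  smul_mem' := by
    rintro c f ⟨v, hm, hv⟩
    exact ⟨c • v, hm.const_smul c, (Lp.coeFn_smul _ _).trans (hv.const_smul c)⟩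

/-- The weight `⟨x⟩^γ`, for derivatives of every order. -/
def singleWeight (γ : ℝ) : ℕ → Plane → ℝ := fun _ x => bracket x ^ γ

/-- The weight `m(x)^{σ + k} ⟨x⟩^γ` for derivatives of order `k`. -/
def doubleWeight (χ : RadialCutoff) (γ σ : ℝ) : ℕ → Plane → ℝ :=
  fun k x => χ.m x ^ (σ + k) * bracket x ^ γ

/-- `H^s_{r,γ}(ℝ²)`. -/
abbrev HSingle (s : ℕ) (γ : ℝ) : Type := radialSobolev s (singleWeight γ)

/-- `H^s_{r,γ,σ}(ℝ²)`. -/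
abbrev HDouble (χ : RadialCutoff) (s : ℕ) (γ σ : ℝ) : Type :=
  radialSobolev s (doubleWeight χ γ σ)

/-- `L²_{r,γ,σ}(ℝ²)`. -/
abbrev L2Double (χ : RadialCutoff) (γ σ : ℝ) : Type := radialL2 (doubleWeight χ γ σ 0)

/-- The radial derivative `∂_S φ = ∑ᵢ (xᵢ / |x|) ∂ᵢ φ` of `φ ∈ H¹`. -/
def Jet.radialDeriv {w : ℕ → Plane → ℝ} (F : Jet 1 w) : Plane → ℝ :=
  fun x => ∑ i : Fin 2, x i / ‖x‖ * (F (MultiIdx.one i) : Plane → ℝ) x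

/-! ### The spaces `Y` and `Z̃` -/

/-- `Y = H¹_{r,γ₁,σ₁+1} ⊕ {1/S} ⊕ ℝ`, as triples `(φ, a, c)` standing for `φ + a/S + c`, with norm
`‖φ‖ + |a| + |c|`. -/
abbrev YSpace (χ : RadialCutoff) (γ₁ σ₁ : ℝ) : Type :=
  WithLp 1 (HDouble χ 1 γ₁ (σ₁ + 1) × WithLp 1 (ℝ × ℝ))

/-- `Z̃ = L²_{r,γ₁,σ₁+2} ⊕ ℝ`, as pairs `(N, z)` standing for `N + z`, with norm `‖N‖ + |z|`. -/
abbrev ZSpace (χ : RadialCutoff) (γ₁ σ₁ : ℝ) : Type :=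
  WithLp 1 (L2Double χ γ₁ (σ₁ + 2) × ℝ)

variable {χ : RadialCutoff} {γ₁ σ₁ : ℝ}

/-- The function `φ(x) + a/|x| + c` represented by `(φ, a, c) ∈ Y`. -/
def YSpace.val (y : YSpace χ γ₁ σ₁) : Plane → ℝ :=
  fun x => y.fst.1.val x + (y.snd.fst / ‖x‖ + y.snd.snd)

/-- The derivative `∂_S (φ + a/S + c)`, where `S = |x|`. -/
def YSpace.radialDeriv (y : YSpace χ γ₁ σ₁) : Plane → ℝ :=
  fun x => y.fst.1.radialDeriv x + deriv (fun S : ℝ => y.snd.fst / S + y.snd.snd) ‖x‖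

/-- The function `N(x) + z` represented by `(N, z) ∈ Z̃`. -/
def ZSpace.val (z : ZSpace χ γ₁ σ₁) : Plane → ℝ :=
  fun x => (z.fst.1 : Plane → ℝ) x + z.snd

end RadialSobolev

end

noncomputable section

namespace RadialSobolev

/-! ### Weighted measures -/

/-! Put a = σ₁ + 2, so 0 < a < 1, and V = φ₀'. On radial profiles the equation is the scalar ODE u'
+ (1/r + 2βV)u = n. With Φ' = V, Φ(0+) = 0 and the integrating factor p(r) = r exp(2βΦ(r)) it reads
(pu)' = pn. Since V tends to κ > 0 and β < 0, p decays exponentially, so the homogeneous solution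
1/p grows and is excluded by the weight at infinity. This leaves u = -p⁻¹ ∫_r^∞ pn. Near the origin
u behaves like -A/r with A = ∫_0^∞ pn; this is too singular for the weighted H¹ because a < 1, and
it is exactly what the summand spanned by 1/S absorbs. A constant c is mapped to 2βκc + c(1/S + 2β(V
- κ)), whose second term is O(1/S) and lies in the weighted L² because a > 0 and γ₁ < 0. The system
is thus triangular, and the constant component c = z/(2βκ) is found first.

The estimates are one-dimensional. Near 0, Φ = O(r), so the kernel p(t)/p(r) is at most C t/r and a
Hardy inequality applies (`memLp_hardy`), while A(1/r - 1/p) is bounded. At infinity the kernel,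
conjugated by the weight, is dominated by a one-sided exponential (`memLp_exp_kernel`). Both bounds
are instances of Schur's test (`lintegral_schur`). Existence and uniqueness are
`IsDrift.exists_solution` and `IsDrift.homogeneous_eq_zero`; the inverse is bounded by the open
mapping theorem, the radial spaces being closed in complete ones.

The rest is a dictionary between closures of test jets and profiles. A radial element of H¹ has a
locally absolutely continuous profile (`exists_profile`); conversely such a profile with finite
norms comes from a jet, by truncation and smoothing (`isProfilePair`); and a jet is determined by
its function (`Jet.eq_zero_of_val`). The H³ hypothesis enters through local boundedness of V
(`locally_bounded_of_mem_sobolev`), which with the behaviour at infinity yields the global bounds of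
`exists_isDrift`. -/

theorem eLpNorm_two_sq {α : Type*} [MeasurableSpace α] (μ : Measure α) (f : α → ℝ) :
    eLpNorm f 2 μ ^ 2 = ∫⁻ x, ‖f x‖ₑ ^ 2 ∂μ := by
  have h := eLpNorm_nnreal_pow_eq_lintegral (μ := μ) (f := f) (p := 2) (by norm_num)
  simpa using h

theorem memLp_two_iff_lintegral {α : Type*} [MeasurableSpace α] {μ : Measure α} {f : α → ℝ}
    (hf : AEStronglyMeasurable f μ) : MemLp f 2 μ ↔ ∫⁻ x, ‖f x‖ₑ ^ 2 ∂μ < ⊤ := by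
  rw [← eLpNorm_two_sq]
  constructor
  · intro h
    exact ENNReal.pow_lt_top h.2
  · intro h
    refine ⟨hf, ?_⟩
    by_contra hc
    rw [not_lt, top_le_iff] at hc
    simp [hc] at h

theorem enorm_mul_sq (a b : ℝ) : ‖a * b‖ₑ ^ 2 = ENNReal.ofReal (a ^ 2) * ‖b‖ₑ ^ 2 := by
  rw [enorm_mul, mul_pow, Real.enorm_eq_ofReal_abs a, ← ENNReal.ofReal_pow (abs_nonneg a), sq_abs]

/-- The density is finite everywhere, so `f` need not be measurable. -/
theorem eLpNorm_weightedMeasure {w : Plane → ℝ} (hw : Measurable w) (f : Plane → ℝ) :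
    eLpNorm f 2 (weightedMeasure w) = eLpNorm (fun x => w x * f x) 2 volume := by
  have h : eLpNorm f 2 (weightedMeasure w) ^ 2 = eLpNorm (fun x => w x * f x) 2 volume ^ 2 := by
    rw [eLpNorm_two_sq, eLpNorm_two_sq, weightedMeasure,
      lintegral_withDensity_eq_lintegral_mul_non_measurable _ (by fun_prop) (by simp)]
    simp only [Pi.mul_apply, enorm_mul_sq]
  exact (ENNReal.pow_right_strictMono two_ne_zero).injective h

/-- A weight: a measurable function that is positive away from the origin. -/
structure IsWeight (w : Plane → ℝ) : Prop where
  measurable : Measurable w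
  pos : ∀ x, x ≠ 0 → 0 < w x

theorem ae_ne_zero : ∀ᵐ x : Plane, x ≠ 0 := by
  simp [ae_iff]

/-- A weight can vanish only at the origin, which is a null set; hence both measures have the same
null sets, and all almost-everywhere statements can be made for Lebesgue measure. -/
theorem IsWeight.ae_eq {w : Plane → ℝ} (hw : IsWeight w) :
    ae (weightedMeasure w) = ae (volume : Measure Plane) := by
  apply le_antisymm
  · exact (withDensity_absolutelyContinuous _ _).ae_le
  · refine (withDensity_absolutelyContinuous' ?_ ?_).ae_le
    · exact (hw.measurable.pow_const 2).ennreal_ofReal.aemeasurable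
    · filter_upwards [ae_ne_zero] with x hx
      have := hw.pos x hx
      simpa using this.ne'

theorem IsWeight.aestronglyMeasurable_iff {w : Plane → ℝ} (hw : IsWeight w) {f : Plane → ℝ} :
    AEStronglyMeasurable f (weightedMeasure w) ↔ AEStronglyMeasurable f volume := by
  constructor
  · rintro ⟨g, hg, h⟩
    exact ⟨g, hg, by rwa [EventuallyEq, ← hw.ae_eq]⟩
  · rintro ⟨g, hg, h⟩
    exact ⟨g, hg, by rwa [EventuallyEq, hw.ae_eq]⟩

theorem IsWeight.memLp_iff {w : Plane → ℝ} (hw : IsWeight w) {f : Plane → ℝ}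
    (hf : AEStronglyMeasurable f volume) :
    MemLp f 2 (weightedMeasure w) ↔ MemLp (fun x => w x * f x) 2 volume := by
  constructor
  · intro h
    exact ⟨hw.measurable.aestronglyMeasurable.mul hf, by rw [← eLpNorm_weightedMeasure hw.measurable]; exact h.2⟩
  · intro h
    exact ⟨hw.aestronglyMeasurable_iff.2 hf, by rw [eLpNorm_weightedMeasure hw.measurable]; exact h.2⟩

/-! ### The weights -/

theorem bracket_ge (x : Plane) : max 1 ‖x‖ ≤ bracket x := by
  refine max_le ?_ ?_
  · exact Real.one_le_sqrt.2 (by nlinarith [sq_nonneg ‖x‖])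
  · exact Real.le_sqrt_of_sq_le (by linarith)

theorem bracket_le (x : Plane) : bracket x ≤ 2 * max 1 ‖x‖ := by
  have h1 : (1 : ℝ) ≤ max 1 ‖x‖ := le_max_left _ _
  have h2 : ‖x‖ ≤ max 1 ‖x‖ := le_max_right _ _
  refine Real.sqrt_le_iff.2 ⟨by linarith, ?_⟩
  nlinarith [norm_nonneg x]

theorem bracket_pos (x : Plane) : 0 < bracket x :=
  lt_of_lt_of_le (by positivity) (bracket_ge x)

theorem continuous_bracket : Continuous bracket := by
  unfold bracket; fun_prop

/-- `m` is a convex combination of |x| and 1. -/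
theorem RadialCutoff.min_le_m (χ : RadialCutoff) (x : Plane) : min ‖x‖ 1 ≤ χ.m x := by
  obtain ⟨h0, h1⟩ := χ.mem_Icc x
  have e1 : min ‖x‖ 1 ≤ ‖x‖ := min_le_left _ _
  have e2 : min ‖x‖ 1 ≤ 1 := min_le_right _ _
  unfold RadialCutoff.m
  nlinarith

theorem RadialCutoff.m_le (χ : RadialCutoff) (x : Plane) : χ.m x ≤ 2 * min ‖x‖ 1 := by
  obtain ⟨h0, h1⟩ := χ.mem_Icc x
  unfold RadialCutoff.m
  have hn := norm_nonneg x
  rcases lt_or_ge ‖x‖ 1 with h | h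
  · rw [χ.eq_zero x h, min_eq_left h.le]; linarith
  · rw [min_eq_right h]
    rcases le_or_gt ‖x‖ 2 with h' | h'
    · nlinarith
    · rw [χ.eq_one x h']; linarith

theorem RadialCutoff.continuous_m (χ : RadialCutoff) : Continuous χ.m := by
  have := χ.smooth.continuous
  unfold RadialCutoff.m; fun_prop

theorem RadialCutoff.m_pos (χ : RadialCutoff) {x : Plane} (hx : x ≠ 0) : 0 < χ.m x :=
  lt_of_lt_of_le (lt_min (norm_pos_iff.2 hx) one_pos) (χ.min_le_m x)

theorem isWeight_doubleWeight (χ : RadialCutoff) (γ σ : ℝ) (k : ℕ) :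
    IsWeight (doubleWeight χ γ σ k) where
  measurable := (χ.continuous_m.measurable.pow_const _).mul
    (continuous_bracket.measurable.pow_const _)
  pos x hx := mul_pos (Real.rpow_pos_of_pos (χ.m_pos hx) _)
    (Real.rpow_pos_of_pos (bracket_pos x) _)

theorem continuousOn_doubleWeight (χ : RadialCutoff) (γ σ : ℝ) (k : ℕ) :
    ContinuousOn (doubleWeight χ γ σ k) {0}ᶜ := by
  refine ContinuousOn.mul ?_ ?_
  · exact χ.continuous_m.continuousOn.rpow_const fun x hx => Or.inl (χ.m_pos hx).ne'
  · exact continuous_bracket.continuousOn.rpow_const fun x _ => Or.inl (bracket_pos x).ne'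

theorem isWeight_singleWeight (γ : ℝ) (k : ℕ) : IsWeight (singleWeight γ k) where
  measurable := continuous_bracket.measurable.pow_const _
  pos x _ := Real.rpow_pos_of_pos (bracket_pos x) _

theorem rpow_le_of_comparable {a b : ℝ} (ha : 0 < a) (hab : a ≤ b) (hba : b ≤ 2 * a) (s : ℝ) :
    b ^ s ≤ 2 ^ |s| * a ^ s ∧ a ^ s ≤ 2 ^ |s| * b ^ s := by
  have hb : 0 < b := ha.trans_le hab
  have h1 : (1 : ℝ) ≤ 2 ^ |s| := Real.one_le_rpow (by norm_num) (abs_nonneg s)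
  rcases le_total 0 s with hs | hs
  · rw [abs_of_nonneg hs] at *
    constructor
    · rw [← Real.mul_rpow (by norm_num) ha.le]
      exact Real.rpow_le_rpow hb.le hba hs
    · have := Real.rpow_le_rpow ha.le hab hs
      nlinarith [Real.rpow_pos_of_pos hb s]
  · rw [abs_of_nonpos hs] at *
    constructor
    · have := Real.rpow_le_rpow_of_nonpos ha hab hs
      nlinarith [Real.rpow_pos_of_pos ha s]
    · have := Real.rpow_le_rpow_of_nonpos hb hba hs
      rw [Real.mul_rpow (by norm_num) ha.le] at this
      have e : (2 : ℝ) ^ (-s) * 2 ^ s = 1 := by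
        rw [← Real.rpow_add (by norm_num)]; simp
      calc a ^ s = 2 ^ (-s) * (2 ^ s * a ^ s) := by rw [← mul_assoc, e, one_mul]
        _ ≤ _ := by gcongr

/-- The power weight `r^s` for `r ≤ 1` and `r^γ` for `r ≥ 1`. -/
def profile (γ s r : ℝ) : ℝ := min r 1 ^ s * max 1 r ^ γ

theorem profile_pos (γ s : ℝ) {r : ℝ} (hr : 0 < r) : 0 < profile γ s r :=
  mul_pos (Real.rpow_pos_of_pos (lt_min hr one_pos) _)
    (Real.rpow_pos_of_pos (lt_max_of_lt_left one_pos) _)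

theorem profile_of_le {r : ℝ} (γ s : ℝ) (hr : r ≤ 1) : profile γ s r = r ^ s := by
  simp [profile, min_eq_left hr, max_eq_left hr]

theorem profile_of_ge {r : ℝ} (γ s : ℝ) (hr : 1 ≤ r) : profile γ s r = r ^ γ := by
  simp [profile, min_eq_right hr, max_eq_right hr]

theorem measurable_profile (γ s : ℝ) : Measurable (profile γ s) := by
  unfold profile
  exact ((measurable_id.min measurable_const).pow_const _).mul
    ((measurable_const.max measurable_id).pow_const _)

/-- Up to constants only the pure powers at 0 and at infinity matter; the cut-off disappears from
the one-dimensional analysis. -/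
theorem doubleWeight_comparable (χ : RadialCutoff) (γ σ : ℝ) (k : ℕ) :
    ∃ C : ℝ, 0 < C ∧ ∀ x : Plane, x ≠ 0 →
      doubleWeight χ γ σ k x ≤ C * profile γ (σ + k) ‖x‖ ∧
      profile γ (σ + k) ‖x‖ ≤ C * doubleWeight χ γ σ k x := by
  refine ⟨2 ^ |σ + k| * 2 ^ |γ|, by positivity, fun x hx => ?_⟩
  have hn := norm_pos_iff.2 hx
  have hmin : 0 < min ‖x‖ 1 := lt_min hn one_pos
  have hmax : 0 < max 1 ‖x‖ := lt_max_of_lt_left one_pos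
  obtain ⟨a1, a2⟩ := rpow_le_of_comparable hmin (χ.min_le_m x) (χ.m_le x) (σ + k)
  obtain ⟨b1, b2⟩ := rpow_le_of_comparable hmax (bracket_ge x) (bracket_le x) γ
  have hm := Real.rpow_nonneg (χ.m_pos hx).le (σ + k)
  have hb := Real.rpow_nonneg (bracket_pos x).le γ
  have h3 := Real.rpow_nonneg hmin.le (σ + k)
  have h4 := Real.rpow_nonneg hmax.le γ
  unfold doubleWeight profile
  constructor
  · calc _ ≤ (2 ^ |σ + k| * min ‖x‖ 1 ^ (σ + k)) * (2 ^ |γ| * max 1 ‖x‖ ^ γ) := by gcongr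
      _ = _ := by ring
  · calc _ ≤ (2 ^ |σ + k| * χ.m x ^ (σ + k)) * (2 ^ |γ| * bracket x ^ γ) := by gcongr
      _ = _ := by ring

/-! ### Polar coordinates -/

/-- The unit circle of the plane. -/
abbrev Circ : Type := Metric.sphere (0 : Plane) 1

/-- The arc length measure on the unit circle. -/
abbrev arc : Measure Circ := (volume : Measure Plane).toSphere

theorem lintegral_polar {f : Plane → ℝ≥0∞} (hf : Measurable f) :
    ∫⁻ x, f x = ∫⁻ θ : Circ, (∫⁻ r in Ioi (0 : ℝ), ENNReal.ofReal r * f (r • (θ : Plane))) ∂arc := by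
  have hfr : Module.finrank ℝ Plane - 1 = 1 := by simp
  have h1 : ∫⁻ x, f x = ∫⁻ x : ({0}ᶜ : Set Plane), f x ∂(Measure.comap Subtype.val volume) := by
    rw [lintegral_subtype_comap (measurableSet_singleton _).compl, restrict_compl_singleton]
  have h2 := (volume : Measure Plane).measurePreserving_homeomorphUnitSphereProd.lintegral_comp_emb
    (Homeomorph.measurableEmbedding _) (fun p => f (p.2.1 • p.1.1))
  have h3 : ∀ x : ({0}ᶜ : Set Plane),
      f ((homeomorphUnitSphereProd Plane x).2.1 • (homeomorphUnitSphereProd Plane x).1.1) = f x := by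
    intro x
    have hx : ‖(x : Plane)‖ ≠ 0 := norm_ne_zero_iff.2 x.2
    simp [smul_smul, hx]
  rw [h1]
  simp_rw [h3] at h2
  rw [h2, hfr, lintegral_prod _ (by fun_prop)]
  refine lintegral_congr fun θ => ?_
  rw [Measure.volumeIoiPow, lintegral_withDensity_eq_lintegral_mul₀ (by fun_prop)
    (by fun_prop), ← lintegral_subtype_comap measurableSet_Ioi]
  simp

instance : NeZero (arc : Measure Circ) := ⟨Measure.toSphere_ne_zero _⟩

theorem lintegral_radial {f : ℝ → ℝ≥0∞} (hf : Measurable f) :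
    ∫⁻ x : Plane, f ‖x‖ = arc univ * ∫⁻ r in Ioi (0 : ℝ), ENNReal.ofReal r * f r := by
  rw [lintegral_polar (by fun_prop)]
  have : ∀ θ : Circ, ∫⁻ r in Ioi (0 : ℝ), ENNReal.ofReal r * f ‖r • (θ : Plane)‖
      = ∫⁻ r in Ioi (0 : ℝ), ENNReal.ofReal r * f r := by
    intro θ
    refine setLIntegral_congr_fun measurableSet_Ioi fun r hr => ?_
    have : ‖r • (θ : Plane)‖ = r := by simp [norm_smul, abs_of_pos hr.out]
    simp only [this]
  rw [lintegral_congr this, lintegral_const, mul_comm]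

/-- Polar coordinates applied to the indicator of the exceptional set; the Jacobian r does not
vanish on (0, ∞). -/
theorem ae_iff_ae_polar {P : Plane → Prop} (hP : MeasurableSet {x | P x}) :
    (∀ᵐ x, P x) ↔ ∀ᵐ θ : Circ ∂arc, ∀ᵐ r : ℝ, 0 < r → P (r • (θ : Plane)) := by
  have hm : Measurable (indicator {x | P x}ᶜ (1 : Plane → ℝ≥0∞)) :=
    measurable_one.indicator hP.compl
  have h1 : (∀ᵐ x, P x) ↔ ∫⁻ x, indicator {x | P x}ᶜ (1 : Plane → ℝ≥0∞) x = 0 := by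
    rw [lintegral_indicator_one hP.compl]; rfl
  rw [h1, lintegral_polar hm, lintegral_eq_zero_iff']
  · refine eventually_congr (Eventually.of_forall fun θ => ?_)
    rw [Pi.zero_apply, lintegral_eq_zero_iff' (by fun_prop), EventuallyEq,
      ae_restrict_iff' measurableSet_Ioi]
    refine eventually_congr (Eventually.of_forall fun r => ?_)
    refine imp_congr_right fun hr => ?_
    have hr' : 0 < r := hr
    by_cases h : P (r • (θ : Plane)) <;> simp [h, hr']
  · refine Measurable.aemeasurable ?_
    refine Measurable.lintegral_prod_right' (f := fun p : Circ × ℝ =>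
      ENNReal.ofReal p.2 * indicator {x | P x}ᶜ (1 : Plane → ℝ≥0∞) (p.2 • (p.1 : Plane))) ?_
    fun_prop

theorem ae_norm_of_ae {P : ℝ → Prop} (h : ∀ᵐ r : ℝ, 0 < r → P r) : ∀ᵐ x : Plane, P ‖x‖ := by
  obtain ⟨s, hs, hsm, hs0⟩ := exists_measurable_superset_of_null h
  have : ∀ᵐ x : Plane, ‖x‖ ∉ s := by
    refine (ae_iff_ae_polar (P := fun x => ‖x‖ ∉ s) (measurable_norm hsm.compl)).2 ?_
    refine Eventually.of_forall fun θ => ?_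
    have : ∀ᵐ r : ℝ, r ∉ s := measure_eq_zero_iff_ae_notMem.1 hs0
    filter_upwards [this] with r hr hr0
    simpa [norm_smul, abs_of_pos hr0, norm_eq_of_mem_sphere] using hr
  filter_upwards [this, ae_ne_zero] with x hx hx0
  by_contra hP
  exact hx (hs (by simp only [mem_compl_iff]; exact fun h => hP (h (norm_pos_iff.2 hx0))))

/-- Almost every ray meets the exceptional set in a null set, and a single such ray suffices because
the property depends on |x| alone. -/
theorem ae_of_ae_norm {P : ℝ → Prop} (h : ∀ᵐ x : Plane, P ‖x‖) : ∀ᵐ r : ℝ, 0 < r → P r := by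
  obtain ⟨s, hs, hsm, hs0⟩ := exists_measurable_superset_of_null h
  have hs1 : ∀ᵐ x : Plane, x ∉ s := measure_eq_zero_iff_ae_notMem.1 hs0
  replace hs1 := (ae_iff_ae_polar (P := fun x => x ∉ s) hsm.compl).1 hs1
  obtain ⟨θ, hθ⟩ := hs1.exists
  filter_upwards [hθ] with r hr hr0
  by_contra hP
  refine hr hr0 (hs ?_)
  simpa [norm_smul, abs_of_pos hr0] using hP

theorem arc_univ_ne_zero : arc univ ≠ 0 := by
  simp only [ne_eq, Measure.measure_univ_eq_zero]
  exact NeZero.ne _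

/-- Membership of a radial function in a weighted `L²` space, in terms of its profile. -/
theorem memLp_radial_iff (χ : RadialCutoff) (γ σ : ℝ) (k : ℕ) {f : ℝ → ℝ} (hf : Measurable f) :
    MemLp (fun x : Plane => f ‖x‖) 2 (weightedMeasure (doubleWeight χ γ σ k)) ↔
      MemLp (fun r => r ^ (σ + k + 1 / 2) * f r) 2 (volume.restrict (Ioc 0 1)) ∧
      MemLp (fun r => r ^ (γ + 1 / 2) * f r) 2 (volume.restrict (Ioi 1)) := by
  have hw := isWeight_doubleWeight χ γ σ k
  have hp := measurable_profile γ (σ + k)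
  have hfn : Measurable fun x : Plane => f ‖x‖ := hf.comp measurable_norm
  have hpn : Measurable fun x : Plane => profile γ (σ + k) ‖x‖ := hp.comp measurable_norm
  rw [hw.memLp_iff hfn.aestronglyMeasurable]
  obtain ⟨C, hC, hcomp⟩ := doubleWeight_comparable χ γ σ k
  have e1 : MemLp (fun x => doubleWeight χ γ σ k x * f ‖x‖) 2 volume ↔
      MemLp (fun x : Plane => profile γ (σ + k) ‖x‖ * f ‖x‖) 2 volume := by
    constructor
    · intro h
      refine h.of_le_mul (c := C) (hpn.mul hfn).aestronglyMeasurable ?_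
      filter_upwards [ae_ne_zero] with x hx
      have := (hcomp x hx).2
      rw [norm_mul, norm_mul, Real.norm_of_nonneg (profile_pos _ _ (norm_pos_iff.2 hx)).le,
        Real.norm_of_nonneg (hw.pos x hx).le, ← mul_assoc]
      gcongr
    · intro h
      refine h.of_le_mul (c := C) (hw.measurable.mul hfn).aestronglyMeasurable ?_
      filter_upwards [ae_ne_zero] with x hx
      have := (hcomp x hx).1
      rw [norm_mul, norm_mul, Real.norm_of_nonneg (profile_pos _ _ (norm_pos_iff.2 hx)).le,
        Real.norm_of_nonneg (hw.pos x hx).le, ← mul_assoc]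
      gcongr
  rw [e1, memLp_two_iff_lintegral (by fun_prop),
    lintegral_radial (f := fun r => ‖profile γ (σ + k) r * f r‖ₑ ^ 2) (by fun_prop),
    memLp_two_iff_lintegral (by fun_prop),
    memLp_two_iff_lintegral (by fun_prop)]
  have hsplit : (Ioi (0 : ℝ)) = Ioc 0 1 ∪ Ioi 1 := (Ioc_union_Ioi_eq_Ioi zero_le_one).symm
  -- The Jacobian r is absorbed into the square as r^(1/2); this is the source of the shifts by 1/2
  -- in all exponents below.
  have e2 : ∀ (t r : ℝ), 0 < r → ENNReal.ofReal r * ‖r ^ t * f r‖ₑ ^ 2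
      = ‖r ^ (t + 1 / 2) * f r‖ₑ ^ 2 := by
    intro t r hr
    rw [enorm_mul_sq, enorm_mul_sq, ← mul_assoc, ← ENNReal.ofReal_mul hr.le]
    congr 2
    rw [Real.rpow_add hr, mul_pow, ← Real.sqrt_eq_rpow, Real.sq_sqrt hr.le, mul_comm]
  rw [hsplit, lintegral_union measurableSet_Ioi
    (by rw [Set.disjoint_left]; rintro x ⟨_, h⟩ h'; exact absurd h (not_le.2 h'))]
  have i1 : ∫⁻ r in Ioc (0 : ℝ) 1, ENNReal.ofReal r * ‖profile γ (σ + k) r * f r‖ₑ ^ 2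
      = ∫⁻ r in Ioc (0 : ℝ) 1, ‖r ^ (σ + k + 1 / 2) * f r‖ₑ ^ 2 :=
    setLIntegral_congr_fun measurableSet_Ioc fun r hr => by
      simp only [profile_of_le γ _ hr.2, e2 _ _ hr.1]
  have i2 : ∫⁻ r in Ioi (1 : ℝ), ENNReal.ofReal r * ‖profile γ (σ + k) r * f r‖ₑ ^ 2
      = ∫⁻ r in Ioi (1 : ℝ), ‖r ^ (γ + 1 / 2) * f r‖ₑ ^ 2 :=
    setLIntegral_congr_fun measurableSet_Ioi fun r hr => by
      simp only [profile_of_ge γ _ (le_of_lt hr.out), e2 _ _ (one_pos.trans hr.out)]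
  rw [i1, i2, ENNReal.mul_lt_top_iff]
  simp only [measure_lt_top, arc_univ_ne_zero, true_and, false_or, ENNReal.add_lt_top]
  constructor
  · rintro (h | h)
    · exact h
    · rw [add_eq_zero] at h
      rw [h.1, h.2]; simp
  · exact Or.inl

/-! ### Locally absolutely continuous functions on the half-line -/

/-- `v` is locally absolutely continuous on `(0, ∞)`, with derivative `g` almost everywhere. -/
structure HasRadialDeriv (v g : ℝ → ℝ) : Prop where
  ac : ∀ a b, 0 < a → 0 < b → AbsolutelyContinuousOnInterval v a b
  hasDerivAt : ∀ᵐ r : ℝ, 0 < r → HasDerivAt v (g r) r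

theorem uIcc_subset_Ioi {a b : ℝ} (ha : 0 < a) (hb : 0 < b) : uIcc a b ⊆ Ioi 0 :=
  fun _ hx => lt_of_lt_of_le (lt_min ha hb) hx.1

theorem uIoc_subset_Ioi {a b : ℝ} (ha : 0 < a) (hb : 0 < b) : uIoc a b ⊆ Ioi 0 :=
  uIoc_subset_uIcc.trans (uIcc_subset_Ioi ha hb)

theorem absolutelyContinuousOnInterval_congr {f g : ℝ → ℝ} {a b : ℝ}
    (hf : AbsolutelyContinuousOnInterval f a b) (h : EqOn f g (uIcc a b)) :
    AbsolutelyContinuousOnInterval g a b := by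
  rw [absolutelyContinuousOnInterval_iff] at hf ⊢
  intro ε hε
  obtain ⟨δ, hδ, H⟩ := hf ε hε
  refine ⟨δ, hδ, fun E hE hlt => ?_⟩
  refine lt_of_eq_of_lt ?_ (H E hE hlt)
  refine Finset.sum_congr rfl fun i hi => ?_
  have := hE.1 i hi
  rw [h this.1, h this.2]

namespace HasRadialDeriv

variable {v g v' g' : ℝ → ℝ} {a b : ℝ}

theorem congr (h : HasRadialDeriv v g) (hv : EqOn v v' (Ioi 0))
    (hg : ∀ᵐ r : ℝ, 0 < r → g r = g' r) : HasRadialDeriv v' g' where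
  ac a b ha hb := absolutelyContinuousOnInterval_congr (h.ac a b ha hb)
    (hv.mono (uIcc_subset_Ioi ha hb))
  hasDerivAt := by
    filter_upwards [h.hasDerivAt, hg] with r h1 h2 hr
    rw [← h2 hr]
    exact (h1 hr).congr_of_eventuallyEq ((hv.eventuallyEq_of_mem (Ioi_mem_nhds hr)).symm)

theorem deriv_ae (h : HasRadialDeriv v g) : ∀ᵐ r : ℝ, 0 < r → deriv v r = g r := by
  filter_upwards [h.hasDerivAt] with r hr h0 using (hr h0).deriv

theorem intervalIntegrable (h : HasRadialDeriv v g) (ha : 0 < a) (hb : 0 < b) :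
    IntervalIntegrable g volume a b := by
  refine (h.ac a b ha hb).intervalIntegrable_deriv.congr_ae ?_
  rw [EventuallyEq, ae_restrict_iff' measurableSet_uIoc]
  filter_upwards [h.deriv_ae] with r hr hm using hr (uIoc_subset_Ioi ha hb hm)

theorem integral_eq_sub (h : HasRadialDeriv v g) (ha : 0 < a) (hb : 0 < b) :
    ∫ x in a..b, g x = v b - v a := by
  rw [← (h.ac a b ha hb).integral_deriv_eq_sub]
  refine intervalIntegral.integral_congr_ae ?_
  filter_upwards [h.deriv_ae] with r hr hm using (hr (uIoc_subset_Ioi ha hb hm)).symm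

theorem continuousOn (h : HasRadialDeriv v g) : ContinuousOn v (Ioi 0) := by
  intro r hr
  have hr : 0 < r := hr
  have := (h.ac (r / 2) (r + 1) (by positivity) (by positivity)).continuousOn
  refine (this.continuousAt ?_).continuousWithinAt
  rw [uIcc_of_le (by linarith)]
  exact Icc_mem_nhds (by linarith) (by linarith)

theorem add (h : HasRadialDeriv v g) (h' : HasRadialDeriv v' g') :
    HasRadialDeriv (fun r => v r + v' r) (fun r => g r + g' r) where
  ac a b ha hb := (h.ac a b ha hb).add (h'.ac a b ha hb)
  hasDerivAt := by
    filter_upwards [h.hasDerivAt, h'.hasDerivAt] with r h1 h2 hr using (h1 hr).add (h2 hr)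

theorem mul (h : HasRadialDeriv v g) (h' : HasRadialDeriv v' g') :
    HasRadialDeriv (fun r => v r * v' r) (fun r => g r * v' r + v r * g' r) where
  ac a b ha hb := (h.ac a b ha hb).mul (h'.ac a b ha hb)
  hasDerivAt := by
    filter_upwards [h.hasDerivAt, h'.hasDerivAt] with r h1 h2 hr using (h1 hr).mul (h2 hr)

/-- Lebesgue's differentiation theorem holds on each interval (1/(n+1), n+1), and countably many of
these exhaust the half-line. -/
theorem primitive {r₀ c : ℝ} (hr₀ : 0 < r₀)
    (hg : ∀ a b, 0 < a → 0 < b → IntervalIntegrable g volume a b)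
    (hv : ∀ r, 0 < r → v r = c + ∫ x in r₀..r, g x) : HasRadialDeriv v g := by
  have key : ∀ a b, 0 < a → 0 < b → AbsolutelyContinuousOnInterval v a b := by
    intro a b ha hb
    have h1 := (hg a b ha hb).absolutelyContinuousOnInterval_intervalIntegral
      (c := a) left_mem_uIcc
    have h2 : AbsolutelyContinuousOnInterval (fun _ : ℝ => v a) a b :=
      (contDiff_const (n := 1)).contDiffOn.absolutelyContinuousOnInterval
    refine absolutelyContinuousOnInterval_congr (h2.add h1) fun r hr => ?_
    have hr0 : 0 < r := uIcc_subset_Ioi ha hb hr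
    rw [Pi.add_apply, hv a ha, hv r hr0, add_assoc,
      intervalIntegral.integral_add_adjacent_intervals (hg _ _ hr₀ ha) (hg _ _ ha hr0)]
  refine ⟨key, ?_⟩
  have h1 : ∀ n : ℕ, ∀ᵐ r : ℝ, r ∈ Ioo (1 / ((n : ℝ) + 1)) (n + 1) → HasDerivAt v (g r) r := by
    intro n
    have hn : 0 < 1 / ((n : ℝ) + 1) := by positivity
    have hn' : 0 < (n : ℝ) + 1 := by positivity
    filter_upwards [(hg _ _ hn hn').ae_hasDerivAt_integral] with r hr hmem
    have hr0 : 0 < r := hn.trans hmem.1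
    have hu : r ∈ uIcc (1 / ((n : ℝ) + 1)) (n + 1) :=
      Icc_subset_uIcc ⟨hmem.1.le, hmem.2.le⟩
    have h3 := (hr hu _ left_mem_uIcc).const_add (v (1 / ((n : ℝ) + 1)))
    refine h3.congr_of_eventuallyEq ?_
    filter_upwards [Ioi_mem_nhds hr0] with s hs
    rw [hv _ hn, hv s hs, add_assoc,
      intervalIntegral.integral_add_adjacent_intervals (hg _ _ hr₀ hn) (hg _ _ hn hs)]
  filter_upwards [ae_all_iff.2 h1] with r hr hr0
  obtain ⟨n, hn⟩ := exists_nat_gt (max r (1 / r))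
  have a1 : r < n := (le_max_left _ _).trans_lt hn
  have a2 : 1 / r < n := (le_max_right _ _).trans_lt hn
  refine hr n ⟨?_, by linarith⟩
  rw [div_lt_comm₀ (by positivity) hr0]
  linarith

theorem of_hasDerivAt (h : ∀ r, 0 < r → HasDerivAt v (g r) r)
    (hg : ∀ a b, 0 < a → 0 < b → IntervalIntegrable g volume a b) : HasRadialDeriv v g := by
  refine primitive (r₀ := 1) (c := v 1) one_pos hg fun r hr => ?_
  rw [intervalIntegral.integral_eq_sub_of_hasDerivAt
    (fun x hx => h x (uIcc_subset_Ioi one_pos hr hx)) (hg _ _ one_pos hr)]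
  ring

theorem of_hasDerivAt_continuousOn (h : ∀ r, 0 < r → HasDerivAt v (g r) r)
    (hg : ContinuousOn g (Ioi 0)) : HasRadialDeriv v g :=
  of_hasDerivAt h fun _ _ ha hb => (hg.mono (uIcc_subset_Ioi ha hb)).intervalIntegrable

theorem const (c : ℝ) : HasRadialDeriv (fun _ => c) (fun _ => 0) :=
  of_hasDerivAt_continuousOn (fun r _ => hasDerivAt_const r c) continuousOn_const

theorem const_mul (c : ℝ) (h : HasRadialDeriv v g) :
    HasRadialDeriv (fun r => c * v r) (fun r => c * g r) :=
  ((const c).mul h).congr (fun _ _ => rfl) (Eventually.of_forall fun _ _ => by simp)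

theorem div_id (a : ℝ) : HasRadialDeriv (fun r => a / r) (fun r => -a / r ^ 2) := by
  refine of_hasDerivAt_continuousOn (fun r hr => ?_) ?_
  · simpa [div_eq_mul_inv] using (hasDerivAt_inv hr.ne').const_mul a
  · exact continuousOn_const.div (by fun_prop) fun r hr => pow_ne_zero 2 (ne_of_gt hr)

theorem eq_of_ae_zero (h : HasRadialDeriv v g) (hg : ∀ᵐ r : ℝ, 0 < r → g r = 0) :
    ∀ r, 0 < r → v r = v 1 := by
  intro r hr
  have h1 := h.integral_eq_sub one_pos hr
  rw [intervalIntegral.integral_zero_ae] at h1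
  · linarith
  · filter_upwards [hg] with x hx hm using hx (uIoc_subset_Ioi one_pos hr hm)

theorem eqOn_of_ae_eq (h : HasRadialDeriv v g) (h' : HasRadialDeriv v' g')
    (hv : ∀ᵐ r : ℝ, 0 < r → v r = v' r) : EqOn v v' (Ioi 0) := by
  refine Measure.eqOn_open_of_ae_eq (μ := volume) ?_ isOpen_Ioi h.continuousOn h'.continuousOn
  rw [EventuallyEq, ae_restrict_iff' measurableSet_Ioi]
  exact hv

theorem deriv_ae_eq (h : HasRadialDeriv v g) (h' : HasRadialDeriv v' g')
    (hv : ∀ᵐ r : ℝ, 0 < r → v r = v' r) : ∀ᵐ r : ℝ, 0 < r → g r = g' r := by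
  have he := h.eqOn_of_ae_eq h' hv
  filter_upwards [h.hasDerivAt, h'.hasDerivAt] with r h1 h2 hr
  exact ((h1 hr).congr_of_eventuallyEq
    ((he.eventuallyEq_of_mem (Ioi_mem_nhds hr)).symm)).unique (h2 hr)

/-- Limits of locally absolutely continuous functions whose derivatives converge locally in `L¹`. -/
theorem of_tendsto {f f' : ℕ → ℝ → ℝ} (hf : ∀ n, HasRadialDeriv (f n) (f' n))
    (hv : ∀ᵐ r : ℝ, 0 < r → Tendsto (fun n => f n r) atTop (𝓝 (v r)))
    (hg : ∀ a b, 0 < a → 0 < b → IntervalIntegrable g volume a b)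
    (hlim : ∀ a b, 0 < a → a ≤ b →
      Tendsto (fun n => ∫⁻ r in Icc a b, ‖f' n r - g r‖ₑ) atTop (𝓝 0)) :
    ∃ u, HasRadialDeriv u g ∧ ∀ᵐ r : ℝ, 0 < r → v r = u r := by
  -- A point of convergence fixes the constant of integration; convergence of the integrals of the
  -- derivatives then identifies the limit with a primitive of `g`.
  have : ∃ r₀ : ℝ, 0 < r₀ ∧ Tendsto (fun n => f n r₀) atTop (𝓝 (v r₀)) := by
    have h1 : ∃ᵐ r : ℝ, 0 < r := by
      rw [frequently_ae_iff]
      change volume (Ioi (0 : ℝ)) ≠ 0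
      simp
    obtain ⟨r₀, h0, h1⟩ := (h1.and_eventually hv).exists
    exact ⟨r₀, h0, h1 h0⟩
  obtain ⟨r₀, hr₀, hlim₀⟩ := this
  refine ⟨fun r => v r₀ + ∫ x in r₀..r, g x, primitive hr₀ hg fun r _ => rfl, ?_⟩
  filter_upwards [hv] with r hr hr0
  have h1 : Tendsto (fun n => ∫ x in r₀..r, f' n x) atTop (𝓝 (∫ x in r₀..r, g x)) := by
    rw [tendsto_iff_norm_sub_tendsto_zero]
    have h2 := hlim (min r₀ r) (max r₀ r) (lt_min hr₀ hr0) min_le_max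
    have h3 := (ENNReal.tendsto_toReal ENNReal.zero_ne_top).comp h2
    have hle : ∀ n, ‖(∫ x in r₀..r, f' n x) - ∫ x in r₀..r, g x‖ₑ
        ≤ ∫⁻ r in Icc (min r₀ r) (max r₀ r), ‖f' n r - g r‖ₑ := by
      intro n
      rw [← intervalIntegral.integral_sub ((hf n).intervalIntegrable hr₀ hr0) (hg _ _ hr₀ hr0),
        ← ofReal_norm, intervalIntegral.norm_integral_eq_norm_integral_uIoc,
        ofReal_norm]
      refine (enorm_integral_le_lintegral_enorm _).trans ?_
      exact lintegral_mono_set uIoc_subset_uIcc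
    have h4 : Tendsto (fun n => ‖(∫ x in r₀..r, f' n x) - ∫ x in r₀..r, g x‖ₑ) atTop (𝓝 0) :=
      tendsto_of_tendsto_of_tendsto_of_le_of_le tendsto_const_nhds h2 (fun _ => zero_le) hle
    have h5 := (ENNReal.tendsto_toReal ENNReal.zero_ne_top).comp h4
    simpa [Function.comp_def] using h5
  have h2 : Tendsto (fun n => f n r₀ + ∫ x in r₀..r, f' n x) atTop
      (𝓝 (v r₀ + ∫ x in r₀..r, g x)) := hlim₀.add h1
  refine tendsto_nhds_unique (hr hr0) (h2.congr fun n => ?_)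
  rw [(hf n).integral_eq_sub hr₀ hr0]; ring

end HasRadialDeriv

/-! ### The radial structure of Sobolev functions -/

theorem tendsto_zero_of_sq {ι : Type*} {l : Filter ι} {f : ι → ℝ≥0∞}
    (h : Tendsto (fun n => f n ^ 2) l (𝓝 0)) : Tendsto f l (𝓝 0) := by
  have h2 := ((ENNReal.continuous_rpow_const (y := (1 / 2 : ℝ))).tendsto 0).comp h
  rw [ENNReal.zero_rpow_of_pos (by norm_num)] at h2
  refine h2.congr fun n => ?_
  rw [Function.comp_apply, ← ENNReal.rpow_natCast, ← ENNReal.rpow_mul]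
  norm_num

/-- Each component of a jet is controlled by the full norm, so one test function approximates all
derivatives at once. -/
theorem exists_test_approx {s : ℕ} {w : ℕ → Plane → ℝ} {F : Jet s w} (hF : F ∈ sobolev s w)
    {ε : ℝ} (hε : 0 < ε) :
    ∃ u : Plane → ℝ, ContDiff ℝ ∞ u ∧ HasCompactSupport u ∧ ∀ α : MultiIdx s,
      eLpNorm (fun x => multiDeriv α.1 u x - F α x) 2 (weightedMeasure (w α.order))
        ≤ ENNReal.ofReal ε := by
  have h1 : F ∈ closure (testJets s w : Set (Jet s w)) := hF
  obtain ⟨G, ⟨u, hu, hu', hG⟩, hd⟩ := Metric.mem_closure_iff.1 h1 ε hε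
  refine ⟨u, hu, hu', fun α => ?_⟩
  have h2 : ‖G α - F α‖ ≤ ε := by
    rw [← PiLp.sub_apply]
    refine (PiLp.norm_apply_le _ _).trans ?_
    rw [← dist_eq_norm, dist_comm]; exact hd.le
  rw [Lp.norm_def] at h2
  have h3 : eLpNorm (fun x => multiDeriv α.1 u x - F α x) 2 (weightedMeasure (w α.order))
      = eLpNorm (G α - F α : Lp ℝ 2 (weightedMeasure (w α.order))) 2
        (weightedMeasure (w α.order)) := by
    refine eLpNorm_congr_ae ?_
    filter_upwards [Lp.coeFn_sub (G α) (F α), hG α] with x h4 h5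
    rw [h4, Pi.sub_apply, h5]
  rw [h3]
  exact ENNReal.le_ofReal_iff_toReal_le (Lp.memLp _).2.ne hε.le |>.2 h2

/-- The radial component `∑ᵢ (xᵢ / |x|) Gᵢ` of a vector field. -/
def radialComp (G : Fin 2 → Plane → ℝ) : Plane → ℝ := fun x => ∑ i : Fin 2, x i / ‖x‖ * G i x

theorem abs_coord_div_norm_le (i : Fin 2) (x : Plane) : |x i / ‖x‖| ≤ 1 := by
  rw [abs_div, abs_norm]
  exact div_le_one_of_le₀ (PiLp.norm_apply_le x i) (norm_nonneg x)

theorem measurable_coord_div_norm (i : Fin 2) : Measurable fun x : Plane => x i / ‖x‖ := by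
  fun_prop

theorem eLpNorm_radialComp_sub_le {w : Plane → ℝ} {G H : Fin 2 → Plane → ℝ}
    (hG : ∀ i, Measurable (G i)) (hH : ∀ i, Measurable (H i)) :
    eLpNorm (fun x => radialComp G x - radialComp H x) 2 (weightedMeasure w)
      ≤ ∑ i, eLpNorm (fun x => G i x - H i x) 2 (weightedMeasure w) := by
  have h1 : (fun x => radialComp G x - radialComp H x)
      = ∑ i, fun x : Plane => x i / ‖x‖ * (G i x - H i x) := by
    funext x
    simp only [radialComp, Finset.sum_apply, ← Finset.sum_sub_distrib, mul_sub]
  rw [h1]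
  refine (eLpNorm_sum_le (fun i _ => ?_) (by norm_num)).trans (Finset.sum_le_sum fun i _ => ?_)
  · exact ((measurable_coord_div_norm i).mul ((hG i).sub (hH i))).aestronglyMeasurable
  · refine eLpNorm_mono fun x => ?_
    rw [norm_mul]
    exact mul_le_of_le_one_left (norm_nonneg _) (abs_coord_div_norm_le i x)

theorem hasDerivAt_ray {u : Plane → ℝ} (hu : ContDiff ℝ ∞ u) (θ : Circ) {r : ℝ} (hr : 0 < r) :
    HasDerivAt (fun r : ℝ => u (r • (θ : Plane)))
      (radialComp (fun i => partialDeriv i u) (r • (θ : Plane))) r := by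
  have h1 : HasDerivAt (fun r : ℝ => r • (θ : Plane)) (θ : Plane) r := by
    simpa using (hasDerivAt_id r).smul_const (θ : Plane)
  have h2 := ((hu.differentiable (by simp)) (r • (θ : Plane))).hasFDerivAt.comp_hasDerivAt r h1
  refine h2.congr_deriv ?_
  have h3 : (θ : Plane) = ∑ i : Fin 2, (θ : Plane) i • EuclideanSpace.single i (1 : ℝ) := by
    ext j; fin_cases j <;> simp
  have hθ : ‖(θ : Plane)‖ = 1 := norm_eq_of_mem_sphere θ
  have h4 : fderiv ℝ u (r • (θ : Plane)) (θ : Plane)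
      = fderiv ℝ u (r • (θ : Plane))
        (∑ i : Fin 2, (θ : Plane) i • EuclideanSpace.single i (1 : ℝ)) := congrArg _ h3
  rw [h4]
  simp only [map_sum, map_smul, radialComp, partialDeriv, norm_smul, hθ, mul_one,
    Real.norm_of_nonneg hr.le, PiLp.smul_apply, smul_eq_mul]
  refine Finset.sum_congr rfl fun i _ => ?_
  rw [mul_div_cancel_left₀ _ hr.ne']

theorem continuous_partialDeriv (i : Fin 2) {u : Plane → ℝ} (hu : ContDiff ℝ ∞ u) :
    Continuous (partialDeriv i u) := (contDiff_partialDeriv i hu).continuous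

/-- A closed annulus is compact and avoids the origin, where alone the weight may degenerate. -/
theorem exists_weight_lower_bound {w : Plane → ℝ} (hw : IsWeight w) (hc : ContinuousOn w {0}ᶜ)
    {a : ℝ} (ha : 0 < a) (b : ℝ) :
    ∃ c, 0 < c ∧ ∀ x : Plane, a ≤ ‖x‖ → ‖x‖ ≤ b → c ≤ w x := by
  have hK : IsCompact {x : Plane | a ≤ ‖x‖ ∧ ‖x‖ ≤ b} := by
    refine (isCompact_closedBall (0 : Plane) b).of_isClosed_subset ?_ ?_
    · exact (isClosed_le continuous_const continuous_norm).inter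
        (isClosed_le continuous_norm continuous_const)
    · intro x hx; simpa using hx.2
  have hsub : {x : Plane | a ≤ ‖x‖ ∧ ‖x‖ ≤ b} ⊆ {0}ᶜ := by
    intro x hx h0
    rw [mem_singleton_iff] at h0
    simp [h0] at hx; linarith
  rcases eq_empty_or_nonempty {x : Plane | a ≤ ‖x‖ ∧ ‖x‖ ≤ b} with he | hne
  · refine ⟨1, one_pos, fun x h1 h2 => ?_⟩
    exact absurd (show x ∈ {x : Plane | a ≤ ‖x‖ ∧ ‖x‖ ≤ b} from ⟨h1, h2⟩) (by simp [he])
  · obtain ⟨x₀, hx₀, hmin⟩ := hK.exists_isMinOn hne (hc.mono hsub)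
    exact ⟨w x₀, hw.pos _ (hsub hx₀), fun x h1 h2 => hmin ⟨h1, h2⟩⟩

/-- The profile along one ray. -/
theorem ray_profile {w : Plane → ℝ} (hw : IsWeight w) (hc : ContinuousOn w {0}ᶜ)
    {u : ℕ → Plane → ℝ} (hu : ∀ n, ContDiff ℝ ∞ (u n)) {R : Plane → ℝ} (hR : Measurable R)
    {v : ℝ → ℝ} (θ : Circ)
    (hv : ∀ᵐ r : ℝ, 0 < r → Tendsto (fun n => u n (r • (θ : Plane))) atTop (𝓝 (v r)))
    (hlim : Tendsto (fun n => ∫⁻ r in Ioi (0 : ℝ), ENNReal.ofReal r *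
      ‖w (r • (θ : Plane)) * (radialComp (fun i => partialDeriv i (u n)) (r • (θ : Plane))
        - R (r • (θ : Plane)))‖ₑ ^ 2) atTop (𝓝 0)) :
    ∃ U, HasRadialDeriv U (fun r => R (r • (θ : Plane))) ∧ ∀ᵐ r : ℝ, 0 < r → v r = U r := by
  set f' : ℕ → ℝ → ℝ := fun n r => radialComp (fun i => partialDeriv i (u n)) (r • (θ : Plane))
    with hf'
  set g : ℝ → ℝ := fun r => R (r • (θ : Plane)) with hgdef
  have hθ : ‖(θ : Plane)‖ = 1 := norm_eq_of_mem_sphere θ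
  have hgm : Measurable g := hR.comp (by fun_prop)
  have hf'm : ∀ n, Measurable (f' n) := by
    intro n
    have := fun i => (continuous_partialDeriv i (hu n)).measurable
    simp only [hf', radialComp]
    refine Finset.measurable_sum _ fun i _ => ?_
    exact Measurable.mul (by fun_prop) ((this i).comp (by fun_prop))
  have hf : ∀ n, HasRadialDeriv (fun r => u n (r • (θ : Plane))) (f' n) := by
    intro n
    refine HasRadialDeriv.of_hasDerivAt_continuousOn (fun r hr => hasDerivAt_ray (hu n) θ hr) ?_
    simp only [hf', radialComp]
    refine continuousOn_finsetSum _ fun i _ => ContinuousOn.mul ?_ ?_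
    · refine ContinuousOn.div (by fun_prop) (by fun_prop) fun r hr => ?_
      have hr : 0 < r := hr
      simp [norm_smul, hθ, hr.ne']
    · exact ((continuous_partialDeriv i (hu n)).comp (by fun_prop)).continuousOn
  -- On [a, b] the factor r w² is at least a c², so the weighted convergence along the ray implies
  -- unweighted L² convergence, and L¹ convergence by Cauchy–Schwarz.
  have hL2 : ∀ a b, 0 < a → a ≤ b → Tendsto
      (fun n => eLpNorm (fun r => f' n r - g r) 2 (volume.restrict (Icc a b))) atTop (𝓝 0) := by
    intro a b ha hab
    obtain ⟨c, hc0, hcw⟩ := exists_weight_lower_bound hw hc ha b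
    have hle : ∀ n, eLpNorm (fun r => f' n r - g r) 2 (volume.restrict (Icc a b)) ^ 2 ≤
        (ENNReal.ofReal (a * c ^ 2))⁻¹ * ∫⁻ r in Ioi (0 : ℝ), ENNReal.ofReal r *
          ‖w (r • (θ : Plane)) * (f' n r - g r)‖ₑ ^ 2 := by
      intro n
      have hpos : 0 < a * c ^ 2 := by positivity
      rw [eLpNorm_two_sq, ← lintegral_const_mul' _ _ (by simpa using hpos)]
      refine le_trans ?_ (lintegral_mono_set (s := Icc a b) fun r hr => lt_of_lt_of_le ha hr.1)
      refine setLIntegral_mono' measurableSet_Icc fun r hr => ?_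
      have hr0 : 0 < r := lt_of_lt_of_le ha hr.1
      have hn : ‖r • (θ : Plane)‖ = r := by simp [norm_smul, hθ, abs_of_pos hr0]
      have hwr := hcw (r • (θ : Plane)) (by rw [hn]; exact hr.1) (by rw [hn]; exact hr.2)
      rw [enorm_mul_sq, ← mul_assoc, ← mul_assoc, mul_assoc (ENNReal.ofReal _)⁻¹,
        ← ENNReal.ofReal_mul hr0.le]
      refine le_mul_of_one_le_left (zero_le) ?_
      rw [← ENNReal.mul_inv_cancel (a := ENNReal.ofReal (a * c ^ 2)) (by simpa using hpos)
        (by simp), mul_comm]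
      gcongr
      exact hr.1
    have h1 : Tendsto (fun n => eLpNorm (fun r => f' n r - g r) 2 (volume.restrict (Icc a b)) ^ 2)
        atTop (𝓝 0) := by
      refine tendsto_of_tendsto_of_tendsto_of_le_of_le tendsto_const_nhds ?_
        (fun _ => zero_le) hle
      have hpos : 0 < a * c ^ 2 := by positivity
      simpa using ENNReal.Tendsto.const_mul hlim (Or.inr (by simpa using hpos))
    exact tendsto_zero_of_sq h1
  have hL1 : ∀ a b, 0 < a → a ≤ b →
      Tendsto (fun n => ∫⁻ r in Icc a b, ‖f' n r - g r‖ₑ) atTop (𝓝 0) := by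
    intro a b ha hab
    have hle : ∀ n, ∫⁻ r in Icc a b, ‖f' n r - g r‖ₑ ≤
        eLpNorm (fun r => f' n r - g r) 2 (volume.restrict (Icc a b)) *
          (volume.restrict (Icc a b)) univ ^ (1 / (1 : ℝ≥0∞).toReal - 1 / (2 : ℝ≥0∞).toReal) := by
      intro n
      rw [← eLpNorm_one_eq_lintegral_enorm]
      exact eLpNorm_le_eLpNorm_mul_rpow_measure_univ (by norm_num)
        ((hf'm n).sub hgm).aestronglyMeasurable
    refine tendsto_of_tendsto_of_tendsto_of_le_of_le tendsto_const_nhds ?_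
      (fun _ => zero_le) hle
    have := ENNReal.Tendsto.mul_const (b := (volume.restrict (Icc a b)) univ ^
      (1 / (1 : ℝ≥0∞).toReal - 1 / (2 : ℝ≥0∞).toReal)) (hL2 a b ha hab) (Or.inr ?_)
    · simpa using this
    · refine ENNReal.rpow_ne_top_of_nonneg (by norm_num) (by simp)
  refine HasRadialDeriv.of_tendsto hf hv ?_ hL1
  intro a b ha hb
  have h1 := hL1 (min a b) (max a b) (lt_min ha hb) min_le_max
  -- A single index with finite L¹ distance makes `g` integrable, as the difference of two
  -- integrable functions.
  obtain ⟨n, hn⟩ := (h1.eventually (gt_mem_nhds (show (0 : ℝ≥0∞) < 1 by simp))).exists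
  have h2 : IntegrableOn (fun r => f' n r - g r) (Icc (min a b) (max a b)) :=
    ⟨((hf'm n).sub hgm).aestronglyMeasurable, hn.trans ENNReal.one_lt_top⟩
  have h3 : IntervalIntegrable (fun r => f' n r - g r) volume a b := by
    rw [intervalIntegrable_iff]
    exact h2.mono_set uIoc_subset_uIcc
  have h4 := ((hf n).intervalIntegrable ha hb).sub h3
  simpa using h4

theorem Jet.measurable_radialDeriv {w : ℕ → Plane → ℝ} (F : Jet 1 w) :
    Measurable F.radialDeriv := by
  unfold Jet.radialDeriv
  refine Finset.measurable_sum _ fun i _ => ?_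
  exact (measurable_coord_div_norm i).mul (Lp.stronglyMeasurable _).measurable

theorem Jet.measurable_val {s : ℕ} {w : ℕ → Plane → ℝ} (F : Jet s w) : Measurable F.val :=
  (Lp.stronglyMeasurable _).measurable

theorem exists_test_approx_radial {w : ℕ → Plane → ℝ} {F : Jet 1 w}
    (hF : F ∈ sobolev 1 w) {ε : ℝ} (hε : 0 < ε) :
    ∃ u : Plane → ℝ, ContDiff ℝ ∞ u ∧
      eLpNorm (fun x => u x - F.val x) 2 (weightedMeasure (w 0)) ≤ ENNReal.ofReal ε ∧
      eLpNorm (fun x => radialComp (fun i => partialDeriv i u) x - F.radialDeriv x) 2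
        (weightedMeasure (w 1)) ≤ ENNReal.ofReal (2 * ε) := by
  obtain ⟨u, hu, _, h⟩ := exists_test_approx hF hε
  refine ⟨u, hu, h (MultiIdx.zero 1), ?_⟩
  have h1 : ∀ i, eLpNorm (fun x => partialDeriv i u x - F (MultiIdx.one i) x) 2
      (weightedMeasure (w 1)) ≤ ENNReal.ofReal ε := by
    intro i
    fin_cases i
    · exact h (MultiIdx.one 0)
    · exact h (MultiIdx.one 1)
  refine (eLpNorm_radialComp_sub_le (G := fun i => partialDeriv i u)
    (H := fun i => F (MultiIdx.one i)) (fun i => (continuous_partialDeriv i hu).measurable)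
    (fun i => (Lp.stronglyMeasurable _).measurable)).trans ?_
  rw [Fin.sum_univ_two, ENNReal.ofReal_mul (by norm_num)]
  refine (add_le_add (h1 0) (h1 1)).trans (le_of_eq ?_)
  rw [← two_mul]; simp

/-- Radial elements of `H¹` have a locally absolutely continuous profile, whose derivative is the
profile of the radial derivative. -/
theorem exists_profile {w : ℕ → Plane → ℝ} (hw : ∀ k, IsWeight (w k))
    (hc : ContinuousOn (w 1) {0}ᶜ) {F : Jet 1 w} (hF : F ∈ radialSobolev 1 w) :
    ∃ v g : ℝ → ℝ, Measurable v ∧ Measurable g ∧ HasRadialDeriv v g ∧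
      F.val =ᵐ[volume] (fun x => v ‖x‖) ∧ F.radialDeriv =ᵐ[volume] fun x => g ‖x‖ := by
  obtain ⟨hF, v, hvm, hv⟩ := hF
  have hv : F.val =ᵐ[volume] fun x => v ‖x‖ := by
    rw [EventuallyEq, ← (hw _).ae_eq]; exact hv
  -- Geometric accuracy makes the squared errors summable, so convergence holds at almost every
  -- point and along almost every ray without passing to subsequences.
  have hε : ∀ n : ℕ, 0 < (1 / 2 : ℝ) ^ n := fun n => by positivity
  choose u hu h0 h1 using fun n => exists_test_approx_radial hF (hε n)
  set E : ℕ → Plane → ℝ≥0∞ := fun n x => ‖w 0 x * (u n x - F.val x)‖ₑ ^ 2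
    + ‖w 1 x * (radialComp (fun i => partialDeriv i (u n)) x - F.radialDeriv x)‖ₑ ^ 2 with hE
  have hm0 := (hw 0).measurable
  have hm1 := (hw 1).measurable
  have hRm := F.measurable_radialDeriv
  have hFm := F.measurable_val
  have hum : ∀ n, Measurable (u n) := fun n => (hu n).continuous.measurable
  have hrm : ∀ n, Measurable (radialComp (fun i => partialDeriv i (u n))) := by
    intro n
    unfold radialComp
    refine Finset.measurable_sum _ fun i _ => ?_
    exact (measurable_coord_div_norm i).mul (continuous_partialDeriv i (hu n)).measurable
  have hEm : ∀ n, Measurable (E n) := fun n => by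
    have := hum n
    have := hrm n
    simp only [hE]; fun_prop
  have hEle : ∀ n, ∫⁻ x, E n x ≤ ENNReal.ofReal (5 * (1 / 4) ^ n) := by
    intro n
    have := hum n
    have := hrm n
    rw [lintegral_add_left (by fun_prop), ← eLpNorm_two_sq, ← eLpNorm_two_sq,
      ← eLpNorm_weightedMeasure hm0 (fun x => u n x - F.val x),
      ← eLpNorm_weightedMeasure hm1
        (fun x => radialComp (fun i => partialDeriv i (u n)) x - F.radialDeriv x)]
    have e : ((1 : ℝ) / 4) ^ n = ((1 / 2) ^ n) ^ 2 := by
      rw [← pow_mul, mul_comm, pow_mul]; norm_num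
    calc _ ≤ ENNReal.ofReal ((1 / 2) ^ n) ^ 2 + ENNReal.ofReal (2 * (1 / 2) ^ n) ^ 2 := by
          gcongr
          · exact h0 n
          · exact h1 n
      _ = _ := by
          rw [← ENNReal.ofReal_pow (by positivity), ← ENNReal.ofReal_pow (by positivity),
            ← ENNReal.ofReal_add (by positivity) (by positivity), e]
          congr 1; ring
  have hsum : ∑' n, ∫⁻ x, E n x ≠ ⊤ := by
    refine ne_top_of_le_ne_top ?_ (ENNReal.tsum_le_tsum hEle)
    rw [← ENNReal.ofReal_tsum_of_nonneg (fun n => by positivity)]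
    · exact ENNReal.ofReal_ne_top
    · exact (summable_geometric_of_lt_one (by norm_num) (by norm_num)).mul_left 5
  have htm : Measurable fun x => ∑' n, E n x := Measurable.tsum hEm
  have hpt : ∀ᵐ x, ∑' n, E n x < ⊤ := by
    refine ae_lt_top htm ?_
    rwa [lintegral_tsum fun n => (hEm n).aemeasurable]
  have hpolar : ∀ᵐ θ : Circ ∂arc,
      ∑' n, ∫⁻ r in Ioi (0 : ℝ), ENNReal.ofReal r * E n (r • (θ : Plane)) < ⊤ := by
    have hin : ∀ n, Measurable fun θ : Circ =>
        ∫⁻ r in Ioi (0 : ℝ), ENNReal.ofReal r * E n (r • (θ : Plane)) := by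
      intro n
      have := hEm n
      refine Measurable.lintegral_prod_right' (f := fun p : Circ × ℝ =>
        ENNReal.ofReal p.2 * E n (p.2 • (p.1 : Plane))) ?_
      fun_prop
    refine ae_lt_top (Measurable.tsum hin) ?_
    rw [lintegral_tsum fun n => (hin n).aemeasurable]
    simpa only [lintegral_polar (hEm _)] using hsum
  have hpt' := (ae_iff_ae_polar (P := fun x => ∑' n, E n x < ⊤)
    (measurableSet_lt htm measurable_const)).1 hpt
  have hv' := (ae_iff_ae_polar (P := fun x => F.val x = v ‖x‖)
    (measurableSet_eq_fun hFm (hvm.comp measurable_norm))).1 hv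
  -- Along almost every ray the test functions converge to `v` and their radial derivatives converge
  -- in the weighted L² sense, as `ray_profile` requires.
  have hgood : ∀ᵐ θ : Circ ∂arc, ∃ U, HasRadialDeriv U (fun r => F.radialDeriv (r • (θ : Plane)))
      ∧ ∀ᵐ r : ℝ, 0 < r → v r = U r := by
    filter_upwards [hpolar, hpt', hv'] with θ ha hb hd
    refine ray_profile (hw 1) hc hu hRm θ ?_ ?_
    · filter_upwards [hb, hd] with r hb hd hr
      have hθ : ‖(θ : Plane)‖ = 1 := norm_eq_of_mem_sphere θ
      have hx : r • (θ : Plane) ≠ 0 := by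
        rw [← norm_ne_zero_iff, norm_smul, hθ]; simpa using hr.ne'
      have hd := hd hr
      rw [show ‖r • (θ : Plane)‖ = r by simp [norm_smul, abs_of_pos hr, hθ]] at hd
      rw [← hd]
      have hlim := ENNReal.tendsto_atTop_zero_of_tsum_ne_top (hb hr).ne
      have hlim2 : Tendsto (fun n => ‖w 0 (r • (θ : Plane)) *
          (u n (r • (θ : Plane)) - F.val (r • (θ : Plane)))‖ₑ ^ 2) atTop (𝓝 0) :=
        tendsto_of_tendsto_of_tendsto_of_le_of_le tendsto_const_nhds hlim (fun _ => zero_le)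
          (fun n => le_self_add)
      have hlim4 : Tendsto (fun n => ‖w 0 (r • (θ : Plane)) *
          (u n (r • (θ : Plane)) - F.val (r • (θ : Plane)))‖ₑ) atTop (𝓝 0) := by
        exact tendsto_zero_of_sq hlim2
      have hlim5 := (ENNReal.tendsto_toReal ENNReal.zero_ne_top).comp hlim4
      have hlim6 : Tendsto (fun n => w 0 (r • (θ : Plane)) *
          (u n (r • (θ : Plane)) - F.val (r • (θ : Plane)))) atTop (𝓝 0) := by
        rw [tendsto_zero_iff_norm_tendsto_zero]
        simpa [Function.comp_def] using hlim5
      have hlim7 := hlim6.const_mul (w 0 (r • (θ : Plane)))⁻¹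
      have hw0 := ((hw 0).pos _ hx).ne'
      simp only [inv_mul_cancel_left₀ hw0, mul_zero] at hlim7
      simpa using hlim7.add_const (F.val (r • (θ : Plane)))
    · refine tendsto_of_tendsto_of_tendsto_of_le_of_le tendsto_const_nhds
        (ENNReal.tendsto_atTop_zero_of_tsum_ne_top ha.ne) (fun _ => zero_le) (fun n => ?_)
      refine lintegral_mono fun r => ?_
      simp only [hE]
      gcongr
      exact le_add_self
  -- One good ray defines the profile and its derivative. On any other good ray the primitive agrees
  -- with `U` almost everywhere, hence so does the derivative; this shows that the radial derivative
  -- is itself radial.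
  obtain ⟨θ₀, U, hU, hvU⟩ := hgood.exists
  have hgm : Measurable fun r : ℝ => F.radialDeriv (r • (θ₀ : Plane)) := hRm.comp (by fun_prop)
  refine ⟨(Ioi 0).indicator U, fun r => F.radialDeriv (r • (θ₀ : Plane)), ?_, hgm,
    hU.congr (fun r hr => (indicator_of_mem hr U).symm) (Eventually.of_forall fun _ _ => rfl),
    ?_, ?_⟩
  · rw [← piecewise_eq_indicator]
    exact hU.continuousOn.measurable_piecewise continuousOn_const measurableSet_Ioi
  · have h2 : ∀ᵐ x : Plane, v ‖x‖ = (Ioi 0).indicator U ‖x‖ := by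
      refine ae_norm_of_ae (P := fun r => v r = (Ioi 0).indicator U r) ?_
      filter_upwards [hvU] with r hr hr0
      rw [hr hr0, indicator_of_mem (show r ∈ Ioi (0 : ℝ) from hr0)]
    filter_upwards [hv, h2] with x h3 h4
    rw [h3, h4]
  · refine (ae_iff_ae_polar (P := fun x => F.radialDeriv x = F.radialDeriv (‖x‖ • (θ₀ : Plane)))
      (measurableSet_eq_fun hRm (hgm.comp measurable_norm))).2 ?_
    filter_upwards [hgood] with θ ⟨U', hU', hvU'⟩
    have hθ : ‖(θ : Plane)‖ = 1 := norm_eq_of_mem_sphere θ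
    have h2 := hU'.deriv_ae_eq hU (by
      filter_upwards [hvU, hvU'] with r h3 h4 hr
      rw [← h3 hr, ← h4 hr])
    filter_upwards [h2] with r h3 hr
    rw [show ‖r • (θ : Plane)‖ = r by simp [norm_smul, abs_of_pos hr, hθ]]
    exact h3 hr

/-! ### A jet is determined by its function -/

/-- Cauchy–Schwarz for the product of w f and ζ/w; the second factor is in L² because the weight is
bounded below on the support of ζ. -/
theorem exists_pairing_bound {w : Plane → ℝ} (hw : IsWeight w) (hc : ContinuousOn w {0}ᶜ)
    {ζ : Plane → ℝ} (hζ : Continuous ζ) (hζc : HasCompactSupport ζ) (hζ0 : tsupport ζ ⊆ {0}ᶜ) :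
    ∃ K : ℝ≥0∞, K ≠ ⊤ ∧ ∀ f : Plane → ℝ, MemLp f 2 (weightedMeasure w) →
      Integrable (fun x => f x * ζ x) ∧
      ‖∫ x, f x * ζ x‖ₑ ≤ K * eLpNorm f 2 (weightedMeasure w) := by
  have hm : MemLp (fun x => ζ x / w x) 2 volume := by
    have hz := hζ.memLp_of_hasCompactSupport (p := 2) (μ := volume) hζc
    have hmeas : AEStronglyMeasurable (fun x => ζ x / w x) volume :=
      (hζ.measurable.div hw.measurable).aestronglyMeasurable
    rcases eq_empty_or_nonempty (tsupport ζ) with he | hne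
    · rw [tsupport_eq_empty_iff] at he
      simp [he]
    · obtain ⟨x₀, hx₀, hmin⟩ := IsCompact.exists_isMinOn hζc hne (hc.mono hζ0)
      have h0 := hw.pos x₀ (hζ0 hx₀)
      refine hz.of_le_mul (c := (w x₀)⁻¹) hmeas (Eventually.of_forall fun x => ?_)
      by_cases hx : ζ x = 0
      · simp [hx]
      · have hxs := subset_tsupport ζ hx
        have h1 : w x₀ ≤ w x := hmin hxs
        rw [norm_div, Real.norm_of_nonneg (h0.le.trans h1), div_eq_inv_mul]
        gcongr
  refine ⟨eLpNorm (fun x => ζ x / w x) 2 volume, hm.2.ne, fun f hf => ?_⟩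
  have hfm := hw.aestronglyMeasurable_iff.1 hf.1
  have hwf := (hw.memLp_iff hfm).1 hf
  have he : (fun x => f x * ζ x) =ᵐ[volume] (fun x => ζ x / w x) • fun x => w x * f x := by
    filter_upwards [ae_ne_zero] with x hx
    have := (hw.pos x hx).ne'
    simp only [Pi.smul_apply', smul_eq_mul]
    field_simp
  have hI : MemLp ((fun x => ζ x / w x) • fun x => w x * f x) 1 volume := hwf.smul hm
  rw [eLpNorm_weightedMeasure hw.measurable]
  refine ⟨(memLp_one_iff_integrable.1 hI).congr he.symm, ?_⟩
  rw [integral_congr_ae he]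
  refine (enorm_integral_le_lintegral_enorm _).trans ?_
  rw [← eLpNorm_one_eq_lintegral_enorm]
  exact eLpNorm_smul_le_mul_eLpNorm hwf.1 hm.1

theorem locallyIntegrableOn_of_memLp {w : Plane → ℝ} (hw : IsWeight w)
    (hc : ContinuousOn w {0}ᶜ) {f : Plane → ℝ} (hf : MemLp f 2 (weightedMeasure w)) :
    LocallyIntegrableOn f {0}ᶜ (volume : Measure Plane) := by
  have hfm := hw.aestronglyMeasurable_iff.1 hf.1
  have hwf := (hw.memLp_iff hfm).1 hf
  rw [locallyIntegrableOn_iff (isOpen_compl_singleton.isLocallyClosed)]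
  intro K hK0 hK
  rcases eq_empty_or_nonempty K with he | hne
  · simp [he]
  obtain ⟨x₀, hx₀, hmin⟩ := hK.exists_isMinOn hne (hc.mono hK0)
  have h0 := hw.pos x₀ (hK0 hx₀)
  have : IsFiniteMeasure (volume.restrict K) := ⟨by simpa using hK.measure_lt_top⟩
  have h2 : MemLp f 2 (volume.restrict K) := by
    refine (hwf.restrict K).of_le_mul (c := (w x₀)⁻¹) hfm.restrict ?_
    filter_upwards [ae_restrict_mem hK.measurableSet] with x hx
    have h1 : w x₀ ≤ w x := hmin hx
    rw [norm_mul, Real.norm_of_nonneg (h0.le.trans h1), ← div_eq_inv_mul, le_div_iff₀ h0, mul_comm]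
    gcongr
  exact h2.integrable (by norm_num)

theorem memLp_multiDeriv_of_sub {s : ℕ} {w : ℕ → Plane → ℝ} (hw : ∀ k, IsWeight (w k))
    (F : Jet s w) {u : Plane → ℝ} (hu : ContDiff ℝ ∞ u) (α : MultiIdx s) {ε : ℝ}
    (h : eLpNorm (fun x => multiDeriv α.1 u x - F α x) 2 (weightedMeasure (w α.order))
      ≤ ENNReal.ofReal ε) :
    MemLp (fun x => multiDeriv α.1 u x - F α x) 2 (weightedMeasure (w α.order)) := by
  refine ⟨?_, h.trans_lt ENNReal.ofReal_lt_top⟩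
  refine (hw _).aestronglyMeasurable_iff.2 ?_
  have h1 : Continuous (multiDeriv α.1 u) :=
    (contDiff_iterate_partialDeriv 0 _ (contDiff_iterate_partialDeriv 1 _ hu)).continuous
  exact (h1.measurable.sub (Lp.stronglyMeasurable _).measurable).aestronglyMeasurable

/-- Closability of the gradient. For approximating test functions u, ∫ ∂ᵢu ψ = -∫ u ∂ᵢψ, and with ψ
supported off the origin both sides pass to the limit. The derivative component thus annihilates
every such ψ and vanishes almost everywhere. -/
theorem Jet.one_eq_zero_of_val {w : ℕ → Plane → ℝ} (hw : ∀ k, IsWeight (w k))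
    (hc : ∀ k, ContinuousOn (w k) {0}ᶜ) {F : Jet 1 w} (hF : F ∈ sobolev 1 w)
    (h0 : F.val =ᵐ[volume] 0) (i : Fin 2) : ∀ᵐ x, F (MultiIdx.one i) x = 0 := by
  have hmem : ∀ α : MultiIdx 1, MemLp (F α) 2 (weightedMeasure (w α.order)) := fun α => Lp.memLp _
  have hloc : LocallyIntegrableOn (F (MultiIdx.one i)) {0}ᶜ (volume : Measure Plane) :=
    locallyIntegrableOn_of_memLp (hw _) (hc _) (hmem _)
  have key := IsOpen.ae_eq_zero_of_integral_contDiff_smul_eq_zero (μ := volume)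
    (isOpen_compl_singleton (x := (0 : Plane))) hloc ?_
  · filter_upwards [key, ae_ne_zero] with x hx hx0 using hx hx0
  intro ψ hψ hψc hψ0
  have hψ' : Continuous (partialDeriv i ψ) := continuous_partialDeriv i hψ
  have hψs : tsupport (partialDeriv i ψ) ⊆ tsupport ψ := by
    refine closure_minimal (fun x hx => ?_) (isClosed_tsupport _)
    by_contra hxs
    refine hx ?_
    have := (notMem_tsupport_iff_eventuallyEq.1 hxs).fderiv_eq (𝕜 := ℝ)
    simp [partialDeriv, this]
  have hψc' : HasCompactSupport (partialDeriv i ψ) :=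
    hψc.of_isClosed_subset (isClosed_tsupport _) hψs
  obtain ⟨K, hK, hKb⟩ := exists_pairing_bound (hw (MultiIdx.one i).order) (hc _) hψ.continuous
    hψc hψ0
  obtain ⟨K', hK', hKb'⟩ := exists_pairing_bound (hw (MultiIdx.zero 1).order) (hc _) hψ' hψc'
    (hψs.trans hψ0)
  have hle : ∀ ε : ℝ, 0 < ε → ‖∫ x, F (MultiIdx.one i) x * ψ x‖ₑ ≤ (K + K') * ENNReal.ofReal ε := by
    intro ε hε
    obtain ⟨u, hu, huc, hue⟩ := exists_test_approx hF hε
    have m1 := memLp_multiDeriv_of_sub hw F hu _ (hue (MultiIdx.one i))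
    have m0 := memLp_multiDeriv_of_sub hw F hu _ (hue (MultiIdx.zero 1))
    obtain ⟨I1, B1⟩ := hKb _ m1
    obtain ⟨I0, B0⟩ := hKb' _ m0
    obtain ⟨I2, -⟩ := hKb _ (hmem (MultiIdx.one i))
    have e1 : multiDeriv (MultiIdx.one i).1 u = partialDeriv i u := by fin_cases i <;> rfl
    have e0 : multiDeriv (MultiIdx.zero 1).1 u = u := rfl
    have hu' := continuous_partialDeriv i hu
    have hparts : ∫ x, u x * partialDeriv i ψ x = - ∫ x, partialDeriv i u x * ψ x := by
      refine integral_mul_fderiv_eq_neg_fderiv_mul_of_integrable ?_ ?_ ?_ ?_ ?_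
      · exact (hu'.mul hψ.continuous).integrable_of_hasCompactSupport hψc.mul_left
      · exact (hu.continuous.mul hψ').integrable_of_hasCompactSupport hψc'.mul_left
      · exact (hu.continuous.mul hψ.continuous).integrable_of_hasCompactSupport hψc.mul_left
      · exact fun x _ => hu.differentiable (by simp) x
      · exact fun x _ => hψ.differentiable (by simp) x
    have s1 : ∫ x, F (MultiIdx.one i) x * ψ x = (∫ x, partialDeriv i u x * ψ x)
        - ∫ x, (multiDeriv (MultiIdx.one i).1 u x - F (MultiIdx.one i) x) * ψ x := by
      have : ∀ x, partialDeriv i u x * ψ x =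
          (multiDeriv (MultiIdx.one i).1 u x - F (MultiIdx.one i) x) * ψ x
          + F (MultiIdx.one i) x * ψ x := fun x => by rw [e1]; ring
      simp_rw [this]
      rw [integral_add I1 I2]; ring
    have s0 : ∫ x, u x * partialDeriv i ψ x
        = ∫ x, (multiDeriv (MultiIdx.zero 1).1 u x - F (MultiIdx.zero 1) x) * partialDeriv i ψ x := by
      refine integral_congr_ae ?_
      filter_upwards [h0] with x hx
      have hx : F (MultiIdx.zero 1) x = 0 := hx
      rw [e0, hx, sub_zero]
    rw [s1, ← neg_eq_iff_eq_neg.2 hparts, s0, ← neg_add', enorm_neg, add_comm K, add_mul]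
    refine (enorm_add_le _ _).trans (add_le_add ?_ ?_)
    · exact B0.trans (by gcongr; exact hue _)
    · exact B1.trans (by gcongr; exact hue _)
  have hlim : Tendsto (fun n : ℕ => (K + K') * ENNReal.ofReal (1 / ((n : ℝ) + 1))) atTop (𝓝 0) := by
    have h1 := ENNReal.tendsto_ofReal tendsto_one_div_add_atTop_nhds_zero_nat
    have h2 := ENNReal.Tendsto.const_mul (a := K + K') h1 (Or.inr (by simp [hK, hK']))
    simpa using h2
  have hz : ‖∫ x, F (MultiIdx.one i) x * ψ x‖ₑ ≤ 0 :=
    ge_of_tendsto' hlim fun n => hle _ (by positivity)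
  have : ∫ x, F (MultiIdx.one i) x * ψ x = 0 := by simpa using hz
  rw [← this]
  exact integral_congr_ae (Eventually.of_forall fun x => by simp [mul_comm])

theorem Jet.eq_zero_of_val {w : ℕ → Plane → ℝ} (hw : ∀ k, IsWeight (w k))
    (hc : ∀ k, ContinuousOn (w k) {0}ᶜ) {F : Jet 1 w} (hF : F ∈ sobolev 1 w)
    (h0 : F.val =ᵐ[volume] 0) : F = 0 := by
  have hall : ∀ α : MultiIdx 1, α = MultiIdx.zero 1 ∨ α = MultiIdx.one 0 ∨ α = MultiIdx.one 1 := by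
    decide
  refine PiLp.ext fun α => ?_
  rw [PiLp.zero_apply, Lp.eq_zero_iff_ae_eq_zero, EventuallyEq, (hw _).ae_eq]
  rcases hall α with rfl | rfl | rfl
  · exact h0
  · exact Jet.one_eq_zero_of_val hw hc hF h0 0
  · exact Jet.one_eq_zero_of_val hw hc hF h0 1

/-! ### Approximation of profiles by smooth profiles -/

/-- Cauchy–Schwarz on an interval of length at most b - a. -/
theorem abs_intervalIntegral_le_of_eLpNorm_le {f : ℝ → ℝ} (hf : AEStronglyMeasurable f volume)
    {a b r ε : ℝ} (hε : 0 ≤ ε) (har : a ≤ r) (hrb : r ≤ b)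
    (h : eLpNorm f 2 volume ≤ ENNReal.ofReal ε) :
    |∫ x in a..r, f x| ≤ Real.sqrt (b - a) * ε := by
  rw [← ENNReal.ofReal_le_ofReal_iff (by positivity), ← Real.enorm_eq_ofReal_abs]
  rw [intervalIntegral.integral_of_le har]
  refine (enorm_integral_le_lintegral_enorm _).trans ?_
  refine (lintegral_mono_set (Ioc_subset_Ioc_right hrb)).trans ?_
  rw [← eLpNorm_one_eq_lintegral_enorm]
  refine (eLpNorm_le_eLpNorm_mul_rpow_measure_univ (q := 2) (by norm_num) hf.restrict).trans ?_
  rw [ENNReal.ofReal_mul (Real.sqrt_nonneg _), mul_comm]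
  gcongr
  · rw [Measure.restrict_apply_univ, Real.volume_Ioc, Real.sqrt_eq_rpow,
      ENNReal.ofReal_rpow_of_nonneg (by linarith) (by norm_num)]
    norm_num
  · exact (eLpNorm_mono_measure _ Measure.restrict_le_self).trans h

/-- A smooth cut-off, equal to `1` on `[a, b]` and to `0` outside `(a / 2, 2 b)`. -/
def plateau (a b r : ℝ) : ℝ :=
  Real.smoothTransition ((r - a / 2) / (a / 2)) * Real.smoothTransition ((2 * b - r) / b)

theorem contDiff_plateau (a b : ℝ) : ContDiff ℝ ∞ (plateau a b) := by
  unfold plateau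
  refine ContDiff.mul ?_ ?_
  · exact Real.smoothTransition.contDiff.comp (by fun_prop)
  · exact Real.smoothTransition.contDiff.comp (by fun_prop)

theorem plateau_nonneg (a b r : ℝ) : 0 ≤ plateau a b r :=
  mul_nonneg (Real.smoothTransition.nonneg _) (Real.smoothTransition.nonneg _)

theorem plateau_le_one (a b r : ℝ) : plateau a b r ≤ 1 :=
  mul_le_one₀ (Real.smoothTransition.le_one _) (Real.smoothTransition.nonneg _)
    (Real.smoothTransition.le_one _)

theorem plateau_eq_one {a b r : ℝ} (ha : 0 < a) (hab : a < b) (hr : r ∈ Icc a b) :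
    plateau a b r = 1 := by
  unfold plateau
  rw [Real.smoothTransition.one_of_one_le, Real.smoothTransition.one_of_one_le, one_mul]
  · rw [le_div_iff₀ (ha.trans hab)]; linarith [hr.2]
  · rw [le_div_iff₀ (by positivity)]; linarith [hr.1]

theorem plateau_eq_zero_left {a b r : ℝ} (ha : 0 < a) (hr : r ≤ a / 2) : plateau a b r = 0 := by
  unfold plateau
  rw [Real.smoothTransition.zero_of_nonpos, zero_mul]
  exact div_nonpos_of_nonpos_of_nonneg (by linarith) (by linarith)

theorem plateau_eq_zero_right {a b r : ℝ} (hb : 0 < b) (hr : 2 * b ≤ r) : plateau a b r = 0 := by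
  unfold plateau
  rw [Real.smoothTransition.zero_of_nonpos (x := (2 * b - r) / b), mul_zero]
  exact div_nonpos_of_nonpos_of_nonneg (by linarith) hb.le

/-- Approximate the derivative and integrate. A test function f close to g in L² is cut off by a
plateau q equal to 1 on the support of g, then corrected by a multiple of q so that its integral
vanishes like that of g. Its primitive is therefore compactly supported, and uniformly close to v.
-/
theorem exists_smooth_profile_approx {v g : ℝ → ℝ} (h : HasRadialDeriv v g) {a b : ℝ}
    (ha : 0 < a) (hab : a < b) (hv0 : ∀ r, r ∉ Icc a b → v r = 0)
    (hg0 : ∀ r, r ∉ Icc a b → g r = 0) (hg : MemLp g 2 volume) :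
    ∃ K, 0 < K ∧ ∀ ε, 0 < ε → ∃ P : ℝ → ℝ, ContDiff ℝ ∞ P ∧
      (∀ r, r ∉ Icc (a / 2) (2 * b) → P r = 0) ∧
      (∀ r, r ∉ Icc (a / 2) (2 * b) → deriv P r = 0) ∧
      eLpNorm (fun r => deriv P r - g r) 2 volume ≤ ENNReal.ofReal (K * ε) ∧
      ∀ r, |P r - v r| ≤ K * ε := by
  have hb : 0 < b := ha.trans hab
  set q := plateau a b with hq
  have hqc : Continuous q := (contDiff_plateau a b).continuous
  have hqs : HasCompactSupport q := by
    refine HasCompactSupport.intro (K := Icc (a / 2) (2 * b)) isCompact_Icc fun r hr => ?_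
    rcases not_and_or.1 hr with hr | hr
    · exact plateau_eq_zero_left ha (not_le.1 hr).le
    · exact plateau_eq_zero_right hb (not_le.1 hr).le
  have hqL : MemLp q 2 volume := hqc.memLp_of_hasCompactSupport hqs
  set c := ∫ r in (a / 2)..(2 * b), q r with hc
  have hcpos : 0 < c := by
    have h1 : ∫ r in a..b, q r = b - a := by
      rw [intervalIntegral.integral_congr (g := fun _ => (1 : ℝ))]
      · simp
      · intro r hr
        rw [uIcc_of_le hab.le] at hr
        exact plateau_eq_one ha hab hr
    have h2 : ∫ r in a..b, q r ≤ c := by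
      refine intervalIntegral.integral_mono_interval (by linarith) hab.le (by linarith)
        (Eventually.of_forall fun r => plateau_nonneg _ _ _) (hqc.intervalIntegrable _ _)
    linarith
  set T := (eLpNorm q 2 volume).toReal with hT
  set S := Real.sqrt (2 * b - a / 2) with hS
  have hS0 : 0 ≤ S := Real.sqrt_nonneg _
  have hT0 : 0 ≤ T := ENNReal.toReal_nonneg
  have hab' : a / 2 ≤ 2 * b := by linarith
  -- The factor 1 + S T / c is the L² cost of the mean correction; the factor 1 + S covers both the
  -- derivative and, by Cauchy–Schwarz, its primitive.
  refine ⟨(1 + S / c * T) * (1 + S), by positivity, fun ε hε => ?_⟩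
  obtain ⟨f, hfs, hf, hfε⟩ := hg.exist_eLpNorm_sub_le (by norm_num) (by norm_num) hε
  have hfc := hf.continuous
  have hd1 : eLpNorm (fun r => q r * f r - g r) 2 volume ≤ ENNReal.ofReal ε := by
    refine le_trans ?_ hfε
    refine eLpNorm_mono fun r => ?_
    have : q r * f r - g r = - (q r * (g r - f r)) := by
      by_cases hr : r ∈ Icc a b
      · rw [hq, plateau_eq_one ha hab hr]; ring
      · rw [hg0 r hr]; ring
    rw [this, norm_neg, norm_mul, Real.norm_of_nonneg (plateau_nonneg a b r), Pi.sub_apply]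
    exact mul_le_of_le_one_left (norm_nonneg _) (plateau_le_one a b r)
  have hIg : ∀ r s, 0 < r → 0 < s → IntervalIntegrable g volume r s :=
    fun r s hr hs => h.intervalIntegrable hr hs
  have ha2 : 0 < a / 2 := by positivity
  have hb2 : 0 < 2 * b := by positivity
  have hva : v (a / 2) = 0 := hv0 _ fun h => by linarith [h.1]
  have hvb : v (2 * b) = 0 := hv0 _ fun h => by linarith [h.2]
  set κ₀ := ∫ r in (a / 2)..(2 * b), q r * f r with hκ
  have hqf : Continuous fun r => q r * f r := hqc.mul hfc
  have hκle : |κ₀| ≤ S * ε := by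
    have h1 : κ₀ = ∫ r in (a / 2)..(2 * b), (q r * f r - g r) := by
      rw [intervalIntegral.integral_sub (hqf.intervalIntegrable _ _) (hIg _ _ ha2 hb2),
        h.integral_eq_sub ha2 hb2, hva, hvb]
      simp [hκ]
    rw [h1]
    exact abs_intervalIntegral_le_of_eLpNorm_le (hqf.aestronglyMeasurable.sub hg.1) hε.le hab'
      le_rfl hd1
  -- Since c = ∫ q and κ₀ = ∫ q f, this function has integral zero. Moreover κ₀ is small, because ∫
  -- g = v(2b) - v(a/2) = 0.
  set k : ℝ → ℝ := fun r => q r * f r - κ₀ / c * q r with hk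
  have hkc : Continuous k := hqf.sub (continuous_const.mul hqc)
  have hks : ContDiff ℝ ∞ k :=
    ((contDiff_plateau a b).mul hf).sub (contDiff_const.mul (contDiff_plateau a b))
  have hk0 : ∀ r, r ≤ a / 2 ∨ 2 * b ≤ r → k r = 0 := by
    intro r hr
    have : q r = 0 := by
      rcases hr with hr | hr
      · exact plateau_eq_zero_left ha hr
      · exact plateau_eq_zero_right hb hr
    simp [hk, this]
  have hd2 : eLpNorm (fun r => k r - g r) 2 volume ≤ ENNReal.ofReal ((1 + S / c * T) * ε) := by
    have h1 : (fun r => k r - g r) = (fun r => q r * f r - g r) - (κ₀ / c) • q := by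
      funext r; simp only [hk, Pi.sub_apply, Pi.smul_apply, smul_eq_mul]; ring
    rw [h1]
    refine (eLpNorm_sub_le (hqf.aestronglyMeasurable.sub hg.1)
      (hqL.const_smul _).1 (by norm_num)).trans ?_
    rw [eLpNorm_const_smul, add_mul, ENNReal.ofReal_add (by positivity) (by positivity), one_mul]
    refine add_le_add hd1 ?_
    rw [Real.enorm_eq_ofReal_abs, ← ENNReal.ofReal_toReal hqL.2.ne, ← hT,
      ← ENNReal.ofReal_mul (abs_nonneg _), abs_div, abs_of_pos hcpos]
    refine ENNReal.ofReal_le_ofReal ?_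
    calc |κ₀| / c * T ≤ (S * ε) / c * T := by gcongr
      _ = S / c * T * ε := by ring
  set P : ℝ → ℝ := fun r => ∫ x in (a / 2)..r, k x with hP
  have hPd : ∀ r, HasDerivAt P (k r) r := fun r =>
    intervalIntegral.integral_hasDerivAt_right (hkc.intervalIntegrable _ _)
      (hkc.stronglyMeasurableAtFilter _ _) hkc.continuousAt
  have hPderiv : deriv P = k := funext fun r => (hPd r).deriv
  have hkint : ∫ x in (a / 2)..(2 * b), k x = 0 := by
    have h1 : ∫ x in (a / 2)..(2 * b), k x = κ₀ - κ₀ / c * c := by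
      rw [hκ, hc, ← intervalIntegral.integral_const_mul, ← hc, ← hκ]
      exact intervalIntegral.integral_sub (hqf.intervalIntegrable _ _)
        ((hqc.const_mul _).intervalIntegrable _ _)
    rw [h1, div_mul_cancel₀ _ hcpos.ne', sub_self]
  have hPl : ∀ r, r ≤ a / 2 → P r = 0 := by
    intro r hr
    simp only [hP]
    rw [intervalIntegral.integral_congr (g := fun _ => (0 : ℝ))]
    · simp
    · intro x hx
      rw [uIcc_of_ge hr] at hx
      exact hk0 x (Or.inl hx.2)
  have hPr : ∀ r, 2 * b ≤ r → P r = 0 := by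
    intro r hr
    simp only [hP]
    rw [← intervalIntegral.integral_add_adjacent_intervals (b := 2 * b)
      (hkc.intervalIntegrable _ _) (hkc.intervalIntegrable _ _), hkint,
      intervalIntegral.integral_congr (g := fun _ => (0 : ℝ))]
    · simp
    · intro x hx
      rw [uIcc_of_le hr] at hx
      exact hk0 x (Or.inr hx.1)
  refine ⟨P, ?_, fun r hr => ?_, fun r hr => ?_, ?_, fun r => ?_⟩
  · rw [contDiff_infty_iff_deriv, hPderiv]
    exact ⟨fun r => (hPd r).differentiableAt, hks⟩
  · rcases not_and_or.1 hr with hr | hr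
    · exact hPl r (not_le.1 hr).le
    · exact hPr r (not_le.1 hr).le
  · rw [hPderiv]
    rcases not_and_or.1 hr with hr | hr
    · exact hk0 r (Or.inl (not_le.1 hr).le)
    · exact hk0 r (Or.inr (not_le.1 hr).le)
  · rw [hPderiv]
    refine hd2.trans (ENNReal.ofReal_le_ofReal ?_)
    gcongr
    refine le_mul_of_one_le_right (by positivity) (by linarith)
  · have hmain : ∀ r, a / 2 ≤ r → r ≤ 2 * b → |P r - v r| ≤ S * ((1 + S / c * T) * ε) := by
      intro r h1 h2
      have e : P r - v r = ∫ x in (a / 2)..r, (k x - g x) := by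
        rw [intervalIntegral.integral_sub (hkc.intervalIntegrable _ _)
          (hIg _ _ ha2 (ha2.trans_le h1)), h.integral_eq_sub ha2 (ha2.trans_le h1), hva, sub_zero]
      rw [e]
      exact abs_intervalIntegral_le_of_eLpNorm_le (hkc.aestronglyMeasurable.sub hg.1)
        (by positivity) h1 h2 hd2
    have hle : S * ((1 + S / c * T) * ε) ≤ (1 + S / c * T) * (1 + S) * ε := by
      have : 0 ≤ (1 + S / c * T) * ε := by positivity
      nlinarith
    have h0 : 0 ≤ (1 + S / c * T) * (1 + S) * ε := by positivity
    rcases lt_or_ge r (a / 2) with h1 | h1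
    · rw [hPl r h1.le, hv0 r (fun h => by linarith [h.1])]; simpa using h0
    rcases lt_or_ge (2 * b) r with h2 | h2
    · rw [hPr r h2.le, hv0 r (fun h => by linarith [h.2])]; simpa using h0
    exact (hmain r h1 h2).trans hle

/-! ### Radial functions with given profiles belong to the weighted Sobolev space -/

/-- The jet of the radial function with profile `v`, where `g` is the derivative of `v`. -/
def radialJetFun (v g : ℝ → ℝ) (α : ℕ × ℕ) : Plane → ℝ :=
  if α = (0, 0) then fun x => v ‖x‖
  else if α = (1, 0) then fun x => x 0 / ‖x‖ * g ‖x‖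
  else fun x => x 1 / ‖x‖ * g ‖x‖

theorem MultiIdx.cases_one (α : MultiIdx 1) :
    α = MultiIdx.zero 1 ∨ α = MultiIdx.one 0 ∨ α = MultiIdx.one 1 := by
  revert α; decide

theorem radialJetFun_one (v g : ℝ → ℝ) (i : Fin 2) :
    radialJetFun v g (MultiIdx.one i).1 = fun x => x i / ‖x‖ * g ‖x‖ := by
  fin_cases i <;> simp [radialJetFun, MultiIdx.one]

theorem eLpNorm_radialJetFun_sub_le (w : ℕ → Plane → ℝ) (v g v' g' : ℝ → ℝ) (α : MultiIdx 1) :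
    eLpNorm (fun x => radialJetFun v g α.1 x - radialJetFun v' g' α.1 x) 2
        (weightedMeasure (w α.order))
      ≤ eLpNorm (fun x => v ‖x‖ - v' ‖x‖) 2 (weightedMeasure (w 0))
        + eLpNorm (fun x => g ‖x‖ - g' ‖x‖) 2 (weightedMeasure (w 1)) := by
  have h1 : ∀ i : Fin 2, eLpNorm (fun x => radialJetFun v g (MultiIdx.one i).1 x
      - radialJetFun v' g' (MultiIdx.one i).1 x) 2 (weightedMeasure (w 1))
      ≤ eLpNorm (fun x => g ‖x‖ - g' ‖x‖) 2 (weightedMeasure (w 1)) := by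
    intro i
    refine eLpNorm_mono fun x => ?_
    simp only [radialJetFun_one]
    rw [← mul_sub, norm_mul]
    exact mul_le_of_le_one_left (norm_nonneg _) (abs_coord_div_norm_le i x)
  rcases α.cases_one with rfl | rfl | rfl
  · exact le_self_add
  · exact (h1 0).trans le_add_self
  · exact (h1 1).trans le_add_self

/-- The radial function with profile `v` belongs to the weighted Sobolev space of order one, with
radial derivative of profile `g`. -/
def IsProfilePair (w : ℕ → Plane → ℝ) (v g : ℝ → ℝ) : Prop :=
  ∃ F ∈ sobolev 1 w, ∀ α : MultiIdx 1, F α =ᵐ[volume] radialJetFun v g α.1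

theorem memLp_radialJetFun {w : ℕ → Plane → ℝ} (hw : ∀ k, IsWeight (w k)) {v g : ℝ → ℝ}
    (hgm : Measurable g) (hv : MemLp (fun x => v ‖x‖) 2 (weightedMeasure (w 0)))
    (hg : MemLp (fun x => g ‖x‖) 2 (weightedMeasure (w 1))) (α : MultiIdx 1) :
    MemLp (radialJetFun v g α.1) 2 (weightedMeasure (w α.order)) := by
  have h1 : ∀ i : Fin 2, MemLp (radialJetFun v g (MultiIdx.one i).1) 2
      (weightedMeasure (w 1)) := by
    intro i
    rw [radialJetFun_one]
    refine hg.mono ?_ (Eventually.of_forall fun x => ?_)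
    · exact (hw 1).aestronglyMeasurable_iff.2 ((measurable_coord_div_norm i).mul
        (hgm.comp measurable_norm)).aestronglyMeasurable
    · rw [norm_mul]
      exact mul_le_of_le_one_left (norm_nonneg _) (abs_coord_div_norm_le i x)
  rcases α.cases_one with rfl | rfl | rfl
  · exact hv
  · exact h1 0
  · exact h1 1

/-- The Sobolev space is closed, and convergence of jets is convergence of each component, which the
norms of the function and of the radial derivative control. -/
theorem IsProfilePair.of_approx {w : ℕ → Plane → ℝ} (hw : ∀ k, IsWeight (w k)) {v g : ℝ → ℝ}
    (hgm : Measurable g) (hv : MemLp (fun x => v ‖x‖) 2 (weightedMeasure (w 0)))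
    (hg : MemLp (fun x => g ‖x‖) 2 (weightedMeasure (w 1)))
    {V G : ℕ → ℝ → ℝ} (hVG : ∀ n, IsProfilePair w (V n) (G n))
    (hV : Tendsto (fun n => eLpNorm (fun x => V n ‖x‖ - v ‖x‖) 2 (weightedMeasure (w 0))) atTop
      (𝓝 0))
    (hG : Tendsto (fun n => eLpNorm (fun x => G n ‖x‖ - g ‖x‖) 2 (weightedMeasure (w 1))) atTop
      (𝓝 0)) : IsProfilePair w v g := by
  choose Fn hFn hFn' using hVG
  have hmem := memLp_radialJetFun hw hgm hv hg
  set F : Jet 1 w := WithLp.toLp 1 fun α => (hmem α).toLp _ with hF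
  have hFα : ∀ α, F α =ᵐ[weightedMeasure (w α.order)] radialJetFun v g α.1 := fun α =>
    (hmem α).coeFn_toLp
  refine ⟨F, ?_, fun α => ?_⟩
  · refine (Submodule.isClosed_topologicalClosure (testJets 1 w)).mem_of_tendsto (f := Fn)
      (b := atTop) ?_ (Eventually.of_forall hFn)
    have h1 : Tendsto (fun n => WithLp.ofLp (Fn n)) atTop (𝓝 (WithLp.ofLp F)) := by
      rw [tendsto_pi_nhds]
      intro α
      rw [Lp.tendsto_Lp_iff_tendsto_eLpNorm']
      have h2 := hV.add hG
      rw [add_zero] at h2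
      refine tendsto_of_tendsto_of_tendsto_of_le_of_le tendsto_const_nhds h2 (fun _ => zero_le)
        (fun n => ?_)
      refine le_trans (le_of_eq ?_) (eLpNorm_radialJetFun_sub_le w (V n) (G n) v g α)
      refine eLpNorm_congr_ae ?_
      have h3 := hFn' n α
      rw [EventuallyEq, ← (hw α.order).ae_eq] at h3
      filter_upwards [h3, hFα α] with x h4 h5
      rw [Pi.sub_apply]
      exact congrArg₂ _ h4 h5
    exact ((PiLp.continuous_toLp 1 _).tendsto _).comp h1
  · rw [EventuallyEq, ← (hw α.order).ae_eq]
    exact hFα α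

/-- The norm is smooth off the origin, and near the origin the function vanishes identically. -/
theorem contDiff_radial {P : ℝ → ℝ} (hP : ContDiff ℝ ∞ P) {a : ℝ} (ha : 0 < a)
    (h0 : ∀ r, r < a → P r = 0) : ContDiff ℝ ∞ fun x : Plane => P ‖x‖ := by
  rw [contDiff_iff_contDiffAt]
  intro x
  by_cases hx : x = 0
  · refine (contDiffAt_const (c := (0 : ℝ))).congr_of_eventuallyEq ?_
    have : ∀ᶠ y : Plane in 𝓝 x, ‖y‖ < a := by
      rw [hx]
      exact continuous_norm.continuousAt.eventually_lt_const (by simpa using ha)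
    filter_upwards [this] with y hy using h0 _ hy
  · exact hP.contDiffAt.comp x (contDiffAt_norm ℝ hx)

theorem partialDeriv_radial {P : ℝ → ℝ} (hP : ContDiff ℝ ∞ P) (i : Fin 2) {x : Plane}
    (hx : x ≠ 0) : partialDeriv i (fun x : Plane => P ‖x‖) x = x i / ‖x‖ * deriv P ‖x‖ := by
  have hn : ‖x‖ ≠ 0 := norm_ne_zero_iff.2 hx
  have h1 := ((hasStrictFDerivAt_norm_sq x).hasFDerivAt).sqrt (pow_ne_zero 2 hn)
  simp only [Real.sqrt_sq (norm_nonneg _)] at h1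
  have h2 := ((hP.differentiable (by simp)) ‖x‖).hasDerivAt.comp_hasFDerivAt x h1
  have h3 : fderiv ℝ (fun x : Plane => P ‖x‖) x = _ := h2.fderiv
  rw [partialDeriv, h3]
  have h4 : inner ℝ x (EuclideanSpace.single i (1 : ℝ)) = x i := by
    simp [EuclideanSpace.inner_single_right]
  simp only [_root_.smul_apply, innerSL_apply_apply, h4, smul_eq_mul, nsmul_eq_mul]
  push_cast
  field_simp

theorem exists_weight_upper_bound {w : Plane → ℝ} (hw : IsWeight w) (hc : ContinuousOn w {0}ᶜ)
    {a : ℝ} (ha : 0 < a) (b : ℝ) :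
    ∃ M, 0 < M ∧ ∀ x : Plane, a ≤ ‖x‖ → ‖x‖ ≤ b → w x ≤ M := by
  have hw' : IsWeight fun x => (w x)⁻¹ := ⟨hw.measurable.inv, fun x hx => inv_pos.2 (hw.pos x hx)⟩
  obtain ⟨c, hc0, h⟩ := exists_weight_lower_bound hw'
    (hc.inv₀ fun x hx => (hw.pos x hx).ne') ha b
  refine ⟨c⁻¹, inv_pos.2 hc0, fun x h1 h2 => ?_⟩
  have hx : x ≠ 0 := norm_pos_iff.1 (ha.trans_le h1)
  rw [le_inv_comm₀ (hw.pos x hx) hc0]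
  exact h x h1 h2

theorem exists_annulus_bound {w : Plane → ℝ} (hw : IsWeight w) (hc : ContinuousOn w {0}ᶜ)
    {a : ℝ} (ha : 0 < a) (b : ℝ) :
    ∃ M : ℝ≥0∞, M ≠ ⊤ ∧ ∀ f : ℝ → ℝ, Measurable f → (∀ r, r ∉ Icc a b → f r = 0) →
      eLpNorm (fun x => f ‖x‖) 2 (weightedMeasure w) ≤ M * eLpNorm f 2 volume := by
  obtain ⟨M, hM, hwM⟩ := exists_weight_upper_bound hw hc ha b
  -- The square of this constant is M² (the bound on the weight) times the length of the circle
  -- times |b|, which bounds the Jacobian r on the annulus.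
  refine ⟨ENNReal.ofReal (M * Real.sqrt ((arc univ).toReal * |b|)), ENNReal.ofReal_ne_top,
    fun f hf h0 => ?_⟩
  rw [eLpNorm_weightedMeasure hw.measurable]
  rw [← ENNReal.pow_le_pow_left_iff two_ne_zero, mul_pow, eLpNorm_two_sq, eLpNorm_two_sq]
  have h1 : ∫⁻ x, ‖w x * f ‖x‖‖ₑ ^ 2 ≤ ∫⁻ x : Plane, ENNReal.ofReal (M ^ 2) * ‖f ‖x‖‖ₑ ^ 2 := by
    refine lintegral_mono fun x => ?_
    rw [enorm_mul_sq]
    by_cases hx : ‖x‖ ∈ Icc a b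
    · have hx0 : x ≠ 0 := norm_pos_iff.1 (ha.trans_le hx.1)
      have := (hw.pos x hx0).le
      gcongr
      exact hwM x hx.1 hx.2
    · rw [h0 _ hx]; simp
  refine h1.trans ?_
  rw [lintegral_radial (f := fun r => ENNReal.ofReal (M ^ 2) * ‖f r‖ₑ ^ 2) (by fun_prop),
    ← ENNReal.ofReal_pow (by positivity), mul_pow, Real.sq_sqrt (by positivity),
    ← mul_assoc, ENNReal.ofReal_mul (by positivity), ENNReal.ofReal_mul (by positivity),
    ENNReal.ofReal_toReal (measure_lt_top _ _).ne, mul_comm (ENNReal.ofReal (M ^ 2)), mul_assoc,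
    mul_assoc]
  gcongr
  rw [← lintegral_const_mul' _ _ ENNReal.ofReal_ne_top,
    ← lintegral_const_mul' _ _ ENNReal.ofReal_ne_top]
  refine (setLIntegral_le_lintegral _ _).trans (lintegral_mono fun r => ?_)
  by_cases hr : r ∈ Icc a b
  · rw [← mul_assoc, mul_comm (ENNReal.ofReal r), mul_assoc]
    gcongr
    exact hr.2.trans (le_abs_self b)
  · rw [h0 _ hr]; simp

theorem memLp_of_annulus {w : Plane → ℝ} (hw : IsWeight w) (hc : ContinuousOn w {0}ᶜ)
    {a b : ℝ} (ha : 0 < a) {f : ℝ → ℝ} (hf : Measurable f)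
    (hfL : MemLp (fun x => f ‖x‖) 2 (weightedMeasure w)) :
    MemLp ((Icc a b).indicator f) 2 volume := by
  obtain ⟨c, hc0, hwc⟩ := exists_weight_lower_bound hw hc ha b
  have hfn : Measurable fun x : Plane => (Icc a b).indicator f ‖x‖ :=
    (hf.indicator measurableSet_Icc).comp measurable_norm
  have h1 : MemLp (fun x : Plane => (Icc a b).indicator f ‖x‖) 2 volume := by
    refine ((hw.memLp_iff (hf.comp measurable_norm).aestronglyMeasurable).1 hfL).of_le_mul
      (c := c⁻¹) hfn.aestronglyMeasurable (Eventually.of_forall fun x => ?_)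
    by_cases hx : ‖x‖ ∈ Icc a b
    · have h2 := hwc x hx.1 hx.2
      rw [indicator_of_mem hx, norm_mul, Real.norm_of_nonneg (hc0.le.trans h2), ← mul_assoc]
      refine le_mul_of_one_le_left (norm_nonneg _) ?_
      rw [inv_mul_eq_div]
      exact (one_le_div hc0).2 h2
    · rw [indicator_of_notMem hx]; simp only [norm_zero]; positivity
  rw [memLp_two_iff_lintegral (hf.indicator measurableSet_Icc).aestronglyMeasurable]
  rw [memLp_two_iff_lintegral hfn.aestronglyMeasurable,
    lintegral_radial (f := fun r => ‖(Icc a b).indicator f r‖ₑ ^ 2)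
      (by have := hf.indicator (measurableSet_Icc (a := a) (b := b)); fun_prop)] at h1
  have h2 := ENNReal.lt_top_of_mul_ne_top_right h1.ne arc_univ_ne_zero
  have h3 : ∫⁻ r, ‖(Icc a b).indicator f r‖ₑ ^ 2 ≤ ENNReal.ofReal a⁻¹ *
      ∫⁻ r in Ioi (0 : ℝ), ENNReal.ofReal r * ‖(Icc a b).indicator f r‖ₑ ^ 2 := by
    rw [← lintegral_const_mul' _ _ ENNReal.ofReal_ne_top, ← lintegral_indicator measurableSet_Ioi]
    refine lintegral_mono fun r => ?_
    by_cases hr : r ∈ Icc a b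
    · have hr0 : r ∈ Ioi (0 : ℝ) := ha.trans_le hr.1
      rw [indicator_of_mem hr0, ← mul_assoc, ← ENNReal.ofReal_mul (by positivity)]
      refine le_mul_of_one_le_left zero_le ?_
      rw [ENNReal.one_le_ofReal, inv_mul_eq_div]
      exact (one_le_div ha).2 hr.1
    · rw [indicator_of_notMem hr]; simp
  exact h3.trans_lt (ENNReal.mul_lt_top ENNReal.ofReal_lt_top h2)

theorem memLp_of_bounded_of_support {f : ℝ → ℝ} (hf : Measurable f) {a b C : ℝ}
    (h0 : ∀ r, r ∉ Icc a b → f r = 0) (hC : ∀ r, |f r| ≤ C) :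
    MemLp f 2 volume ∧ eLpNorm f 2 volume ≤
      ENNReal.ofReal C * eLpNorm ((Icc a b).indicator (fun _ : ℝ => (1 : ℝ))) 2 volume := by
  have h1 : MemLp ((Icc a b).indicator (fun _ : ℝ => (1 : ℝ))) 2 volume :=
    memLp_indicator_const 2 measurableSet_Icc 1 (Or.inr (by simp))
  have h2 : ∀ r, ‖f r‖ ≤ C * ‖(Icc a b).indicator (fun _ : ℝ => (1 : ℝ)) r‖ := by
    intro r
    by_cases hr : r ∈ Icc a b
    · rw [indicator_of_mem hr]; simpa using hC r
    · rw [indicator_of_notMem hr, h0 r hr]; simp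
  exact ⟨h1.of_le_mul hf.aestronglyMeasurable (Eventually.of_forall h2),
    eLpNorm_le_mul_eLpNorm_of_ae_le_mul (Eventually.of_forall h2) 2⟩

theorem isProfilePair_of_smooth {w : ℕ → Plane → ℝ} (hw : ∀ k, IsWeight (w k))
    (hc : ∀ k, ContinuousOn (w k) {0}ᶜ)
    {P : ℝ → ℝ} (hP : ContDiff ℝ ∞ P) {a b : ℝ} (ha : 0 < a)
    (h0 : ∀ r, r ∉ Icc a b → P r = 0) (h0' : ∀ r, r ∉ Icc a b → deriv P r = 0) :
    IsProfilePair w P (deriv P) ∧ MemLp (fun x => P ‖x‖) 2 (weightedMeasure (w 0)) ∧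
      MemLp (fun x => deriv P ‖x‖) 2 (weightedMeasure (w 1)) := by
  have hL : ∀ (k : ℕ) (f : ℝ → ℝ), Continuous f → (∀ r, r ∉ Icc a b → f r = 0) →
      MemLp (fun x => f ‖x‖) 2 (weightedMeasure (w k)) := by
    intro k f hf hf0
    obtain ⟨M, hM, h⟩ := exists_annulus_bound (hw k) (hc k) ha b
    refine ⟨(hw k).aestronglyMeasurable_iff.2
      (hf.comp continuous_norm).measurable.aestronglyMeasurable, ?_⟩
    refine (h f hf.measurable hf0).trans_lt (ENNReal.mul_lt_top hM.lt_top ?_)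
    exact (hf.memLp_of_hasCompactSupport
      (HasCompactSupport.intro isCompact_Icc fun r hr => hf0 r hr)).2
  have hPc := hP.continuous
  have hPc' : Continuous (deriv P) := hP.continuous_deriv (by simp)
  have hv := hL 0 P hPc h0
  have hg := hL 1 (deriv P) hPc' h0'
  refine ⟨?_, hv, hg⟩
  have hmem := memLp_radialJetFun hw hPc'.measurable hv hg
  refine ⟨WithLp.toLp 1 fun α => (hmem α).toLp _, ?_, fun α => ?_⟩
  · refine Submodule.le_topologicalClosure _ ?_
    refine ⟨fun x => P ‖x‖, contDiff_radial hP ha fun r hr => h0 r fun h => ?_, ?_, fun α => ?_⟩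
    · exact absurd h.1 (not_le.2 hr)
    · refine HasCompactSupport.intro (isCompact_closedBall (0 : Plane) b) fun x hx => h0 _ fun h => ?_
      exact hx (by simpa using h.2)
    · refine ((hmem α).coeFn_toLp).trans ?_
      rw [EventuallyEq, (hw _).ae_eq]
      have h1 : ∀ i : Fin 2, ∀ᵐ x, radialJetFun P (deriv P) (MultiIdx.one i).1 x
          = partialDeriv i (fun x => P ‖x‖) x := by
        intro i
        filter_upwards [ae_ne_zero] with x hx
        rw [radialJetFun_one, partialDeriv_radial hP i hx]
      rcases α.cases_one with rfl | rfl | rfl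
      · exact Eventually.of_forall fun x => rfl
      · exact h1 0
      · exact h1 1
  · rw [EventuallyEq, ← (hw _).ae_eq]
    exact (hmem α).coeFn_toLp

/-- On a fixed annulus the weighted planar norms are controlled by one-dimensional L² norms, so the
smooth approximants of the profile give test functions converging in the Sobolev norm. -/
theorem isProfilePair_of_support {w : ℕ → Plane → ℝ} (hw : ∀ k, IsWeight (w k))
    (hc : ∀ k, ContinuousOn (w k) {0}ᶜ) {v g : ℝ → ℝ} (h : HasRadialDeriv v g)
    (hvm : Measurable v) (hgm : Measurable g)
    (hv : MemLp (fun x => v ‖x‖) 2 (weightedMeasure (w 0)))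
    (hg : MemLp (fun x => g ‖x‖) 2 (weightedMeasure (w 1)))
    {a b : ℝ} (ha : 0 < a) (hab : a < b) (hv0 : ∀ r, r ∉ Icc a b → v r = 0)
    (hg0 : ∀ r, r ∉ Icc a b → g r = 0) : IsProfilePair w v g := by
  have hgL : MemLp g 2 volume := by
    have h1 := memLp_of_annulus (b := b) (hw 1) (hc 1) ha hgm hg
    have h2 : (Icc a b).indicator g = g := by
      rw [indicator_eq_self]
      intro r hr
      by_contra hr'
      exact hr (hg0 r hr')
    rwa [h2] at h1
  obtain ⟨K, hK, happ⟩ := exists_smooth_profile_approx h ha hab hv0 hg0 hgL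
  choose P hP hP0 hP0' hPg hPv using fun n : ℕ =>
    happ (1 / ((n : ℝ) + 1)) (by positivity)
  have ha2 : 0 < a / 2 := by positivity
  have hout : ∀ r, r ∉ Icc (a / 2) (2 * b) → r ∉ Icc a b := fun r hr hr' =>
    hr ⟨by linarith [hr'.1], by linarith [hr'.2]⟩
  obtain ⟨M0, hM0, hB0⟩ := exists_annulus_bound (hw 0) (hc 0) ha2 (2 * b)
  obtain ⟨M1, hM1, hB1⟩ := exists_annulus_bound (hw 1) (hc 1) ha2 (2 * b)
  have hlim : Tendsto (fun n : ℕ => ENNReal.ofReal (K * (1 / ((n : ℝ) + 1)))) atTop (𝓝 0) := by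
    have := ENNReal.tendsto_ofReal (tendsto_one_div_add_atTop_nhds_zero_nat.const_mul K)
    simpa using this
  have hI : eLpNorm ((Icc (a / 2) (2 * b)).indicator (fun _ : ℝ => (1 : ℝ))) 2 volume ≠ ⊤ :=
    (memLp_indicator_const 2 measurableSet_Icc (1 : ℝ) (Or.inr (by simp))).2.ne
  refine IsProfilePair.of_approx hw hgm hv hg
    (fun n => (isProfilePair_of_smooth hw hc (hP n) ha2 (hP0 n) (hP0' n)).1) ?_ ?_
  · have hlim' := ENNReal.Tendsto.const_mul (a := M0 *
      eLpNorm ((Icc (a / 2) (2 * b)).indicator (fun _ : ℝ => (1 : ℝ))) 2 volume) hlim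
      (Or.inr (ENNReal.mul_ne_top hM0 hI))
    rw [mul_zero] at hlim'
    refine tendsto_of_tendsto_of_tendsto_of_le_of_le tendsto_const_nhds hlim' (fun _ => zero_le)
      (fun n => ?_)
    have hm : Measurable fun r => P n r - v r := (hP n).continuous.measurable.sub hvm
    have h0 : ∀ r, r ∉ Icc (a / 2) (2 * b) → P n r - v r = 0 := fun r hr => by
      rw [hP0 n r hr, hv0 r (hout r hr), sub_zero]
    refine (hB0 _ hm h0).trans ?_
    refine (mul_le_mul_right (memLp_of_bounded_of_support hm h0 (hPv n)).2 M0).trans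
      (le_of_eq ?_)
    ring
  · have hlim' := ENNReal.Tendsto.const_mul (a := M1) hlim (Or.inr hM1)
    rw [mul_zero] at hlim'
    refine tendsto_of_tendsto_of_tendsto_of_le_of_le tendsto_const_nhds hlim' (fun _ => zero_le)
      (fun n => ?_)
    have hm : Measurable fun r => deriv (P n) r - g r := (measurable_deriv _).sub hgm
    have h0 : ∀ r, r ∉ Icc (a / 2) (2 * b) → deriv (P n) r - g r = 0 := fun r hr => by
      rw [hP0' n r hr, hg0 r (hout r hr), sub_zero]
    exact (hB1 _ hm h0).trans (by gcongr; exact hPg n)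

/-! ### Truncation -/

/-- Dominated convergence applied to the squares. -/
theorem tendsto_eLpNorm_of_dominated {α : Type*} [MeasurableSpace α] {μ : Measure α}
    {f : ℕ → α → ℝ} {h : α → ℝ} {C : ℝ} (hf : ∀ n, AEStronglyMeasurable (f n) μ)
    (hh : MemLp h 2 μ) (hle : ∀ n, ∀ᵐ x ∂μ, ‖f n x‖ ≤ C * ‖h x‖)
    (hlim : ∀ᵐ x ∂μ, Tendsto (fun n => f n x) atTop (𝓝 0)) :
    Tendsto (fun n => eLpNorm (f n) 2 μ) atTop (𝓝 0) := by
  refine tendsto_zero_of_sq ?_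
  simp_rw [eLpNorm_two_sq]
  have hfin : ∫⁻ x, ENNReal.ofReal (C ^ 2) * ‖h x‖ₑ ^ 2 ∂μ ≠ ⊤ := by
    rw [lintegral_const_mul' _ _ ENNReal.ofReal_ne_top]
    exact ENNReal.mul_ne_top ENNReal.ofReal_ne_top ((memLp_two_iff_lintegral hh.1).1 hh).ne
  have key := tendsto_lintegral_of_dominated_convergence' (μ := μ)
    (F := fun n x => ‖f n x‖ₑ ^ 2) (f := fun _ => 0)
    (fun x => ENNReal.ofReal (C ^ 2) * ‖h x‖ₑ ^ 2) (fun n => (hf n).enorm.pow_const 2)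
    (fun n => ?_) hfin ?_
  · simpa using key
  · filter_upwards [hle n] with x hx
    rw [← enorm_mul_sq]
    gcongr
    rw [Real.enorm_eq_ofReal_abs, Real.enorm_eq_ofReal_abs]
    refine ENNReal.ofReal_le_ofReal ?_
    rw [abs_mul]
    exact hx.trans (mul_le_mul_of_nonneg_right (le_abs_self C) (abs_nonneg _))
  · filter_upwards [hlim] with x hx
    have h1 := (ENNReal.continuous_pow 2).tendsto 0 |>.comp (hx.enorm.trans_eq (by simp))
    simpa [Function.comp_def] using h1

/-- A smooth step from `0` on `(-∞, 1]` to `1` on `[2, ∞)`. -/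
def step (t : ℝ) : ℝ := Real.smoothTransition (t - 1)

theorem contDiff_step : ContDiff ℝ ∞ step :=
  Real.smoothTransition.contDiff.comp (by fun_prop)

theorem step_zero {t : ℝ} (h : t ≤ 1) : step t = 0 :=
  Real.smoothTransition.zero_of_nonpos (by linarith)

theorem step_one {t : ℝ} (h : 2 ≤ t) : step t = 1 :=
  Real.smoothTransition.one_of_one_le (by linarith)

theorem step_nonneg (t : ℝ) : 0 ≤ step t := Real.smoothTransition.nonneg _

theorem step_le_one (t : ℝ) : step t ≤ 1 := Real.smoothTransition.le_one _

theorem deriv_step_left {t : ℝ} (h : t < 1) : deriv step t = 0 := by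
  have : step =ᶠ[𝓝 t] fun _ => 0 := by
    filter_upwards [Iio_mem_nhds h] with s hs using step_zero hs.le
  rw [this.deriv_eq]; simp

theorem deriv_step_right {t : ℝ} (h : 2 < t) : deriv step t = 0 := by
  have : step =ᶠ[𝓝 t] fun _ => 1 := by
    filter_upwards [Ioi_mem_nhds h] with s hs using step_one (le_of_lt hs)
  rw [this.deriv_eq]; simp

theorem continuous_deriv_step : Continuous (deriv step) := contDiff_step.continuous_deriv (by simp)

theorem hasDerivAt_step (t : ℝ) : HasDerivAt step (deriv step t) t :=
  (contDiff_step.differentiable (by simp) t).hasDerivAt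

/-- The derivative of `step` is continuous and vanishes outside [1, 2]. -/
theorem exists_step_bound : ∃ K, 0 ≤ K ∧ ∀ t, |t * deriv step t| ≤ K := by
  obtain ⟨K, hK⟩ := (isCompact_Icc (a := (1 : ℝ)) (b := 2)).exists_bound_of_continuousOn
    (continuous_id.mul continuous_deriv_step).continuousOn
  have hK0 : 0 ≤ K := (norm_nonneg _).trans (hK 1 ⟨le_rfl, by norm_num⟩)
  refine ⟨K, hK0, fun t => ?_⟩
  rcases lt_or_ge t 1 with h | h
  · rw [deriv_step_left h]; simpa using hK0
  rcases lt_or_ge 2 t with h' | h'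
  · rw [deriv_step_right h']; simpa using hK0
  exact hK t ⟨h, h'⟩

/-- A smooth cut-off to the annulus `1 / N ≤ r ≤ 2 N`. -/
def annulusCut (N r : ℝ) : ℝ := step (N * r) * (1 - step (r / N))

/-- The derivative of `annulusCut`. -/
def annulusCutDeriv (N r : ℝ) : ℝ :=
  N * deriv step (N * r) * (1 - step (r / N)) - step (N * r) * (deriv step (r / N) / N)

theorem hasDerivAt_annulusCut (N r : ℝ) :
    HasDerivAt (annulusCut N) (annulusCutDeriv N r) r := by
  have h1 : HasDerivAt (fun r => step (N * r)) (deriv step (N * r) * N) r := by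
    exact ((hasDerivAt_step (N * r)).comp r ((hasDerivAt_id r).const_mul N)).congr_deriv (by ring)
  have h2 : HasDerivAt (fun r => 1 - step (r / N)) (-(deriv step (r / N) / N)) r := by
    have := ((hasDerivAt_step (r / N)).comp r ((hasDerivAt_id r).div_const N)).const_sub 1
    simpa [div_eq_mul_inv] using this
  refine (h1.mul h2).congr_deriv ?_
  unfold annulusCutDeriv
  ring

theorem continuous_annulusCutDeriv (N : ℝ) : Continuous (annulusCutDeriv N) := by
  have h1 := contDiff_step.continuous
  have h2 := continuous_deriv_step
  unfold annulusCutDeriv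
  fun_prop

theorem annulusCut_nonneg (N r : ℝ) : 0 ≤ annulusCut N r :=
  mul_nonneg (step_nonneg _) (by linarith [step_le_one (r / N)])

theorem annulusCut_le_one (N r : ℝ) : annulusCut N r ≤ 1 :=
  mul_le_one₀ (step_le_one _) (by linarith [step_le_one (r / N)])
    (by linarith [step_nonneg (r / N)])

theorem annulusCut_support {N r : ℝ} (hN : 0 < N) (hr : r ∉ Icc (1 / N) (2 * N)) :
    annulusCut N r = 0 ∧ annulusCutDeriv N r = 0 := by
  unfold annulusCut annulusCutDeriv
  rcases not_and_or.1 hr with h | h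
  · have h1 : N * r < 1 := by
      rw [not_le, lt_div_iff₀ hN] at h; linarith
    rw [step_zero h1.le, deriv_step_left h1]; simp
  · have h1 : 2 < r / N := by
      rw [lt_div_iff₀ hN]; exact not_le.1 h
    rw [step_one h1.le, deriv_step_right h1]; simp

theorem annulusCut_core {N r : ℝ} (hN : 0 < N) (h1 : 2 < N * r) (h2 : r < N) :
    annulusCut N r = 1 ∧ annulusCutDeriv N r = 0 := by
  unfold annulusCut annulusCutDeriv
  have h3 : r / N < 1 := (div_lt_one hN).2 h2
  rw [step_one h1.le, step_zero h3.le, deriv_step_right h1, deriv_step_left h3]; simp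

/-- The quantity t step'(t) is invariant under dilation, so the bound is uniform in N. This
uniformity makes truncation work in scale-invariant weights. -/
theorem abs_mul_annulusCutDeriv_le {K : ℝ} (hK : ∀ t, |t * deriv step t| ≤ K) {N r : ℝ} :
    |r * annulusCutDeriv N r| ≤ 2 * K := by
  have h1 := hK (N * r)
  have h2 := hK (r / N)
  have e : r * annulusCutDeriv N r = (N * r * deriv step (N * r)) * (1 - step (r / N))
      - (r / N * deriv step (r / N)) * step (N * r) := by
    unfold annulusCutDeriv; ring
  rw [e]
  refine (abs_sub _ _).trans ?_
  rw [abs_mul (N * r * deriv step (N * r)), abs_mul (r / N * deriv step (r / N))]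
  have a1 : |1 - step (r / N)| ≤ 1 := by
    rw [abs_le]; constructor <;> linarith [step_nonneg (r / N), step_le_one (r / N)]
  have a2 : |step (N * r)| ≤ 1 := by
    rw [abs_le]; constructor <;> linarith [step_nonneg (N * r), step_le_one (N * r)]
  have b1 := mul_le_mul h1 a1 (abs_nonneg _) ((abs_nonneg _).trans h1)
  have b2 := mul_le_mul h2 a2 (abs_nonneg _) ((abs_nonneg _).trans h2)
  linarith

theorem eventually_annulusCut_core {r : ℝ} (hr : 0 < r) :
    ∀ᶠ n : ℕ in atTop, annulusCut ((n : ℝ) + 1) r = 1 ∧ annulusCutDeriv ((n : ℝ) + 1) r = 0 := by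
  have h1 : ∀ᶠ n : ℕ in atTop, max (2 / r) r < (n : ℝ) := by
    exact tendsto_natCast_atTop_atTop.eventually_gt_atTop _
  filter_upwards [h1] with n hn
  have a1 : 2 / r < n := (le_max_left _ _).trans_lt hn
  have a2 : r < n := (le_max_right _ _).trans_lt hn
  rw [div_lt_iff₀ hr] at a1
  exact annulusCut_core (by positivity) (by nlinarith) (by linarith)

/-- Every radial function with a locally absolutely continuous profile and finite norm belongs to
the weighted Sobolev space of order one. -/
theorem isProfilePair {w : ℕ → Plane → ℝ} (hw : ∀ k, IsWeight (w k))
    (hc : ∀ k, ContinuousOn (w k) {0}ᶜ) {C : ℝ} (hC : ∀ x, x ≠ 0 → w 1 x ≤ C * (‖x‖ * w 0 x))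
    {v g : ℝ → ℝ} (h : HasRadialDeriv v g) (hvm : Measurable v) (hgm : Measurable g)
    (hv : MemLp (fun x => v ‖x‖) 2 (weightedMeasure (w 0)))
    (hg : MemLp (fun x => g ‖x‖) 2 (weightedMeasure (w 1))) : IsProfilePair w v g := by
  obtain ⟨K, hK0, hK⟩ := exists_step_bound
  have hcutm : ∀ N, Measurable (annulusCut N) := fun N =>
    (continuous_iff_continuousAt.2 fun r => (hasDerivAt_annulusCut N r).continuousAt).measurable
  have hcutm' : ∀ N, Measurable (annulusCutDeriv N) := fun N =>
    (continuous_annulusCutDeriv N).measurable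
  have hm : ∀ {f : ℝ → ℝ}, Measurable f → ∀ k,
      AEStronglyMeasurable (fun x : Plane => f ‖x‖) (weightedMeasure (w k)) := fun hf k =>
    (hw k).aestronglyMeasurable_iff.2 (hf.comp measurable_norm).aestronglyMeasurable
  have habs : ∀ N r, |annulusCut N r| ≤ 1 := fun N r => by
    rw [abs_le]; constructor <;> linarith [annulusCut_nonneg N r, annulusCut_le_one N r]
  have habs' : ∀ N r, |annulusCut N r - 1| ≤ 1 := fun N r => by
    rw [abs_le]; constructor <;> linarith [annulusCut_nonneg N r, annulusCut_le_one N r]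
  have hne : ∀ k, ∀ᵐ x ∂(weightedMeasure (w k)), x ≠ 0 := fun k => by
    rw [(hw k).ae_eq]; exact ae_ne_zero
  -- the cross term, dominated by the function itself
  have hcross : ∀ N x, x ≠ 0 → ‖w 1 x * (annulusCutDeriv N ‖x‖ * v ‖x‖)‖
      ≤ (C * (2 * K)) * ‖w 0 x * v ‖x‖‖ := by
    intro N x hx
    have h0 := (hw 0).pos x hx
    have h1 := (hw 1).pos x hx
    have hn := norm_pos_iff.2 hx
    have hC0 : 0 ≤ C := by
      by_contra hneg
      have := hC x hx
      have : C * (‖x‖ * w 0 x) < 0 := mul_neg_of_neg_of_pos (not_le.1 hneg) (by positivity)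
      linarith
    rw [norm_mul, norm_mul, norm_mul, Real.norm_of_nonneg h0.le, Real.norm_of_nonneg h1.le]
    have h2 := abs_mul_annulusCutDeriv_le hK (N := N) (r := ‖x‖)
    rw [abs_mul, abs_norm] at h2
    calc w 1 x * (‖annulusCutDeriv N ‖x‖‖ * ‖v ‖x‖‖)
        ≤ (C * (‖x‖ * w 0 x)) * (‖annulusCutDeriv N ‖x‖‖ * ‖v ‖x‖‖) := by
          gcongr; exact hC x hx
      _ = C * (‖x‖ * |annulusCutDeriv N ‖x‖|) * (w 0 x * ‖v ‖x‖‖) := by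
          rw [Real.norm_eq_abs (annulusCutDeriv N ‖x‖)]; ring
      _ ≤ _ := by gcongr
  have hwv : MemLp (fun x => w 0 x * v ‖x‖) 2 volume :=
    ((hw 0).memLp_iff (hvm.comp measurable_norm).aestronglyMeasurable).1 hv
  have hwm := (hw 1).measurable
  have hcrossm : ∀ N, AEStronglyMeasurable
      (fun x => w 1 x * (annulusCutDeriv N ‖x‖ * v ‖x‖)) volume := fun N => by
    have := hcutm' N
    exact Measurable.aestronglyMeasurable (by fun_prop)
  have hcrossL : ∀ N, MemLp (fun x => annulusCutDeriv N ‖x‖ * v ‖x‖) 2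
      (weightedMeasure (w 1)) := by
    intro N
    have := hcutm' N
    rw [(hw 1).memLp_iff (Measurable.aestronglyMeasurable (by fun_prop))]
    refine hwv.of_le_mul (c := C * (2 * K)) (hcrossm N) ?_
    filter_upwards [ae_ne_zero] with x hx using hcross N x hx
  have hvn : ∀ N, MemLp (fun x => annulusCut N ‖x‖ * v ‖x‖) 2 (weightedMeasure (w 0)) := by
    intro N
    refine hv.mono (hm ((hcutm N).mul hvm) 0) (Eventually.of_forall fun x => ?_)
    rw [norm_mul]
    exact mul_le_of_le_one_left (norm_nonneg _) (habs _ _)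
  have hgn : ∀ N, MemLp (fun x => annulusCut N ‖x‖ * g ‖x‖) 2 (weightedMeasure (w 1)) := by
    intro N
    refine hg.mono (hm ((hcutm N).mul hgm) 1) (Eventually.of_forall fun x => ?_)
    rw [norm_mul]
    exact mul_le_of_le_one_left (norm_nonneg _) (habs _ _)
  have hcut : ∀ N, HasRadialDeriv (annulusCut N) (annulusCutDeriv N) := fun N =>
    HasRadialDeriv.of_hasDerivAt_continuousOn (fun r _ => hasDerivAt_annulusCut N r)
      (continuous_annulusCutDeriv N).continuousOn
  -- By the product rule the truncated derivative carries a cross term with the derivative of the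
  -- cut-off.
  have hpair : ∀ n : ℕ, IsProfilePair w (fun r => annulusCut ((n : ℝ) + 1) r * v r)
      (fun r => annulusCutDeriv ((n : ℝ) + 1) r * v r + annulusCut ((n : ℝ) + 1) r * g r) := by
    intro n
    have hN : 0 < (n : ℝ) + 1 := by positivity
    refine isProfilePair_of_support hw hc ((hcut _).mul h) ((hcutm _).mul hvm)
      (((hcutm' _).mul hvm).add ((hcutm _).mul hgm)) (hvn _) ((hcrossL _).add (hgn _))
      (a := 1 / ((n : ℝ) + 1)) (b := 2 * ((n : ℝ) + 1)) (by positivity) ?_ ?_ ?_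
    · rw [div_lt_iff₀ hN]
      nlinarith [(Nat.cast_nonneg n : (0 : ℝ) ≤ n)]
    · intro r hr
      rw [(annulusCut_support hN hr).1, zero_mul]
    · intro r hr
      rw [(annulusCut_support hN hr).1, (annulusCut_support hN hr).2]; ring
  refine IsProfilePair.of_approx hw hgm hv hg hpair ?_ ?_
  · refine tendsto_eLpNorm_of_dominated (C := 1) (fun n => (hvn _).1.sub hv.1) hv
      (fun n => Eventually.of_forall fun x => ?_) ?_
    · rw [← sub_one_mul, norm_mul]
      gcongr
      exact habs' _ _
    · filter_upwards [hne 0] with x hx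
      refine tendsto_const_nhds.congr' ?_
      filter_upwards [eventually_annulusCut_core (norm_pos_iff.2 hx)] with n hn
      rw [hn.1]; ring
  · have t1 : Tendsto (fun n : ℕ => eLpNorm (fun x => annulusCutDeriv ((n : ℝ) + 1) ‖x‖ * v ‖x‖) 2
        (weightedMeasure (w 1))) atTop (𝓝 0) := by
      simp_rw [eLpNorm_weightedMeasure hwm]
      refine tendsto_eLpNorm_of_dominated (C := C * (2 * K)) (fun n => hcrossm _) hwv
        (fun n => ?_) ?_
      · filter_upwards [ae_ne_zero] with x hx using hcross _ x hx
      · filter_upwards [ae_ne_zero] with x hx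
        refine tendsto_const_nhds.congr' ?_
        filter_upwards [eventually_annulusCut_core (norm_pos_iff.2 hx)] with n hn
        rw [hn.2]; ring
    have t2 : Tendsto (fun n : ℕ => eLpNorm (fun x => annulusCut ((n : ℝ) + 1) ‖x‖ * g ‖x‖ - g ‖x‖)
        2 (weightedMeasure (w 1))) atTop (𝓝 0) := by
      refine tendsto_eLpNorm_of_dominated (C := 1) (fun n => (hgn _).1.sub hg.1) hg
        (fun n => Eventually.of_forall fun x => ?_) ?_
      · rw [← sub_one_mul, norm_mul]
        gcongr
        exact habs' _ _
      · filter_upwards [hne 1] with x hx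
        refine tendsto_const_nhds.congr' ?_
        filter_upwards [eventually_annulusCut_core (norm_pos_iff.2 hx)] with n hn
        rw [hn.1]; ring
    have t3 := t1.add t2
    rw [add_zero] at t3
    refine tendsto_of_tendsto_of_tendsto_of_le_of_le tendsto_const_nhds t3 (fun _ => zero_le)
      (fun n => ?_)
    simp only [add_sub_assoc]
    exact eLpNorm_add_le (hcrossL _).1 ((hgn _).1.sub hg.1) (by norm_num)

/-- Passing from order 0 to order 1 multiplies the weight by m ≤ 2|x|, which is the hypothesis
needed for truncation. The radial component of the gradient is g because the squares of the xᵢ/|x|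
sum to 1. -/
theorem exists_jet_of_profile (χ : RadialCutoff) (γ σ : ℝ) {v g : ℝ → ℝ} (h : HasRadialDeriv v g)
    (hvm : Measurable v) (hgm : Measurable g)
    (hv : MemLp (fun x => v ‖x‖) 2 (weightedMeasure (doubleWeight χ γ σ 0)))
    (hg : MemLp (fun x => g ‖x‖) 2 (weightedMeasure (doubleWeight χ γ σ 1))) :
    ∃ F : HDouble χ 1 γ σ, F.1.val =ᵐ[volume] (fun x => v ‖x‖) ∧
      F.1.radialDeriv =ᵐ[volume] fun x => g ‖x‖ := by
  have hw := isWeight_doubleWeight χ γ σ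
  have hC : ∀ x : Plane, x ≠ 0 →
      doubleWeight χ γ σ 1 x ≤ 2 * (‖x‖ * doubleWeight χ γ σ 0 x) := by
    intro x hx
    have hm := χ.m_pos hx
    have h1 := (χ.m_le x).trans (mul_le_mul_of_nonneg_left (min_le_left ‖x‖ 1) zero_le_two)
    have h2 : doubleWeight χ γ σ 1 x = χ.m x * doubleWeight χ γ σ 0 x := by
      simp only [doubleWeight, Nat.cast_one, Nat.cast_zero, add_zero]
      rw [Real.rpow_add hm, Real.rpow_one]; ring
    rw [h2, ← mul_assoc]
    exact mul_le_mul_of_nonneg_right h1 ((hw 0).pos x hx).le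
  obtain ⟨F, hF, hFα⟩ := isProfilePair hw (continuousOn_doubleWeight χ γ σ) hC h hvm hgm hv hg
  have h0 : F.val =ᵐ[volume] fun x => v ‖x‖ := hFα (MultiIdx.zero 1)
  refine ⟨⟨F, hF, v, hvm, ?_⟩, h0, ?_⟩
  · rw [EventuallyEq, (hw _).ae_eq]; exact h0
  · have h1 := fun i => hFα (MultiIdx.one i)
    filter_upwards [h1 0, h1 1, ae_ne_zero] with x e0 e1 hx
    have hn : ‖x‖ ≠ 0 := norm_ne_zero_iff.2 hx
    have hsq : x 0 ^ 2 + x 1 ^ 2 = ‖x‖ ^ 2 := by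
      rw [EuclideanSpace.norm_sq_eq]; simp
    rw [Jet.radialDeriv, Fin.sum_univ_two, e0, e1, radialJetFun_one, radialJetFun_one]
    field_simp
    rw [← hsq]; ring

/-! ### Local boundedness of functions in `H³` -/

/-- The point of the plane with coordinates `t`, `s`. -/
def pt (t s : ℝ) : Plane := WithLp.toLp 2 ![t, s]

theorem lintegral_plane (f : Plane → ℝ≥0∞) (hf : Measurable f) :
    ∫⁻ x, f x = ∫⁻ s, ∫⁻ t, f (pt t s) := by
  have h1 := (EuclideanSpace.volume_preserving_symm_measurableEquiv_toLp (Fin 2)).symm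
  have h2 := (volume_preserving_finTwoArrow ℝ).symm
  have h3 := (h2.trans h1 : MeasurePreserving _ _ _)
  rw [← h3.lintegral_comp hf, Measure.volume_eq_prod]
  exact lintegral_prod_symm' _ (hf.comp h3.measurable)

theorem hasDerivAt_pt_left {u : Plane → ℝ} (hu : ContDiff ℝ ∞ u) (t s : ℝ) :
    HasDerivAt (fun t => u (pt t s)) (partialDeriv 0 u (pt t s)) t := by
  have h1 : HasDerivAt (fun t : ℝ => pt t s) (EuclideanSpace.single 0 1) t := by
    have e : (fun t : ℝ => pt t s) = fun t => t • EuclideanSpace.single (0 : Fin 2) (1 : ℝ) + pt 0 s := by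
      funext t; ext i; fin_cases i <;> simp [pt]
    rw [e]
    simpa using ((hasDerivAt_id t).smul_const (EuclideanSpace.single (0 : Fin 2) (1 : ℝ))).add_const
      (pt 0 s)
  exact ((hu.differentiable (by simp)) (pt t s)).hasFDerivAt.comp_hasDerivAt t h1

theorem hasDerivAt_pt_right {u : Plane → ℝ} (hu : ContDiff ℝ ∞ u) (t s : ℝ) :
    HasDerivAt (fun s => u (pt t s)) (partialDeriv 1 u (pt t s)) s := by
  have h1 : HasDerivAt (fun s : ℝ => pt t s) (EuclideanSpace.single 1 1) s := by
    have e : (fun s : ℝ => pt t s) = fun s => s • EuclideanSpace.single (1 : Fin 2) (1 : ℝ) + pt t 0 := by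
      funext t; ext i; fin_cases i <;> simp [pt]
    rw [e]
    simpa using ((hasDerivAt_id s).smul_const (EuclideanSpace.single (1 : Fin 2) (1 : ℝ))).add_const
      (pt t 0)
  exact ((hu.differentiable (by simp)) (pt t s)).hasFDerivAt.comp_hasDerivAt s h1

theorem hasCompactSupport_partialDeriv (i : Fin 2) {u : Plane → ℝ} (hu : HasCompactSupport u) :
    HasCompactSupport (partialDeriv i u) :=
  (hu.fderiv (𝕜 := ℝ)).comp_left (g := fun L : Plane →L[ℝ] ℝ => L (EuclideanSpace.single i 1)) rfl

theorem hasCompactSupport_line {u : Plane → ℝ} (hu : HasCompactSupport u) (c : ℝ → Plane)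
    (hcoord : ∃ i : Fin 2, ∀ t, c t i = t) : HasCompactSupport fun t => u (c t) := by
  obtain ⟨i, hi⟩ := hcoord
  obtain ⟨R, hR⟩ := hu.isBounded.subset_closedBall 0
  refine HasCompactSupport.intro (isCompact_closedBall (0 : ℝ) R) fun t ht => ?_
  by_contra hne
  refine ht ?_
  have h1 := hR (subset_tsupport u hne)
  rw [mem_closedBall_zero_iff] at h1 ⊢
  rw [← hi t]
  exact (PiLp.norm_apply_le (c t) i).trans h1

theorem contDiff_pt_left (s : ℝ) : ContDiff ℝ ∞ fun t => pt t s := by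
  rw [contDiff_euclidean]
  intro i; fin_cases i <;> simp [pt] <;> fun_prop

theorem contDiff_pt_right (t : ℝ) : ContDiff ℝ ∞ fun s => pt t s := by
  rw [contDiff_euclidean]
  intro i; fin_cases i <;> simp [pt] <;> fun_prop

/-- The fundamental theorem of calculus is applied in one coordinate to u, then in the other to ∂₁u,
compact support removing the boundary terms. -/
theorem enorm_le_lintegral_mixed {u : Plane → ℝ} (hu : ContDiff ℝ ∞ u) (huc : HasCompactSupport u)
    (x : Plane) : ‖u x‖ₑ ≤ ∫⁻ y, ‖partialDeriv 0 (partialDeriv 1 u) y‖ₑ := by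
  have h1 := contDiff_partialDeriv 1 hu
  have h0 := contDiff_partialDeriv 0 h1
  have c1 := hasCompactSupport_partialDeriv 1 huc
  have hx : x = pt (x 0) (x 1) := by ext i; fin_cases i <;> simp [pt]
  rw [lintegral_plane _ (by have := h0.continuous; fun_prop), hx]
  have s1 := HasCompactSupport.enorm_le_lintegral_Ici_deriv
    (f := fun s => u (pt (x 0) s)) ((hu.comp (contDiff_pt_right _)).of_le (by simp))
    (hasCompactSupport_line huc _ ⟨1, fun s => by simp [pt]⟩) (x 1)
  refine s1.trans ((setLIntegral_le_lintegral _ _).trans (lintegral_mono fun s => ?_))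
  rw [(hasDerivAt_pt_right hu _ _).deriv]
  have s2 := HasCompactSupport.enorm_le_lintegral_Ici_deriv
    (f := fun t => partialDeriv 1 u (pt t s)) ((h1.comp (contDiff_pt_left _)).of_le (by simp))
    (hasCompactSupport_line c1 _ ⟨0, fun s => by simp [pt]⟩) (x 0)
  refine s2.trans ((setLIntegral_le_lintegral _ _).trans (lintegral_mono fun t => ?_))
  rw [(hasDerivAt_pt_left h1 _ _).deriv]

theorem partialDeriv_mul (i : Fin 2) {u v : Plane → ℝ} (hu : ContDiff ℝ ∞ u)
    (hv : ContDiff ℝ ∞ v) :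
    partialDeriv i (u * v) = partialDeriv i u * v + u * partialDeriv i v := by
  funext x
  have h1 : DifferentiableAt ℝ u x := (hu.differentiable (by simp)) x
  have h2 : DifferentiableAt ℝ v x := (hv.differentiable (by simp)) x
  simp only [partialDeriv, fderiv_mul h1 h2, Pi.add_apply, Pi.mul_apply,
    _root_.add_apply, _root_.smul_apply, smul_eq_mul]
  ring

theorem lintegral_mul_le_eLpNorm (γ : ℝ) (k : ℕ) {ζ : Plane → ℝ} (hζ : Continuous ζ)
    (hζc : HasCompactSupport ζ) :
    ∃ K : ℝ≥0∞, K ≠ ⊤ ∧ ∀ f : Plane → ℝ, Continuous f →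
      ∫⁻ x, ‖ζ x * f x‖ₑ ≤ K * eLpNorm f 2 (weightedMeasure (singleWeight γ k)) := by
  have hpos : ∀ x, 0 < singleWeight γ k x := fun x => Real.rpow_pos_of_pos (bracket_pos x) _
  have hwc : Continuous (singleWeight γ k) :=
    continuous_bracket.rpow_const fun x => Or.inl (bracket_pos x).ne'
  have hq : Continuous fun x => ζ x / singleWeight γ k x :=
    hζ.div hwc fun x => (hpos x).ne'
  have hqL : MemLp (fun x => ζ x / singleWeight γ k x) 2 volume := by
    refine hq.memLp_of_hasCompactSupport ?_
    simp only [div_eq_mul_inv]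
    exact hζc.mul_right
  refine ⟨_, hqL.2.ne, fun f hf => ?_⟩
  rw [eLpNorm_weightedMeasure hwc.measurable, ← eLpNorm_one_eq_lintegral_enorm]
  have e : (fun x => ζ x * f x) = (fun x => ζ x / singleWeight γ k x) •
      fun x => singleWeight γ k x * f x := by
    funext x
    have := (hpos x).ne'
    simp only [Pi.smul_apply', smul_eq_mul]
    field_simp
  rw [e]
  exact eLpNorm_smul_le_mul_eLpNorm (hwc.mul hf).aestronglyMeasurable hqL.1

/-- The function is localised by a bump equal to 1 on the ball, and its mixed derivative expanded by
Leibniz. Cauchy–Schwarz bounds the four resulting terms, which involve derivatives of orders 0, 1, 1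
and 2. -/
theorem exists_sup_bound (γ : ℝ) {R : ℝ} (hR : 0 < R) :
    ∃ K : ℝ≥0∞, K ≠ ⊤ ∧ ∀ u : Plane → ℝ, ContDiff ℝ ∞ u → ∀ B : ℝ≥0∞,
      (∀ α : MultiIdx 3, eLpNorm (multiDeriv α.1 u) 2
        (weightedMeasure (singleWeight γ α.order)) ≤ B) →
      ∀ x, ‖x‖ < R → ‖u x‖ₑ ≤ K * B := by
  let η : ContDiffBump (0 : Plane) := ⟨R, 2 * R, hR, by linarith⟩
  have hη : ContDiff ℝ ∞ (η : Plane → ℝ) := η.contDiff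
  have hηc : HasCompactSupport (η : Plane → ℝ) := η.hasCompactSupport
  have d1 := contDiff_partialDeriv 1 hη
  have d0 := contDiff_partialDeriv 0 hη
  have d01 := contDiff_partialDeriv 0 d1
  have c1 := hasCompactSupport_partialDeriv 1 hηc
  have c0 := hasCompactSupport_partialDeriv 0 hηc
  have c01 := hasCompactSupport_partialDeriv 0 c1
  obtain ⟨K1, hK1, b1⟩ := lintegral_mul_le_eLpNorm γ 0 d01.continuous c01
  obtain ⟨K2, hK2, b2⟩ := lintegral_mul_le_eLpNorm γ 1 d1.continuous c1
  obtain ⟨K3, hK3, b3⟩ := lintegral_mul_le_eLpNorm γ 1 d0.continuous c0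
  obtain ⟨K4, hK4, b4⟩ := lintegral_mul_le_eLpNorm γ 2 hη.continuous hηc
  refine ⟨K1 + K2 + K3 + K4, by simp [hK1, hK2, hK3, hK4], fun u hu B hB x hx => ?_⟩
  have u1 := contDiff_partialDeriv 1 hu
  have u0 := contDiff_partialDeriv 0 hu
  have u01 := contDiff_partialDeriv 0 u1
  have e1 : (η : Plane → ℝ) x = 1 := η.one_of_mem_closedBall (by simpa using hx.le)
  have e2 : u x = (η * u : Plane → ℝ) x := by simp [e1]
  have e3 : partialDeriv 0 (partialDeriv 1 (η * u : Plane → ℝ)) =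
      partialDeriv 0 (partialDeriv 1 η) * u + partialDeriv 1 η * partialDeriv 0 u
      + (partialDeriv 0 η * partialDeriv 1 u + η * partialDeriv 0 (partialDeriv 1 u)) := by
    rw [partialDeriv_mul 1 hη hu, partialDeriv_add 0 (u := partialDeriv 1 η * u) (v := η * partialDeriv 1 u)
        (d1.mul hu) (hη.mul u1),
      partialDeriv_mul 0 d1 hu, partialDeriv_mul 0 hη u1]
  rw [e2]
  refine (enorm_le_lintegral_mixed (u := (η * u : Plane → ℝ)) (hη.mul hu) hηc.mul_right x).trans ?_
  have hm : ∀ {f : Plane → ℝ}, ContDiff ℝ ∞ f → Measurable f := fun hf => hf.continuous.measurable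
  have i1 := (b1 u hu.continuous).trans
    (mul_le_mul_right (hB ⟨(0, 0), by decide⟩) K1)
  have i2 := (b2 _ u0.continuous).trans
    (mul_le_mul_right (hB ⟨(1, 0), by decide⟩) K2)
  have i3 := (b3 _ u1.continuous).trans
    (mul_le_mul_right (hB ⟨(0, 1), by decide⟩) K3)
  have i4 := (b4 _ u01.continuous).trans
    (mul_le_mul_right (hB ⟨(1, 1), by decide⟩) K4)
  rw [e3]
  have m1 := hm (d01.mul hu)
  have m2 := hm (d1.mul u0)
  have m3 := hm (d0.mul u1)
  calc _ ≤ ∫⁻ y, (‖partialDeriv 0 (partialDeriv 1 η) y * u y‖ₑ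
        + ‖partialDeriv 1 η y * partialDeriv 0 u y‖ₑ + (‖partialDeriv 0 η y * partialDeriv 1 u y‖ₑ
        + ‖η y * partialDeriv 0 (partialDeriv 1 u) y‖ₑ)) := by
        refine lintegral_mono fun y => ?_
        simp only [Pi.add_apply, Pi.mul_apply]
        exact (enorm_add_le _ _).trans (add_le_add (enorm_add_le _ _) (enorm_add_le _ _))
    _ ≤ K1 * B + K2 * B + (K3 * B + K4 * B) := by
        have m12 : Measurable fun y => ‖partialDeriv 0 (partialDeriv 1 η) y * u y‖ₑ
            + ‖partialDeriv 1 η y * partialDeriv 0 u y‖ₑ := m1.enorm.add m2.enorm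
        rw [lintegral_add_left m12, lintegral_add_left m1.enorm,
          lintegral_add_left m3.enorm]
        exact add_le_add (add_le_add i1 i2) (add_le_add i3 i4)
    _ = _ := by ring

/-- Test functions close to the jet are uniformly bounded on the ball by `exists_sup_bound`, and a
subsequence converges almost everywhere. -/
theorem locally_bounded_of_mem_sobolev {γ : ℝ} {F : Jet 3 (singleWeight γ)}
    (hF : F ∈ sobolev 3 (singleWeight γ)) {R : ℝ} (hR : 0 < R) :
    ∃ M : ℝ, ∀ᵐ x, ‖x‖ < R → |F.val x| ≤ M := by
  obtain ⟨K, hK, hKb⟩ := exists_sup_bound γ hR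
  choose u hu huc hua using fun n : ℕ => exists_test_approx hF
    (ε := 1 / ((n : ℝ) + 1)) (by positivity)
  set B : ℝ≥0∞ := ∑ α : MultiIdx 3, eLpNorm (F α) 2
    (weightedMeasure (singleWeight γ α.order)) + 1 with hB
  have hBt : B ≠ ⊤ := by
    simp only [hB, ne_eq, ENNReal.add_eq_top, ENNReal.sum_eq_top, Finset.mem_univ, true_and,
      ENNReal.one_ne_top, or_false, not_exists]
    exact fun α => (Lp.memLp (F α)).2.ne
  have hbound : ∀ n x, ‖x‖ < R → ‖u n x‖ₑ ≤ K * B := by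
    intro n
    refine hKb _ (hu n) B fun α => ?_
    have hc : Continuous (multiDeriv α.1 (u n)) :=
      (contDiff_iterate_partialDeriv 0 _ (contDiff_iterate_partialDeriv 1 _ (hu n))).continuous
    have e : multiDeriv α.1 (u n) = (F α : Plane → ℝ)
        + fun x => multiDeriv α.1 (u n) x - F α x := by
      funext x; simp
    rw [e]
    refine (eLpNorm_add_le (Lp.memLp (F α)).1 ?_ (by norm_num)).trans ?_
    · exact hc.aestronglyMeasurable.sub (Lp.memLp (F α)).1
    · refine add_le_add (Finset.single_le_sum (f := fun α : MultiIdx 3 => eLpNorm (F α) 2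
        (weightedMeasure (singleWeight γ α.order))) (fun _ _ => zero_le) (Finset.mem_univ α)) ?_
      refine (hua n α).trans ?_
      rw [ENNReal.ofReal_le_one, div_le_one (by positivity)]
      linarith [(Nat.cast_nonneg n : (0 : ℝ) ≤ n)]
  have hw := isWeight_singleWeight γ
  have hlim : Tendsto (fun n => eLpNorm (u n - F.val) 2 (weightedMeasure (singleWeight γ 0))) atTop
      (𝓝 0) := by
    have h1 := ENNReal.tendsto_ofReal tendsto_one_div_add_atTop_nhds_zero_nat
    rw [ENNReal.ofReal_zero] at h1
    exact tendsto_of_tendsto_of_tendsto_of_le_of_le tendsto_const_nhds h1 (fun _ => zero_le)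
      (fun n => hua n (MultiIdx.zero 3))
  have hmeas := tendstoInMeasure_of_tendsto_eLpNorm (p := 2) two_ne_zero
    (fun n => (hu n).continuous.aestronglyMeasurable) F.measurable_val.aestronglyMeasurable hlim
  obtain ⟨ns, -, hns⟩ := hmeas.exists_seq_tendsto_ae
  rw [(hw 0).ae_eq] at hns
  refine ⟨(K * B).toReal, ?_⟩
  filter_upwards [hns] with x hx hxR
  refine le_of_tendsto hx.abs (Eventually.of_forall fun n => ?_)
  have h1 := ENNReal.toReal_mono (ENNReal.mul_ne_top hK hBt) (hbound (ns n) x hxR)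
  simpa using h1

/-! ### The first-order radial equation -/

/-- A bounded coefficient `V` with `V - κ = O(1/r)`, and its primitive `Φ` with `Φ(0) = 0`. -/
structure IsDrift (V Φ : ℝ → ℝ) (κ M : ℝ) : Prop where
  measurable : Measurable V
  hasDerivAt : ∀ r, 0 < r → HasDerivAt Φ (V r) r
  abs_le : ∀ r, 0 < r → |V r| ≤ M
  abs_sub_le : ∀ r, 0 < r → |V r - κ| ≤ M / r
  abs_primitive_le : ∀ r, 0 < r → |Φ r| ≤ M * r
  le_sub : ∀ r t, 0 < r → r ≤ t → κ / 2 * (t - r) - M ≤ Φ t - Φ r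

/-- A differentiable function with almost everywhere bounded derivative is Lipschitz. -/
theorem abs_sub_le_of_ae_deriv_le {f : ℝ → ℝ} (hf : DifferentiableOn ℝ f (Ioi 0)) {M : ℝ}
    (hM : ∀ R : ℝ, 0 < R → ∃ B : ℝ, ∀ᵐ r : ℝ, 0 < r → r < R → |deriv f r| ≤ B) {R : ℝ}
    (hR : ∀ᵐ r : ℝ, 0 < r → r < R → |deriv f r| ≤ M) {a b : ℝ} (ha : 0 < a) (hab : a ≤ b)
    (hb : b < R) : |f b - f a| ≤ M * (b - a) := by
  obtain ⟨B, hB⟩ := hM (b + 1) (by linarith)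
  have hsub : ∀ᵐ r : ℝ, r ∈ uIoc a b → |deriv f r| ≤ M := by
    filter_upwards [hR] with r hr hm
    rw [uIoc_of_le hab] at hm
    exact hr (ha.trans hm.1) (hm.2.trans_lt hb)
  have hint : IntervalIntegrable (deriv f) volume a b := by
    refine (intervalIntegrable_const (c := M)).mono_fun
      (measurable_deriv f).aestronglyMeasurable ?_
    rw [EventuallyLE, ae_restrict_iff' measurableSet_uIoc]
    filter_upwards [hsub] with r hr hm
    exact (hr hm).trans (le_abs_self M)
  have h1 : ∫ r in a..b, deriv f r = f b - f a :=
    intervalIntegral.integral_eq_sub_of_hasDerivAt (fun x hx =>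
      (hf.differentiableAt (Ioi_mem_nhds (uIcc_subset_Ioi ha (ha.trans_le hab) hx))).hasDerivAt)
      hint
  rw [← h1, ← abs_of_nonneg (sub_nonneg.2 hab)]
  exact intervalIntegral.norm_integral_le_of_norm_le_const_ae (f := deriv f) (C := M) hsub

/-- Beyond some R the hypotheses at infinity control the derivative, and below R local boundedness
does. Hence φ₀ is Lipschitz, extends to 0, and Φ = φ₀ - φ₀(0+). -/
theorem exists_isDrift {φ₀ : ℝ → ℝ} (hφ₀ : DifferentiableOn ℝ φ₀ (Ioi 0)) {κ : ℝ} (hκ : 0 < κ)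
    (hlim : Tendsto (deriv φ₀) atTop (𝓝 κ))
    (hdecay : Asymptotics.IsBigO atTop (fun r : ℝ => deriv φ₀ r - κ) (fun r : ℝ => 1 / r))
    (hloc : ∀ R : ℝ, 0 < R → ∃ B : ℝ, ∀ᵐ r : ℝ, 0 < r → r < R → |deriv φ₀ r| ≤ B) :
    ∃ Φ M, IsDrift (deriv φ₀) Φ κ M := by
  obtain ⟨K, hK⟩ := hdecay.bound
  obtain ⟨R, hR1, hR⟩ : ∃ R : ℝ, 1 ≤ R ∧ ∀ r, R ≤ r → |deriv φ₀ r - κ| ≤ K / r ∧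
      κ / 2 ≤ deriv φ₀ r ∧ deriv φ₀ r ≤ 2 * κ := by
    have h1 := hlim.eventually (Icc_mem_nhds (show κ / 2 < κ by linarith)
      (show κ < 2 * κ by linarith))
    obtain ⟨R, hR⟩ := eventually_atTop.1 (hK.and h1)
    refine ⟨max R 1, le_max_right _ _, fun r hr => ?_⟩
    obtain ⟨a, b⟩ := hR r ((le_max_left _ _).trans hr)
    have hr0 : 0 < r := one_pos.trans_le ((le_max_right _ _).trans hr)
    refine ⟨?_, b⟩
    simpa [abs_of_pos hr0, div_eq_mul_inv] using a
  have hR0 : 0 < R := one_pos.trans_le hR1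
  obtain ⟨B, hB⟩ := hloc R hR0
  set M₀ : ℝ := max B (2 * κ) with hM₀
  have hM₀0 : 0 < M₀ := lt_max_of_lt_right (by linarith)
  have hall : ∀ᵐ r : ℝ, 0 < r → |deriv φ₀ r| ≤ M₀ := by
    filter_upwards [hB] with r hr h0
    rcases lt_or_ge r R with h | h
    · exact (hr h0 h).trans (le_max_left _ _)
    · obtain ⟨-, h1, h2⟩ := hR r h
      exact (abs_le.2 ⟨by linarith, h2⟩).trans (le_max_right _ _)
  have hlip : ∀ a b, 0 < a → a ≤ b → |φ₀ b - φ₀ a| ≤ M₀ * (b - a) := fun a b ha hab =>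
    abs_sub_le_of_ae_deriv_le hφ₀ hloc (R := b + 1) (hall.mono fun r hr h0 _ => hr h0) ha hab
      (by linarith)
  have hd : ∀ r, 0 < r → HasDerivAt φ₀ (deriv φ₀ r) r := fun r hr =>
    (hφ₀.differentiableAt (Ioi_mem_nhds hr)).hasDerivAt
  -- The Lipschitz estimate turns the almost-everywhere bound on the derivative into a bound at
  -- every point.
  have hV : ∀ r, 0 < r → |deriv φ₀ r| ≤ M₀ := by
    intro r hr
    refine (hd r hr).le_of_lip' hM₀0.le ?_
    filter_upwards [Ioi_mem_nhds hr] with x hx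
    rw [Real.norm_eq_abs, Real.norm_eq_abs]
    rcases le_total x r with h | h
    · rw [abs_sub_comm, abs_sub_comm x, abs_of_nonneg (sub_nonneg.2 h)]
      exact hlip _ _ hx h
    · rw [abs_of_nonneg (sub_nonneg.2 h)]
      exact hlip _ _ hr h
  -- The constant c is the value at 0 of a Lipschitz extension of φ₀ to the line.
  obtain ⟨c, hc⟩ : ∃ c, ∀ r, 0 < r → |φ₀ r - c| ≤ M₀ * r := by
    have hlw : LipschitzOnWith ⟨M₀, hM₀0.le⟩ φ₀ (Ioi 0) := by
      refine LipschitzOnWith.of_dist_le_mul fun x hx y hy => ?_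
      rw [Real.dist_eq, Real.dist_eq]
      rcases le_total x y with h | h
      · rw [abs_sub_comm, abs_sub_comm x, abs_of_nonneg (sub_nonneg.2 h)]
        exact hlip _ _ hx h
      · rw [abs_of_nonneg (sub_nonneg.2 h)]
        exact hlip _ _ hy h
    obtain ⟨g, hg, hge⟩ := hlw.extend_real
    refine ⟨g 0, fun r hr => ?_⟩
    have := hg.dist_le_mul r 0
    rw [← hge hr] at this
    simp only [Real.dist_eq, sub_zero, abs_of_pos hr] at this
    exact this
  have hfar : ∀ a b, R ≤ a → a ≤ b → κ / 2 * (b - a) ≤ φ₀ b - φ₀ a := by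
    intro a b ha hab
    refine (convex_Ici R).mul_sub_le_image_sub_of_le_deriv
      (hφ₀.continuousOn.mono fun x hx => hR0.trans_le hx)
      (hφ₀.mono fun x hx => hR0.trans_le (interior_subset hx)) (fun x hx =>
        (hR x (interior_subset hx)).2.1) a ha b (ha.trans hab) hab
  -- M₀ bounds V and the slope of Φ, K is the decay constant beyond R, and (M₀ + κ)R bounds both r|V
  -- - κ| for r < R and the loss of linear growth on (0, R).
  refine ⟨fun r => φ₀ r - c, max (max M₀ K) ((M₀ + κ) * R), measurable_deriv _,
    fun r hr => (hd r hr).sub_const c, fun r hr =>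
      (hV r hr).trans ((le_max_left _ _).trans (le_max_left _ _)), fun r hr => ?_,
    fun r hr => (hc r hr).trans ?_, fun r t hr hrt => ?_⟩
  · rcases lt_or_ge r R with h | h
    · rw [le_div_iff₀ hr]
      refine le_trans ?_ (le_max_right _ _)
      refine mul_le_mul ((abs_sub _ _).trans ?_) h.le hr.le (by positivity)
      rw [abs_of_pos hκ]
      linarith [hV r hr]
    · refine (hR r h).1.trans ?_
      gcongr
      exact (le_max_right _ _).trans (le_max_left _ _)
  · gcongr
    exact (le_max_left _ _).trans (le_max_left _ _)
  · have h1 : κ / 2 * (t - r) - (M₀ + κ) * R ≤ φ₀ t - φ₀ r := by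
      rcases le_total t R with h | h
      · have := (abs_le.1 (hlip r t hr hrt)).1
        nlinarith
      · rcases le_total r R with h' | h'
        · have := (abs_le.1 (hlip r R hr h')).1
          have := hfar R t le_rfl h
          nlinarith
        · have := hfar r t h' hrt
          nlinarith
    have := le_max_right (max M₀ K) ((M₀ + κ) * R)
    linarith

/-! ### Schur's test and the two model kernels. -/

theorem lintegral_mul_sq_le {α : Type*} [MeasurableSpace α] {μ : Measure α} {k f w : α → ℝ≥0∞}
    (hk : Measurable k) (hf : Measurable f) (hw : Measurable w) (w0 : ∀ᵐ x ∂μ, w x ≠ 0)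
    (wt : ∀ᵐ x ∂μ, w x ≠ ⊤) :
    (∫⁻ y, k y * f y ∂μ) ^ 2 ≤ (∫⁻ y, k y * w y ∂μ) * ∫⁻ y, k y * ((w y)⁻¹ * f y ^ 2) ∂μ := by
  -- Cauchy–Schwarz for the factorisation k f = (k w)^(1/2) (k w⁻¹ f²)^(1/2).
  have h := ENNReal.lintegral_mul_le_Lp_mul_Lq μ Real.HolderConjugate.two_two
    (f := fun y => (k y * w y) ^ (1 / 2 : ℝ)) (g := fun y => (k y * ((w y)⁻¹ * f y ^ 2)) ^ (1 / 2 : ℝ))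
    (by fun_prop) (by fun_prop)
  have e : ∀ x : ℝ≥0∞, (x ^ (1 / 2 : ℝ)) ^ (2 : ℝ) = x := fun x => by
    rw [← ENNReal.rpow_mul]; norm_num
  simp only [e] at h
  have e1 : ∫⁻ y, k y * f y ∂μ = ∫⁻ y, ((fun y => (k y * w y) ^ (1 / 2 : ℝ)) *
      fun y => (k y * ((w y)⁻¹ * f y ^ 2)) ^ (1 / 2 : ℝ)) y ∂μ := by
    refine lintegral_congr_ae ?_
    filter_upwards [w0, wt] with y h0 ht
    rw [Pi.mul_apply, ← ENNReal.mul_rpow_of_nonneg _ _ (by norm_num)]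
    have : k y * w y * (k y * ((w y)⁻¹ * f y ^ 2)) = (k y * f y) ^ (2 : ℝ) := by
      rw [ENNReal.rpow_two, show k y * w y * (k y * ((w y)⁻¹ * f y ^ 2)) =
        (w y * (w y)⁻¹) * (k y * f y) ^ 2 by ring, ENNReal.mul_inv_cancel h0 ht, one_mul]
    rw [this, ← ENNReal.rpow_mul]
    norm_num
  rw [← e1] at h
  calc _ ≤ ((∫⁻ y, k y * w y ∂μ) ^ (1 / 2 : ℝ)
        * (∫⁻ y, k y * ((w y)⁻¹ * f y ^ 2) ∂μ) ^ (1 / 2 : ℝ)) ^ 2 := by gcongr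
    _ = _ := by rw [mul_pow, ← ENNReal.rpow_two, ← ENNReal.rpow_two, e, e]

/-- The Schur test for the `L²` boundedness of a nonnegative kernel. -/
theorem lintegral_schur {α : Type*} [MeasurableSpace α] {μ : Measure α} [SFinite μ]
    {K : α → α → ℝ≥0∞} (hK : Measurable (Function.uncurry K)) {f w : α → ℝ≥0∞}
    (hf : Measurable f) (hw : Measurable w) (w0 : ∀ᵐ x ∂μ, w x ≠ 0) (wt : ∀ᵐ x ∂μ, w x ≠ ⊤)
    {C : ℝ≥0∞} (h1 : ∀ᵐ x ∂μ, ∫⁻ y, K x y * w y ∂μ ≤ C * w x)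
    (h2 : ∀ᵐ y ∂μ, ∫⁻ x, K x y * w x ∂μ ≤ C * w y) :
    ∫⁻ x, (∫⁻ y, K x y * f y ∂μ) ^ 2 ∂μ ≤ C ^ 2 * ∫⁻ y, f y ^ 2 ∂μ := by
  have hm : Measurable (Function.uncurry fun x y => C * w x * (K x y * ((w y)⁻¹ * f y ^ 2))) := by
    have : Measurable fun z : α × α => C * w z.1 * (Function.uncurry K z * ((w z.2)⁻¹ * f z.2 ^ 2)) := by
      fun_prop
    exact this
  calc _ ≤ ∫⁻ x, ∫⁻ y, C * w x * (K x y * ((w y)⁻¹ * f y ^ 2)) ∂μ ∂μ := by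
        refine lintegral_mono_ae ?_
        filter_upwards [h1] with x hx
        have hKx : Measurable (K x) := hK.of_uncurry_left
        rw [lintegral_const_mul _ (by fun_prop)]
        refine (lintegral_mul_sq_le hKx hf hw w0 wt).trans ?_
        gcongr
    _ = ∫⁻ y, ∫⁻ x, C * w x * (K x y * ((w y)⁻¹ * f y ^ 2)) ∂μ ∂μ :=
        lintegral_lintegral_swap hm.aemeasurable
    _ ≤ ∫⁻ y, C ^ 2 * f y ^ 2 ∂μ := by
        refine lintegral_mono_ae ?_
        filter_upwards [h2, w0, wt] with y hy h0 ht
        have hKy : Measurable fun x => K x y := hK.of_uncurry_right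
        calc _ = ∫⁻ x, (K x y * w x) * (C * ((w y)⁻¹ * f y ^ 2)) ∂μ := by
              refine lintegral_congr fun x => ?_
              ring
          _ = (∫⁻ x, K x y * w x ∂μ) * (C * ((w y)⁻¹ * f y ^ 2)) :=
              lintegral_mul_const _ (by fun_prop)
          _ ≤ C * w y * (C * ((w y)⁻¹ * f y ^ 2)) := by gcongr
          _ = (w y * (w y)⁻¹) * (C ^ 2 * f y ^ 2) := by ring
          _ = _ := by rw [ENNReal.mul_inv_cancel h0 ht, one_mul]
    _ = _ := lintegral_const_mul _ (by fun_prop)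

theorem memLp_of_schur {μ : Measure ℝ} [SFinite μ] {K : ℝ → ℝ → ℝ≥0∞}
    (hK : Measurable (Function.uncurry K)) {w : ℝ → ℝ≥0∞} (hw : Measurable w)
    (w0 : ∀ᵐ x ∂μ, w x ≠ 0) (wt : ∀ᵐ x ∂μ, w x ≠ ⊤) {C D : ℝ}
    (h1 : ∀ᵐ x ∂μ, ∫⁻ y, K x y * w y ∂μ ≤ ENNReal.ofReal C * w x)
    (h2 : ∀ᵐ y ∂μ, ∫⁻ x, K x y * w x ∂μ ≤ ENNReal.ofReal C * w y)
    {f F : ℝ → ℝ} (hfm : Measurable f) (hf : MemLp f 2 μ) (hFm : AEStronglyMeasurable F μ)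
    (hF : ∀ᵐ x ∂μ, ‖F x‖ₑ ≤ ENNReal.ofReal D * ∫⁻ y, K x y * ‖f y‖ₑ ∂μ) : MemLp F 2 μ := by
  rw [memLp_two_iff_lintegral hFm]
  have h3 := lintegral_schur (μ := μ) hK hfm.enorm hw w0 wt h1 h2
  have h4 := (memLp_two_iff_lintegral hf.1).1 hf
  calc _ ≤ ∫⁻ x, ENNReal.ofReal D ^ 2 * (∫⁻ y, K x y * ‖f y‖ₑ ∂μ) ^ 2 ∂μ := by
        refine lintegral_mono_ae ?_
        filter_upwards [hF] with x hx
        rw [← mul_pow]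
        gcongr
    _ = ENNReal.ofReal D ^ 2 * ∫⁻ x, (∫⁻ y, K x y * ‖f y‖ₑ ∂μ) ^ 2 ∂μ :=
        lintegral_const_mul' _ _ (by finiteness)
    _ ≤ ENNReal.ofReal D ^ 2 * (ENNReal.ofReal C ^ 2 * ∫⁻ y, ‖f y‖ₑ ^ 2 ∂μ) := by gcongr
    _ < ⊤ := ENNReal.mul_lt_top (by finiteness) (ENNReal.mul_lt_top (by finiteness) h4)

theorem lintegral_Ioc_rpow {a r : ℝ} (ha : a < 1) (hr : 0 < r) :
    ∫⁻ y in Ioc 0 r, ENNReal.ofReal (y ^ (-a)) = ENNReal.ofReal (r ^ (1 - a) / (1 - a)) := by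
  have hi : IntervalIntegrable (fun y : ℝ => y ^ (-a)) volume 0 r :=
    intervalIntegral.intervalIntegrable_rpow' (by linarith)
  rw [intervalIntegrable_iff_integrableOn_Ioc_of_le hr.le] at hi
  rw [← ofReal_integral_eq_lintegral_ofReal hi, ← intervalIntegral.integral_of_le hr.le,
    integral_rpow (Or.inl (by linarith)), Real.zero_rpow (by linarith), sub_zero]
  · rw [show -a + 1 = 1 - a by ring]
  · rw [EventuallyLE, ae_restrict_iff' measurableSet_Ioc]
    exact Eventually.of_forall fun y hy => Real.rpow_nonneg hy.1.le _

theorem lintegral_Ioi_rpow {a y : ℝ} (ha : a < 1) (hy : 0 < y) :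
    ∫⁻ r in Ioi y, ENNReal.ofReal (r ^ (a - 2)) = ENNReal.ofReal (y ^ (a - 1) / (1 - a)) := by
  rw [← ofReal_integral_eq_lintegral_ofReal (integrableOn_Ioi_rpow_of_lt (by linarith) hy),
    integral_Ioi_rpow_of_lt (by linarith) hy]
  · congr 1
    rw [show a - 2 + 1 = a - 1 by ring, ← neg_sub 1 a, neg_div_neg_eq]
  · rw [EventuallyLE, ae_restrict_iff' measurableSet_Ioi]
    exact Eventually.of_forall fun r hr => Real.rpow_nonneg (hy.trans hr).le _

theorem lintegral_Ioi_exp {k r : ℝ} (hk : 0 < k) :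
    ∫⁻ t in Ioi r, ENNReal.ofReal (Real.exp (-k * (t - r))) = ENNReal.ofReal (1 / k) := by
  have e : ∀ t, Real.exp (-k * (t - r)) = Real.exp (k * r) * Real.exp (-k * t) := fun t => by
    rw [← Real.exp_add]; ring_nf
  simp only [e]
  have hi := (integrableOn_exp_mul_Ioi (neg_neg_of_pos hk) r).const_mul (Real.exp (k * r))
  rw [← ofReal_integral_eq_lintegral_ofReal hi (Eventually.of_forall fun _ => by positivity),
    integral_const_mul, integral_exp_mul_Ioi (neg_neg_of_pos hk)]
  rw [neg_div_neg_eq, ← mul_div_assoc, ← Real.exp_add]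
  simp

theorem lintegral_Iic_exp {k t : ℝ} (hk : 0 < k) :
    ∫⁻ r in Iic t, ENNReal.ofReal (Real.exp (-k * (t - r))) = ENNReal.ofReal (1 / k) := by
  have e : ∀ r, Real.exp (-k * (t - r)) = Real.exp (-k * t) * Real.exp (k * r) := fun r => by
    rw [← Real.exp_add]; ring_nf
  simp only [e]
  have hi := (integrableOn_exp_mul_Iic hk t).const_mul (Real.exp (-k * t))
  rw [← ofReal_integral_eq_lintegral_ofReal hi (Eventually.of_forall fun _ => by positivity),
    integral_const_mul, integral_exp_mul_Iic hk]
  rw [← mul_div_assoc, ← Real.exp_add]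
  simp

/-- A weighted Hardy inequality on `(0, 1)`. -/
theorem memLp_hardy {a D : ℝ} (ha : a < 1) {f F : ℝ → ℝ} (hfm : Measurable f)
    (hf : MemLp f 2 (volume.restrict (Ioc 0 1)))
    (hFm : AEStronglyMeasurable F (volume.restrict (Ioc 0 1)))
    (hF : ∀ r ∈ Ioc (0 : ℝ) 1, ‖F r‖ₑ ≤ ENNReal.ofReal D * ∫⁻ t in Ioc 0 r,
      ENNReal.ofReal (r ^ (a - 3 / 2) * t ^ (1 / 2 - a)) * ‖f t‖ₑ) :
    MemLp F 2 (volume.restrict (Ioc 0 1)) := by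
  set K : ℝ → ℝ → ℝ≥0∞ := fun r t => if 0 < t ∧ t ≤ r then
    ENNReal.ofReal (r ^ (a - 3 / 2) * t ^ (1 / 2 - a)) else 0 with hKdef
  have hK : Measurable (Function.uncurry K) := by
    refine Measurable.ite ?_ (by fun_prop) measurable_const
    exact (measurableSet_lt measurable_const measurable_snd).inter
      (measurableSet_le measurable_snd measurable_fst)
  have hpos : ∀ᵐ x ∂volume.restrict (Ioc (0 : ℝ) 1), x ∈ Ioc (0 : ℝ) 1 :=
    ae_restrict_mem measurableSet_Ioc
  -- The Schur weight t^(-1/2) reproduces itself: r^(a-3/2) ∫_0^r t^(-a) dt = r^(-1/2)/(1-a) and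
  -- t^(1/2-a) ∫_t^∞ r^(a-2) dr = t^(-1/2)/(1-a). Both integrals converge because a < 1.
  refine memLp_of_schur (C := 1 / (1 - a)) (D := D) hK
    (w := fun t => ENNReal.ofReal (t ^ (-(1 / 2) : ℝ)))
    (by fun_prop) ?_ ?_ ?_ ?_ hfm hf hFm ?_
  · filter_upwards [hpos] with x hx
    simpa using Real.rpow_pos_of_pos hx.1 _
  · exact Eventually.of_forall fun x => ENNReal.ofReal_ne_top
  · filter_upwards [hpos] with r hr
    have hr0 := hr.1
    calc _ ≤ ∫⁻ t, K r t * ENNReal.ofReal (t ^ (-(1 / 2) : ℝ)) :=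
          lintegral_mono' Measure.restrict_le_self le_rfl
      _ = ∫⁻ t, (Ioc 0 r).indicator
          (fun t => ENNReal.ofReal (r ^ (a - 3 / 2)) * ENNReal.ofReal (t ^ (-a))) t := by
          refine lintegral_congr fun t => ?_
          simp only [hKdef, indicator_apply, mem_Ioc]
          split_ifs with h
          · have ht0 := h.1
            rw [← ENNReal.ofReal_mul (by positivity), ← ENNReal.ofReal_mul
              (Real.rpow_nonneg hr0.le _), mul_assoc, ← Real.rpow_add h.1]
            ring_nf
          · simp
      _ = ENNReal.ofReal (r ^ (a - 3 / 2)) * ENNReal.ofReal (r ^ (1 - a) / (1 - a)) := by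
          rw [lintegral_indicator measurableSet_Ioc, lintegral_const_mul _ (by fun_prop),
            lintegral_Ioc_rpow ha hr0]
      _ ≤ _ := by
          rw [← ENNReal.ofReal_mul (by positivity), ← ENNReal.ofReal_mul
            (by have : 0 < 1 - a := by linarith
                positivity)]
          apply le_of_eq
          congr 1
          rw [← mul_div_assoc, ← Real.rpow_add hr0]
          ring_nf
  · filter_upwards [hpos] with t ht
    have ht0 := ht.1
    calc _ ≤ ∫⁻ r, K r t * ENNReal.ofReal (r ^ (-(1 / 2) : ℝ)) :=
          lintegral_mono' Measure.restrict_le_self le_rfl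
      _ = ∫⁻ r, (Ici t).indicator
          (fun r => ENNReal.ofReal (t ^ (1 / 2 - a)) * ENNReal.ofReal (r ^ (a - 2))) r := by
          refine lintegral_congr fun r => ?_
          simp only [hKdef, indicator_apply, mem_Ici, ht0, true_and]
          split_ifs with h
          · have hr0 := ht0.trans_le h
            rw [← ENNReal.ofReal_mul (by positivity), ← ENNReal.ofReal_mul (by positivity),
              mul_comm (r ^ (a - 3 / 2)), mul_assoc, ← Real.rpow_add hr0]
            ring_nf
          · simp
      _ = ENNReal.ofReal (t ^ (1 / 2 - a)) * ENNReal.ofReal (t ^ (a - 1) / (1 - a)) := by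
          rw [lintegral_indicator measurableSet_Ici, lintegral_const_mul _ (by fun_prop),
            setLIntegral_congr Ioi_ae_eq_Ici.symm, lintegral_Ioi_rpow ha ht0]
      _ ≤ _ := by
          rw [← ENNReal.ofReal_mul (by positivity), ← ENNReal.ofReal_mul
            (by have : 0 < 1 - a := by linarith
                positivity)]
          apply le_of_eq
          congr 1
          rw [← mul_div_assoc, ← Real.rpow_add ht0]
          ring_nf
  · filter_upwards [hpos] with r hr
    refine (hF r hr).trans (le_of_eq ?_)
    congr 1
    rw [show Ioc 0 r = Ioc 0 r ∩ Ioc 0 1 from (inter_eq_left.2 (Ioc_subset_Ioc_right hr.2)).symm,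
      ← setLIntegral_indicator measurableSet_Ioc]
    refine lintegral_congr fun t => ?_
    simp only [hKdef, indicator_apply, mem_Ioc]
    split_ifs <;> simp

/-- Convolution with a one-sided exponential is bounded on `L²`. -/
theorem memLp_exp_kernel {k D : ℝ} (hk : 0 < k) {f F : ℝ → ℝ} (hfm : Measurable f)
    (hf : MemLp f 2 (volume.restrict (Ioi 1)))
    (hFm : AEStronglyMeasurable F (volume.restrict (Ioi 1)))
    (hF : ∀ r, 1 < r → ‖F r‖ₑ ≤ ENNReal.ofReal D * ∫⁻ t in Ioi r,
      ENNReal.ofReal (Real.exp (-k * (t - r))) * ‖f t‖ₑ) :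
    MemLp F 2 (volume.restrict (Ioi 1)) := by
  set K : ℝ → ℝ → ℝ≥0∞ := fun r t => if r < t then
    ENNReal.ofReal (Real.exp (-k * (t - r))) else 0 with hKdef
  have hK : Measurable (Function.uncurry K) := by
    refine Measurable.ite (measurableSet_lt measurable_fst measurable_snd) ?_ measurable_const
    fun_prop
  -- The constant weight suffices, since both marginals of the exponential kernel are at most 1/k.
  refine memLp_of_schur (C := 1 / k) (D := D) hK (w := fun _ => 1) measurable_const
    (by simp) (by simp) ?_ ?_ hfm hf hFm ?_
  · refine Eventually.of_forall fun r => ?_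
    simp only [mul_one]
    rw [← lintegral_Ioi_exp (r := r) hk, ← lintegral_indicator (s := Ioi r) measurableSet_Ioi]
    exact lintegral_mono' Measure.restrict_le_self fun t => by
      simp only [hKdef, indicator_apply, mem_Ioi]; exact le_rfl
  · refine Eventually.of_forall fun t => ?_
    simp only [mul_one]
    rw [← lintegral_Iic_exp (t := t) hk, ← lintegral_indicator measurableSet_Iic]
    exact lintegral_mono' Measure.restrict_le_self fun r => by
      simp only [hKdef, indicator_apply, mem_Iic]
      split_ifs with h1 h2
      · exact le_rfl
      · exact absurd h1.le h2
      · exact zero_le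
      · exact le_rfl
  · filter_upwards [ae_restrict_mem measurableSet_Ioi] with r hr
    have hr : 1 < r := hr
    refine (hF r hr).trans (le_of_eq ?_)
    congr 1
    rw [show Ioi r = Ioi r ∩ Ioi 1 from (inter_eq_left.2 (Ioi_subset_Ioi hr.le)).symm,
      ← setLIntegral_indicator measurableSet_Ioi]
    refine lintegral_congr fun t => ?_
    simp only [hKdef, indicator_apply, mem_Ioi]
    split_ifs <;> simp

theorem memLp_rpow_Ioc_iff {s : ℝ} :
    MemLp (fun r : ℝ => r ^ s) 2 (volume.restrict (Ioc 0 1)) ↔ -1 < 2 * s := by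
  have hm : AEStronglyMeasurable (fun r : ℝ => r ^ s) (volume.restrict (Ioc 0 1)) := by fun_prop
  rw [memLp_two_iff_integrable_sq hm, ← intervalIntegral.integrableOn_Ioo_rpow_iff one_pos,
    ← integrableOn_Ioc_iff_integrableOn_Ioo]
  refine integrableOn_congr_fun (fun r hr => ?_) measurableSet_Ioc
  have := hr.1
  rw [← Real.rpow_natCast, ← Real.rpow_mul hr.1.le, mul_comm]
  norm_num

theorem memLp_rpow_Ioi_iff {s : ℝ} :
    MemLp (fun r : ℝ => r ^ s) 2 (volume.restrict (Ioi 1)) ↔ 2 * s < -1 := by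
  have hm : AEStronglyMeasurable (fun r : ℝ => r ^ s) (volume.restrict (Ioi 1)) := by fun_prop
  rw [memLp_two_iff_integrable_sq hm, ← integrableOn_Ioi_rpow_iff one_pos]
  refine integrableOn_congr_fun (fun r hr => ?_) measurableSet_Ioi
  have : (0 : ℝ) < r := one_pos.trans hr
  rw [← Real.rpow_natCast, ← Real.rpow_mul this.le, mul_comm]
  norm_num

theorem memLp_of_abs_le {S : Set ℝ} (hS : MeasurableSet S) {f g : ℝ → ℝ} {C : ℝ}
    (hg : MemLp g 2 (volume.restrict S)) (hf : AEStronglyMeasurable f (volume.restrict S))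
    (h : ∀ r ∈ S, |f r| ≤ C * |g r|) : MemLp f 2 (volume.restrict S) :=
  hg.of_le_mul hf ((ae_restrict_iff' hS).2 (Eventually.of_forall h))

/-- The integrating factor `r exp (2 β Φ)` of the operator `∂_r + 1/r + 2 β V`. -/
def integratingFactor (β : ℝ) (Φ : ℝ → ℝ) (r : ℝ) : ℝ := r * Real.exp (2 * β * Φ r)

/-! ### Bounds on the integrating factor. -/

namespace IsDrift

variable {V Φ : ℝ → ℝ} {κ M β : ℝ}

theorem factor_pos {r : ℝ} (hr : 0 < r) : 0 < integratingFactor β Φ r := mul_pos hr (Real.exp_pos _)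

theorem bound_nonneg (D : IsDrift V Φ κ M) : 0 ≤ M := (abs_nonneg _).trans (D.abs_le 1 one_pos)

theorem hasDerivAt_factor (D : IsDrift V Φ κ M) {r : ℝ} (hr : 0 < r) :
    HasDerivAt (integratingFactor β Φ) ((1 / r + 2 * β * V r) * integratingFactor β Φ r) r := by
  have h := (hasDerivAt_id r).mul (((D.hasDerivAt r hr).const_mul (2 * β)).exp)
  refine h.congr_deriv ?_
  simp only [integratingFactor, id]
  field_simp

theorem hasDerivAt_inv_factor (D : IsDrift V Φ κ M) {r : ℝ} (hr : 0 < r) :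
    HasDerivAt (fun r => (integratingFactor β Φ r)⁻¹) (-(1 / r + 2 * β * V r) * (integratingFactor β Φ r)⁻¹) r := by
  refine ((D.hasDerivAt_factor hr).inv (factor_pos hr).ne').congr_deriv ?_
  have := (factor_pos (β := β) (Φ := Φ) hr).ne'
  field_simp

theorem continuousOn_factor (D : IsDrift V Φ κ M) : ContinuousOn (integratingFactor β Φ) (Ioi 0) :=
  fun _ hr => (D.hasDerivAt_factor hr).continuousAt.continuousWithinAt

theorem intervalIntegrable_coeff (D : IsDrift V Φ κ M) {a b : ℝ} (ha : 0 < a) (hb : 0 < b) :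
    IntervalIntegrable (fun r => 1 / r + 2 * β * V r) volume a b := by
  refine IntervalIntegrable.add ?_ (IntervalIntegrable.const_mul ?_ _)
  · exact (ContinuousOn.div continuousOn_const continuousOn_id
      fun r hr => (uIcc_subset_Ioi ha hb hr : (0 : ℝ) < r).ne').intervalIntegrable
  · refine (intervalIntegrable_const (c := M)).mono_fun D.measurable.aestronglyMeasurable ?_
    rw [EventuallyLE, ae_restrict_iff' measurableSet_uIoc]
    exact Eventually.of_forall fun r hr =>
      (D.abs_le r (uIoc_subset_Ioi ha hb hr)).trans (le_abs_self M)

theorem hasRadialDeriv_factor (D : IsDrift V Φ κ M) :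
    HasRadialDeriv (integratingFactor β Φ) (fun r => (1 / r + 2 * β * V r) * integratingFactor β Φ r) :=
  .of_hasDerivAt (fun _ hr => D.hasDerivAt_factor hr) fun _ _ ha hb =>
    (D.intervalIntegrable_coeff ha hb).mul_continuousOn
      (D.continuousOn_factor.mono (uIcc_subset_Ioi ha hb))

theorem continuousOn_inv_factor (D : IsDrift V Φ κ M) : ContinuousOn (fun r => (integratingFactor β Φ r)⁻¹) (Ioi 0) :=
  D.continuousOn_factor.inv₀ fun _ hr => (factor_pos hr).ne'

theorem hasRadialDeriv_inv_factor (D : IsDrift V Φ κ M) :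
    HasRadialDeriv (fun r => (integratingFactor β Φ r)⁻¹) (fun r => -(1 / r + 2 * β * V r) * (integratingFactor β Φ r)⁻¹) :=
  .of_hasDerivAt (fun _ hr => D.hasDerivAt_inv_factor hr) fun _ _ ha hb =>
    (D.intervalIntegrable_coeff ha hb).neg.mul_continuousOn
      (D.continuousOn_inv_factor.mono (uIcc_subset_Ioi ha hb))

/-- As β < 0, the linear lower bound on Φ(t) - Φ(r) becomes exponential decay at rate -βκ. -/
theorem factor_div_le (D : IsDrift V Φ κ M) (hβ : β < 0) {r t : ℝ} (hr : 0 < r) (hrt : r ≤ t) :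
    integratingFactor β Φ t / integratingFactor β Φ r ≤ Real.exp (-2 * β * M) * (t / r) * Real.exp (-(-β * κ) * (t - r)) := by
  have ht := hr.trans_le hrt
  have e : integratingFactor β Φ t / integratingFactor β Φ r = (t / r) * Real.exp (2 * β * (Φ t - Φ r)) := by
    rw [integratingFactor, integratingFactor, mul_sub, Real.exp_sub]
    field_simp
  rw [e, mul_comm (Real.exp (-2 * β * M)) (t / r), mul_assoc (t / r), ← Real.exp_add]
  have := D.le_sub r t hr hrt
  gcongr
  nlinarith

/-- On (0, 1] one has |Φ| ≤ M, so the exponential part of the quotient lies between constants, in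
whichever order r and t come. -/
theorem factor_le_near (D : IsDrift V Φ κ M) (β : ℝ) {r t : ℝ} (hr : 0 < r) (hr1 : r ≤ 1)
    (ht : 0 < t) (ht1 : t ≤ 1) : integratingFactor β Φ t / integratingFactor β Φ r ≤
      Real.exp (4 * |β| * M) * (t / r) := by
  have hM := D.bound_nonneg
  have e : integratingFactor β Φ t / integratingFactor β Φ r =
      Real.exp (2 * β * (Φ t - Φ r)) * (t / r) := by
    rw [integratingFactor, integratingFactor, mul_sub, Real.exp_sub]
    field_simp
  have h : ∀ x, 0 < x → x ≤ 1 → |Φ x| ≤ M := fun x hx hx1 =>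
    (D.abs_primitive_le x hx).trans (mul_le_of_le_one_right hM hx1)
  rw [e]
  refine mul_le_mul_of_nonneg_right (Real.exp_le_exp.2 ?_) (by positivity)
  calc _ ≤ |2 * β * (Φ t - Φ r)| := le_abs_self _
    _ = 2 * |β| * |Φ t - Φ r| := by rw [abs_mul, abs_mul, abs_two]
    _ ≤ 2 * |β| * (M + M) := by
        gcongr
        exact (abs_sub _ _).trans (add_le_add (h t ht ht1) (h r hr hr1))
    _ = _ := by ring

/-- Half of the exponential rate pays for the polynomial factor: 1 + s ≤ (1 + 4/k) exp(ks/4), and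
this is squared. -/
theorem sq_mul_exp_le {k s : ℝ} (hk : 0 < k) (hs : 0 ≤ s) :
    (1 + s) ^ 2 * Real.exp (-k * s) ≤ (1 + 4 / k) ^ 2 * Real.exp (-(k / 2) * s) := by
  have h1 : 1 + s ≤ (1 + 4 / k) * Real.exp (k / 4 * s) := by
    have h2 := Real.add_one_le_exp (k / 4 * s)
    have h3 : s = 4 / k * (k / 4 * s) := by field_simp
    have h4 : (1 : ℝ) ≤ Real.exp (k / 4 * s) := Real.one_le_exp (by positivity)
    have h5 : 4 / k * (k / 4 * s) ≤ 4 / k * Real.exp (k / 4 * s) := by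
      gcongr; linarith
    linarith
  calc _ ≤ ((1 + 4 / k) * Real.exp (k / 4 * s)) ^ 2 * Real.exp (-k * s) := by gcongr
    _ = (1 + 4 / k) ^ 2 * (Real.exp (k / 4 * s) * Real.exp (k / 4 * s) * Real.exp (-k * s)) := by
        ring
    _ = _ := by
        rw [← Real.exp_add, ← Real.exp_add]
        ring_nf

/-- Moving the weight from r to t costs at most one more factor t/r, as -(γ + 1/2) ≤ 1. For r ≥ 1
one has t/r ≤ 1 + (t - r), and the square of this is absorbed by half of the exponential decay. -/
theorem factor_le_far (D : IsDrift V Φ κ M) (hκ : 0 < κ) (hβ : β < 0) {γ : ℝ} (hγ : -1 < γ)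
    {r t : ℝ} (hr : 1 ≤ r) (hrt : r ≤ t) :
    r ^ (γ + 1 / 2) * (integratingFactor β Φ t / integratingFactor β Φ r) ≤ Real.exp (-2 * β * M) * (1 + 4 / (-β * κ)) ^ 2 *
      Real.exp (-(-β * κ / 2) * (t - r)) * t ^ (γ + 1 / 2) := by
  have hr0 : 0 < r := one_pos.trans_le hr
  have ht0 := hr0.trans_le hrt
  have hk : 0 < -β * κ := mul_pos (neg_pos.2 hβ) hκ
  have h1 : r ^ (γ + 1 / 2) * (t / r) ≤ (t / r) ^ 2 * t ^ (γ + 1 / 2) := by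
    have h2 : r ^ (γ + 1 / 2) = (t / r) ^ (-(γ + 1 / 2)) * t ^ (γ + 1 / 2) := by
      rw [Real.rpow_neg (by positivity), Real.div_rpow ht0.le hr0.le]
      have := (Real.rpow_pos_of_pos ht0 (γ + 1 / 2)).ne'
      have := (Real.rpow_pos_of_pos hr0 (γ + 1 / 2)).ne'
      field_simp
    have h3 : 1 ≤ t / r := (one_le_div hr0).2 hrt
    have h4 : (t / r) ^ (-(γ + 1 / 2)) ≤ t / r := by
      conv_rhs => rw [← Real.rpow_one (t / r)]
      exact Real.rpow_le_rpow_of_exponent_le h3 (by linarith)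
    rw [h2, sq]
    have := Real.rpow_pos_of_pos ht0 (γ + 1 / 2)
    calc _ = (t / r) ^ (-(γ + 1 / 2)) * (t / r) * t ^ (γ + 1 / 2) := by ring
      _ ≤ _ := by gcongr
  have h5 : t / r ≤ 1 + (t - r) := by
    rw [div_le_iff₀ hr0]
    nlinarith
  calc _ ≤ r ^ (γ + 1 / 2) * (Real.exp (-2 * β * M) * (t / r) *
        Real.exp (-(-β * κ) * (t - r))) := by
        gcongr
        exact D.factor_div_le hβ hr0 hrt
    _ = Real.exp (-2 * β * M) * (r ^ (γ + 1 / 2) * (t / r)) *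
        Real.exp (-(-β * κ) * (t - r)) := by ring
    _ ≤ Real.exp (-2 * β * M) * ((t / r) ^ 2 * t ^ (γ + 1 / 2)) *
        Real.exp (-(-β * κ) * (t - r)) := by gcongr
    _ ≤ Real.exp (-2 * β * M) * ((1 + (t - r)) ^ 2 * t ^ (γ + 1 / 2)) *
        Real.exp (-(-β * κ) * (t - r)) := by gcongr
    _ = Real.exp (-2 * β * M) * t ^ (γ + 1 / 2) * ((1 + (t - r)) ^ 2 *
        Real.exp (-(-β * κ) * (t - r))) := by ring
    _ ≤ Real.exp (-2 * β * M) * t ^ (γ + 1 / 2) * ((1 + 4 / (-β * κ)) ^ 2 *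
        Real.exp (-(-β * κ / 2) * (t - r))) := by
        exact mul_le_mul_of_nonneg_left (sq_mul_exp_le hk (sub_nonneg.2 hrt)) (by positivity)
    _ = _ := by ring

/-- Since |Φ(r)| ≤ Mr, the inequality |e^x - 1| ≤ |x|e^|x| with x = -2βΦ gains a factor r, which
cancels the pole. Thus 1/p and 1/r have the same singular part at the origin. -/
theorem abs_inv_factor_sub_le (D : IsDrift V Φ κ M) {r : ℝ} (hr : 0 < r) (hr1 : r ≤ 1) :
    |(integratingFactor β Φ r)⁻¹ - r⁻¹| ≤ 2 * |β| * M * Real.exp (2 * |β| * M) := by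
  have hM := D.bound_nonneg
  have e : (integratingFactor β Φ r)⁻¹ - r⁻¹ = r⁻¹ * (Real.exp (-(2 * β * Φ r)) - 1) := by
    rw [integratingFactor, mul_inv, Real.exp_neg]; ring
  have h1 : |-(2 * β * Φ r)| ≤ 2 * |β| * M * r := by
    rw [abs_neg, abs_mul, abs_mul, abs_two]
    have := D.abs_primitive_le r hr
    nlinarith [abs_nonneg β]
  have h2 : |Real.exp (-(2 * β * Φ r)) - 1| ≤
      |-(2 * β * Φ r)| * Real.exp |-(2 * β * Φ r)| := by
    set x := -(2 * β * Φ r)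
    have ha := Real.add_one_le_exp x
    have hb := Real.add_one_le_exp (-x)
    have hc : Real.exp x - 1 ≤ x * Real.exp x := by
      have : Real.exp (-x) * Real.exp x = 1 := by rw [← Real.exp_add]; simp
      nlinarith [Real.exp_pos x]
    have hd : (1 : ℝ) ≤ Real.exp |x| := Real.one_le_exp (abs_nonneg x)
    rw [_root_.abs_le]
    constructor
    · nlinarith [neg_abs_le x, abs_nonneg x]
    · refine hc.trans (mul_le_mul (le_abs_self x) (Real.exp_le_exp.2 (le_abs_self x))
        (Real.exp_pos _).le (abs_nonneg x))
  rw [e, abs_mul, abs_of_pos (inv_pos.2 hr)]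
  calc _ ≤ r⁻¹ * ((2 * |β| * M * r) * Real.exp (2 * |β| * M)) := by
        gcongr
        refine h2.trans (mul_le_mul h1 (Real.exp_le_exp.2 (h1.trans ?_)) (Real.exp_pos _).le
          (by positivity))
        exact mul_le_of_le_one_right (by positivity) hr1
    _ = _ := by field_simp

end IsDrift

/-! ### Solvability and uniqueness for the radial equation in weighted L². -/

namespace IsDrift

variable {V Φ n : ℝ → ℝ} {κ M β γ a : ℝ}

/-- Near 0 the integrating factor is at most a constant times t = t^(1/2-a) t^(a+1/2), and t^(1/2-a)
is square integrable for a < 1; Cauchy–Schwarz concludes. -/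
theorem integrableOn_Ioc_factor_mul (D : IsDrift V Φ κ M) (β : ℝ) (ha : a < 1)
    (hn : Measurable n) (h1 : MemLp (fun r => r ^ (a + 1 / 2) * n r) 2 (volume.restrict (Ioc 0 1))) :
    IntegrableOn (fun t => integratingFactor β Φ t * n t) (Ioc 0 1) := by
  have h2 : MemLp (fun r : ℝ => r ^ (1 / 2 - a)) 2 (volume.restrict (Ioc 0 1)) :=
    memLp_rpow_Ioc_iff.2 (by linarith)
  have hC : 0 < integratingFactor β Φ 1 := factor_pos one_pos
  have h3 := (h2.integrable_mul h1).norm.const_mul (Real.exp (2 * |β| * M))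
  refine h3.mono' ?_ ?_
  · exact ((D.continuousOn_factor.mono fun r hr => hr.1).aestronglyMeasurable
      measurableSet_Ioc).mul hn.aestronglyMeasurable
  · filter_upwards [ae_restrict_mem measurableSet_Ioc] with t ht
    have ht0 := ht.1
    have e : t = t ^ (1 / 2 - a) * t ^ (a + 1 / 2) := by
      rw [← Real.rpow_add ht0, show 1 / 2 - a + (a + 1 / 2) = 1 by ring, Real.rpow_one]
    have hle : integratingFactor β Φ t ≤ Real.exp (2 * |β| * M) * t := by
      rw [integratingFactor, mul_comm]
      have h4 := D.abs_primitive_le t ht0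
      have h5 : M * t ≤ M := mul_le_of_le_one_right D.bound_nonneg ht.2
      have h6 : 2 * β * Φ t ≤ 2 * |β| * M := by
        calc _ ≤ |2 * β * Φ t| := le_abs_self _
          _ = 2 * |β| * |Φ t| := by rw [abs_mul, abs_mul, abs_two]
          _ ≤ _ := by gcongr; exact h4.trans h5
      gcongr
    simp only [Pi.mul_apply, norm_mul, Real.norm_eq_abs]
    rw [abs_of_pos (factor_pos ht0)]
    calc _ ≤ Real.exp (2 * |β| * M) * t * |n t| := by gcongr
      _ = Real.exp (2 * |β| * M) * (t ^ (1 / 2 - a) * t ^ (a + 1 / 2)) * |n t| := by rw [← e]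
      _ = Real.exp (2 * |β| * M) * (|t ^ (1 / 2 - a)| * (|t ^ (a + 1 / 2)| * |n t|)) := by
          rw [abs_of_nonneg (Real.rpow_nonneg ht0.le _), abs_of_nonneg (Real.rpow_nonneg ht0.le _)]
          ring

/-- `factor_le_far` from the base point 1 bounds the integrating factor by the weight times a
square-integrable exponential. -/
theorem integrableOn_Ioi_factor_mul (D : IsDrift V Φ κ M) (hκ : 0 < κ) (hβ : β < 0)
    (hγ : -1 < γ) (hn : Measurable n)
    (h1 : MemLp (fun r => r ^ (γ + 1 / 2) * n r) 2 (volume.restrict (Ioi 1))) :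
    IntegrableOn (fun t => integratingFactor β Φ t * n t) (Ioi 1) := by
  have hk : 0 < -β * κ := mul_pos (neg_pos.2 hβ) hκ
  have h2 : MemLp (fun t : ℝ => Real.exp (-(-β * κ / 2) * t)) 2 (volume.restrict (Ioi 1)) := by
    rw [memLp_two_iff_integrable_sq (by fun_prop)]
    have e : ∀ t, Real.exp (-(-β * κ / 2) * t) ^ 2 = Real.exp (-(-β * κ) * t) := fun t => by
      rw [← Real.exp_nat_mul]; ring_nf
    simp only [e]
    exact integrableOn_exp_mul_Ioi (neg_neg_of_pos hk) 1
  have hC : 0 < integratingFactor β Φ 1 := factor_pos one_pos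
  set C := Real.exp (-2 * β * M) * (1 + 4 / (-β * κ)) ^ 2 * Real.exp (-β * κ / 2)
    * integratingFactor β Φ 1 with hCdef
  have h3 := (h2.integrable_mul h1).norm.const_mul C
  refine h3.mono' ?_ ?_
  · exact ((D.continuousOn_factor.mono (Ioi_subset_Ioi zero_le_one)).aestronglyMeasurable
      measurableSet_Ioi).mul hn.aestronglyMeasurable
  · filter_upwards [ae_restrict_mem measurableSet_Ioi] with t ht
    have ht : 1 < t := ht
    have ht0 : 0 < t := one_pos.trans ht
    have h4 := D.factor_le_far hκ hβ hγ le_rfl ht.le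
    rw [Real.one_rpow, one_mul, div_le_iff₀ hC] at h4
    simp only [Pi.mul_apply, norm_mul, Real.norm_eq_abs]
    rw [abs_of_pos (factor_pos ht0), abs_of_nonneg (Real.rpow_nonneg ht0.le _), Real.abs_exp]
    calc _ ≤ _ := mul_le_mul_of_nonneg_right h4 (abs_nonneg _)
      _ = _ := by
        rw [hCdef, show -(-β * κ / 2) * (t - 1) = -β * κ / 2 + -(-β * κ / 2) * t by ring,
          Real.exp_add]
        ring

/-- The kernel is at most a constant times t/r, and r^(a-1/2) (t/r) = r^(a-3/2) t^(1/2-a) t^(a+1/2)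
is Hardy's kernel acting on the weighted datum. -/
theorem memLp_near (D : IsDrift V Φ κ M) (β : ℝ) (ha : a < 1)
    (hn : Measurable n) (h1 : MemLp (fun r => r ^ (a + 1 / 2) * n r) 2 (volume.restrict (Ioc 0 1)))
    (hm : AEStronglyMeasurable (fun r => r ^ (a - 1 / 2) * ((integratingFactor β Φ r)⁻¹ *
      ∫ t in Ioc 0 r, integratingFactor β Φ t * n t)) (volume.restrict (Ioc 0 1))) :
    MemLp (fun r => r ^ (a - 1 / 2) * ((integratingFactor β Φ r)⁻¹ *
      ∫ t in Ioc 0 r, integratingFactor β Φ t * n t)) 2 (volume.restrict (Ioc 0 1)) := by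
  refine memLp_hardy (D := Real.exp (4 * |β| * M)) ha (by fun_prop) h1 hm fun r hr => ?_
  have hr0 := hr.1
  rw [← mul_assoc, ← integral_const_mul]
  refine (enorm_integral_le_lintegral_enorm _).trans ?_
  rw [← lintegral_const_mul' _ _ (by finiteness)]
  refine setLIntegral_mono' measurableSet_Ioc fun t ht => ?_
  have ht0 := ht.1
  rw [← mul_assoc (ENNReal.ofReal _), ← ENNReal.ofReal_mul (Real.exp_pos _).le, ← ofReal_norm,
    ← ofReal_norm, ← ENNReal.ofReal_mul (by positivity)]
  refine ENNReal.ofReal_le_ofReal ?_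
  simp only [norm_mul, Real.norm_eq_abs, abs_inv]
  rw [abs_of_pos (factor_pos ht0), abs_of_pos (factor_pos hr0),
    abs_of_nonneg (Real.rpow_nonneg hr0.le _), abs_of_nonneg (Real.rpow_nonneg ht0.le _)]
  have e1 : r ^ (a - 1 / 2) = r ^ (a - 3 / 2) * r := by
    rw [← Real.rpow_add_one hr0.ne']; ring_nf
  have e2 : t = t ^ (1 / 2 - a) * t ^ (a + 1 / 2) := by
    rw [← Real.rpow_add ht0, show 1 / 2 - a + (a + 1 / 2) = 1 by ring, Real.rpow_one]
  calc _ = r ^ (a - 1 / 2) * |n t| * (integratingFactor β Φ t / integratingFactor β Φ r) := by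
        ring
    _ ≤ r ^ (a - 1 / 2) * |n t| * (Real.exp (4 * |β| * M) * (t / r)) := by
        gcongr
        exact D.factor_le_near β hr0 hr.2 ht0 (ht.2.trans hr.2)
    _ = Real.exp (4 * |β| * M) * r ^ (a - 3 / 2) * |n t| * t := by
        rw [e1]; field_simp
    _ = Real.exp (4 * |β| * M) * r ^ (a - 3 / 2) * |n t| * (t ^ (1 / 2 - a) * t ^ (a + 1 / 2)) := by
        rw [← e2]
    _ = _ := by ring

theorem memLp_far (D : IsDrift V Φ κ M) (hκ : 0 < κ) (hβ : β < 0) (hγ : -1 < γ)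
    (hn : Measurable n) (h1 : MemLp (fun r => r ^ (γ + 1 / 2) * n r) 2 (volume.restrict (Ioi 1)))
    (hm : AEStronglyMeasurable (fun r => r ^ (γ + 1 / 2) * ((integratingFactor β Φ r)⁻¹ *
      ∫ t in Ioi r, integratingFactor β Φ t * n t)) (volume.restrict (Ioi 1))) :
    MemLp (fun r => r ^ (γ + 1 / 2) * ((integratingFactor β Φ r)⁻¹ *
      ∫ t in Ioi r, integratingFactor β Φ t * n t)) 2 (volume.restrict (Ioi 1)) := by
  have hk : 0 < -β * κ := mul_pos (neg_pos.2 hβ) hκ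
  refine memLp_exp_kernel (D := Real.exp (-2 * β * M) * (1 + 4 / (-β * κ)) ^ 2)
    (half_pos hk) (by fun_prop) h1 hm fun r hr => ?_
  have hr0 : 0 < r := one_pos.trans hr
  rw [← mul_assoc, ← integral_const_mul]
  refine (enorm_integral_le_lintegral_enorm _).trans ?_
  rw [← lintegral_const_mul' _ _ (by finiteness)]
  refine setLIntegral_mono' measurableSet_Ioi fun t ht => ?_
  have ht : r < t := ht
  have ht0 := hr0.trans ht
  rw [← mul_assoc (ENNReal.ofReal _), ← ENNReal.ofReal_mul (by positivity), ← ofReal_norm,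
    ← ofReal_norm, ← ENNReal.ofReal_mul (by positivity)]
  refine ENNReal.ofReal_le_ofReal ?_
  simp only [norm_mul, Real.norm_eq_abs, abs_inv]
  rw [abs_of_pos (factor_pos ht0), abs_of_pos (factor_pos hr0),
    abs_of_nonneg (Real.rpow_nonneg hr0.le _), abs_of_nonneg (Real.rpow_nonneg ht0.le _)]
  have h4 := D.factor_le_far hκ hβ hγ hr.le ht.le
  calc _ = r ^ (γ + 1 / 2) * (integratingFactor β Φ t / integratingFactor β Φ r) * |n t| := by
        ring
    _ ≤ _ := mul_le_mul_of_nonneg_right h4 (abs_nonneg _)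
    _ = _ := by ring

theorem abs_coeff_le (D : IsDrift V Φ κ M) (β : ℝ) {r : ℝ} (hr : 0 < r) :
    |2 * β * V r| ≤ 2 * |β| * M := by
  rw [abs_mul, abs_mul, abs_two]
  have := D.abs_le r hr
  gcongr

/-- The factor 1/r costs exactly the power of r by which the two weights differ, and V is bounded.
-/
theorem memLp_coeff_near (D : IsDrift V Φ κ M) {φ : ℝ → ℝ} (hφ : Measurable φ)
    (h : MemLp (fun r => r ^ (a - 1 / 2) * φ r) 2 (volume.restrict (Ioc 0 1))) :
    MemLp (fun r => r ^ (a + 1 / 2) * ((1 / r + 2 * β * V r) * φ r)) 2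
      (volume.restrict (Ioc 0 1)) := by
  have hVm := D.measurable
  refine memLp_of_abs_le measurableSet_Ioc h (C := 1 + 2 * |β| * M) (by fun_prop) fun r hr => ?_
  have hr0 := hr.1
  have e : r ^ (a + 1 / 2) * ((1 / r + 2 * β * V r) * φ r) =
      (1 + 2 * β * V r * r) * (r ^ (a - 1 / 2) * φ r) := by
    rw [show a + 1 / 2 = (a - 1 / 2) + 1 by ring, Real.rpow_add_one hr0.ne']
    field_simp
  rw [e, abs_mul]
  refine mul_le_mul_of_nonneg_right ((abs_add_le _ _).trans ?_) (abs_nonneg _)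
  rw [abs_one, abs_mul, abs_of_pos hr0]
  have h1 := D.abs_coeff_le β hr0
  have := mul_le_of_le_one_right (abs_nonneg (2 * β * V r)) hr.2
  linarith

theorem memLp_coeff_far (D : IsDrift V Φ κ M) {φ : ℝ → ℝ} (hφ : Measurable φ)
    (h : MemLp (fun r => r ^ (γ + 1 / 2) * φ r) 2 (volume.restrict (Ioi 1))) :
    MemLp (fun r => r ^ (γ + 1 / 2) * ((1 / r + 2 * β * V r) * φ r)) 2
      (volume.restrict (Ioi 1)) := by
  have hVm := D.measurable
  refine memLp_of_abs_le measurableSet_Ioi h (C := 1 + 2 * |β| * M) (by fun_prop) fun r hr => ?_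
  have hr1 : 1 < r := hr
  have hr0 : 0 < r := one_pos.trans hr1
  rw [mul_left_comm, abs_mul]
  refine mul_le_mul_of_nonneg_right ((abs_add_le _ _).trans ?_) (abs_nonneg _)
  rw [abs_of_pos (one_div_pos.2 hr0)]
  exact add_le_add ((div_le_one hr0).2 hr1.le) (D.abs_coeff_le β hr0)

theorem memLp_coeff_div (D : IsDrift V Φ κ M) {S : Set ℝ} (hS : MeasurableSet S)
    (hS0 : S ⊆ Ioi 0) (A : ℝ) {s : ℝ}
    (h : MemLp (fun r : ℝ => r ^ (s - 1 / 2)) 2 (volume.restrict S)) :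
    MemLp (fun r => r ^ (s + 1 / 2) * (2 * β * V r * (A / r))) 2 (volume.restrict S) := by
  have hVm := D.measurable
  refine memLp_of_abs_le hS h (C := 2 * |β| * M * |A|) (by fun_prop) fun r hr => ?_
  have hr0 : 0 < r := hS0 hr
  have e : r ^ (s + 1 / 2) * (2 * β * V r * (A / r)) = 2 * β * V r * A * r ^ (s - 1 / 2) := by
    rw [show s + 1 / 2 = (s - 1 / 2) + 1 by ring, Real.rpow_add_one hr0.ne']
    field_simp
  rw [e, abs_mul, abs_mul]
  have := D.abs_coeff_le β hr0
  gcongr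

/-- The primitive `r ↦ ∫_r^∞ f`. -/
theorem hasRadialDeriv_integral_Ioi {f : ℝ → ℝ} (hi : IntegrableOn f (Ioi 0)) :
    HasRadialDeriv (fun r => ∫ t in Ioi r, f t) (fun t => -f t) := by
  have hloc : ∀ a b : ℝ, 0 < a → 0 < b → IntervalIntegrable f volume a b := fun a b ha hb =>
    intervalIntegrable_iff.2 (hi.mono_set (uIoc_subset_Ioi ha hb))
  refine .primitive (r₀ := 1) (c := ∫ t in Ioi 1, f t) one_pos
    (fun a b ha hb => (hloc a b ha hb).neg) fun r hr => ?_
  rw [intervalIntegral.integral_neg]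
  have := intervalIntegral.integral_interval_add_Ioi (f := f)
    (hi.mono_set (Ioi_subset_Ioi zero_le_one)) (hi.mono_set (Ioi_subset_Ioi hr.le))
  linarith

/-- The solution operator: every right-hand side `n` is attained by `φ + A / r` with `φ` in the
weighted space, where `φ` vanishes at infinity. -/
theorem exists_solution (D : IsDrift V Φ κ M) (hκ : 0 < κ) (hβ : β < 0) (hγ : -1 < γ)
    (hγ0 : γ < 0) (ha0 : 0 < a) (ha : a < 1) (hn : Measurable n)
    (h1 : MemLp (fun r => r ^ (a + 1 / 2) * n r) 2 (volume.restrict (Ioc 0 1)))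
    (h2 : MemLp (fun r => r ^ (γ + 1 / 2) * n r) 2 (volume.restrict (Ioi 1))) :
    ∃ (φ g : ℝ → ℝ) (A : ℝ), Measurable φ ∧ Measurable g ∧ HasRadialDeriv φ g ∧
      MemLp (fun r => r ^ (a - 1 / 2) * φ r) 2 (volume.restrict (Ioc 0 1)) ∧
      MemLp (fun r => r ^ (γ + 1 / 2) * φ r) 2 (volume.restrict (Ioi 1)) ∧
      MemLp (fun r => r ^ (a + 1 / 2) * g r) 2 (volume.restrict (Ioc 0 1)) ∧
      MemLp (fun r => r ^ (γ + 1 / 2) * g r) 2 (volume.restrict (Ioi 1)) ∧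
      ∀ r, 0 < r → g r + (1 / r + 2 * β * V r) * φ r + 2 * β * V r * (A / r) = n r := by
  have hi1 := D.integrableOn_Ioc_factor_mul β ha hn h1
  have hi2 := D.integrableOn_Ioi_factor_mul hκ hβ hγ hn h2
  have hi : IntegrableOn (fun t => integratingFactor β Φ t * n t) (Ioi 0) := by
    rw [← Ioc_union_Ioi_eq_Ioi (zero_le_one' ℝ)]
    exact hi1.union hi2
  set T : ℝ → ℝ := fun r => ∫ t in Ioi r, integratingFactor β Φ t * n t with hT
  set A : ℝ := ∫ t in Ioi 0, integratingFactor β Φ t * n t with hA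
  have hTd : HasRadialDeriv T (fun t => -(integratingFactor β Φ t * n t)) :=
    hasRadialDeriv_integral_Ioi hi
  have hW : ∀ r, 0 < r → ∫ t in Ioc 0 r, integratingFactor β Φ t * n t = A - T r := by
    intro r hr
    rw [hA, ← Ioc_union_Ioi_eq_Ioi hr.le, setIntegral_union (Ioc_disjoint_Ioi le_rfl)
      measurableSet_Ioi (hi.mono_set fun x hx => hx.1) (hi.mono_set (Ioi_subset_Ioi hr.le))]
    ring
  set u : ℝ → ℝ := fun r => (integratingFactor β Φ r)⁻¹ * T r with hu
  have hud := (D.hasRadialDeriv_inv_factor (β := β)).mul hTd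
  -- The admissible solution is -u = -p⁻¹ ∫_r^∞ pn; adding A/r removes its pole at the origin.
  set φ₁ : ℝ → ℝ := fun r => -1 * u r + A / r with hφ₁
  have hφ₁d := (hud.const_mul (-1)).add (HasRadialDeriv.div_id A)
  set φ : ℝ → ℝ := (Ioi 0).indicator φ₁ with hφ
  have hφeq : ∀ r, 0 < r → φ r = φ₁ r := fun r hr => indicator_of_mem (s := Ioi 0) hr φ₁
  have hφm : Measurable φ := by
    rw [hφ, ← piecewise_eq_indicator]
    exact ContinuousOn.measurable_piecewise hφ₁d.continuousOn continuousOn_const measurableSet_Ioi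
  -- Reading the derivative off the equation makes the equation hold at every r > 0 and gives the
  -- bounds on `g` from those on `φ`.
  set g : ℝ → ℝ := fun r => n r - (1 / r + 2 * β * V r) * φ r - 2 * β * V r * (-A / r) with hg
  have hVm := D.measurable
  have hgm : Measurable g := by fun_prop
  have hφd : HasRadialDeriv φ g := by
    refine hφ₁d.congr (fun r hr => (hφeq r hr).symm) (Eventually.of_forall fun r hr => ?_)
    have hp := (factor_pos (β := β) (Φ := Φ) hr).ne'
    simp only [hg, hφeq r hr, hφ₁, hu]
    field_simp
    ring
  have hφc : ContinuousOn φ (Ioi 0) := hφd.continuousOn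
  -- Since ∫_r^∞ pn = A - ∫_0^r pn, one has φ = p⁻¹ ∫_0^r pn + A(1/r - 1/p). The first term is
  -- handled by Hardy's inequality and the second is bounded.
  have hnear : MemLp (fun r => r ^ (a - 1 / 2) * φ r) 2 (volume.restrict (Ioc 0 1)) := by
    have hc1 : ContinuousOn (fun r => r ^ (a - 1 / 2) * ((integratingFactor β Φ r)⁻¹ *
        (A - T r))) (Ioi 0) :=
      (continuousOn_id.rpow_const fun r hr => Or.inl (ne_of_gt hr)).mul
        (D.continuousOn_inv_factor.mul (continuousOn_const.sub hTd.continuousOn))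
    have e1 : EqOn (fun r => r ^ (a - 1 / 2) * ((integratingFactor β Φ r)⁻¹ * (A - T r)))
        (fun r => r ^ (a - 1 / 2) * ((integratingFactor β Φ r)⁻¹ *
          ∫ t in Ioc 0 r, integratingFactor β Φ t * n t)) (Ioi 0) := fun r hr => by
      simp only [hW r hr]
    have m1 := D.memLp_near β ha hn h1 (((hc1.congr e1.symm).mono
      fun r hr => hr.1).aestronglyMeasurable measurableSet_Ioc)
    have m2 : MemLp (fun r => r ^ (a - 1 / 2) * (A * (r⁻¹ - (integratingFactor β Φ r)⁻¹))) 2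
        (volume.restrict (Ioc 0 1)) := by
      refine memLp_of_abs_le measurableSet_Ioc (memLp_rpow_Ioc_iff (s := a - 1 / 2).2
        (by linarith)) (C := |A| * (2 * |β| * M * Real.exp (2 * |β| * M))) ?_ fun r hr => ?_
      · refine ContinuousOn.aestronglyMeasurable (ContinuousOn.mono (s := Ioi 0) ?_
          fun r hr => hr.1) measurableSet_Ioc
        exact (continuousOn_id.rpow_const fun r hr => Or.inl (ne_of_gt hr)).mul
          (continuousOn_const.mul ((continuousOn_id.inv₀ fun r hr => ne_of_gt hr).sub
            D.continuousOn_inv_factor))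
      · rw [abs_mul, abs_mul, abs_sub_comm, mul_comm]
        gcongr
        exact D.abs_inv_factor_sub_le hr.1 hr.2
    refine (m1.add m2).ae_eq ?_
    filter_upwards [ae_restrict_mem measurableSet_Ioc] with r hr
    simp only [Pi.add_apply, hW r hr.1, hφeq r hr.1, hφ₁, hu]
    ring
  -- At infinity the two terms are estimated separately; A/r is admissible because γ < 0.
  have hfar : MemLp (fun r => r ^ (γ + 1 / 2) * φ r) 2 (volume.restrict (Ioi 1)) := by
    have hc1 : ContinuousOn (fun r => r ^ (γ + 1 / 2) * ((integratingFactor β Φ r)⁻¹ *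
        T r)) (Ioi 0) :=
      (continuousOn_id.rpow_const fun r hr => Or.inl (ne_of_gt hr)).mul
        (D.continuousOn_inv_factor.mul hTd.continuousOn)
    have m1 := D.memLp_far hκ hβ hγ hn h2 ((hc1.mono
      (Ioi_subset_Ioi zero_le_one)).aestronglyMeasurable measurableSet_Ioi)
    have m2 := (memLp_rpow_Ioi_iff (s := γ - 1 / 2).2 (by linarith)).const_mul A
    refine (m2.sub m1).ae_eq ?_
    filter_upwards [ae_restrict_mem measurableSet_Ioi] with r hr
    have hr0 : 0 < r := one_pos.trans hr
    simp only [Pi.sub_apply, hφeq r hr0, hφ₁, hu]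
    rw [show γ + 1 / 2 = (γ - 1 / 2) + 1 by ring, Real.rpow_add_one hr0.ne']
    field_simp
    ring
  -- The coefficient of 1/r is -A, since the solution is φ - A/r.
  refine ⟨φ, g, -A, hφm, hgm, hφd, hnear, hfar, ?_, ?_, fun r hr => by simp only [hg]; ring⟩
  · refine ((h1.sub (D.memLp_coeff_near (β := β) hφm hnear)).sub (D.memLp_coeff_div (β := β)
      measurableSet_Ioc (fun r hr => hr.1) (-A) (s := a) (memLp_rpow_Ioc_iff.2 (by linarith)))).ae_eq
      (Eventually.of_forall fun r => ?_)
    simp only [Pi.sub_apply, hg]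
    ring
  · refine ((h2.sub (D.memLp_coeff_far (β := β) hφm hfar)).sub (D.memLp_coeff_div (β := β)
      measurableSet_Ioi (Ioi_subset_Ioi zero_le_one) (-A) (s := γ)
      (memLp_rpow_Ioi_iff.2 (by linarith)))).ae_eq (Eventually.of_forall fun r => ?_)
    simp only [Pi.sub_apply, hg]
    ring

/-- The product p(v + A/r) has zero derivative, because the derivative of A/r cancels (1/r)(A/r), so
it is a constant C. Decay of p against integrability at infinity forces C = 0. Then v = -A/r, which
the weight at the origin excludes unless A = 0. -/
theorem homogeneous_eq_zero (D : IsDrift V Φ κ M) (hκ : 0 < κ) (hβ : β < 0) (hγ : -1 < γ)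
    (hγ0 : γ < 0) (ha : a < 1) {v g : ℝ → ℝ} {A : ℝ} (hv : HasRadialDeriv v g)
    (h1 : MemLp (fun r => r ^ (a - 1 / 2) * v r) 2 (volume.restrict (Ioc 0 1)))
    (h2 : MemLp (fun r => r ^ (γ + 1 / 2) * v r) 2 (volume.restrict (Ioi 1)))
    (h : ∀ᵐ r : ℝ, 0 < r → g r + (1 / r + 2 * β * V r) * v r + 2 * β * V r * (A / r) = 0) :
    A = 0 ∧ ∀ r, 0 < r → v r = 0 := by
  have hC := ((D.hasRadialDeriv_factor (β := β)).mul
    (hv.add (HasRadialDeriv.div_id A))).eq_of_ae_zero (by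
      filter_upwards [h] with r hr hr0
      have h3 := hr hr0
      calc _ = integratingFactor β Φ r *
            (g r + (1 / r + 2 * β * V r) * v r + 2 * β * V r * (A / r)) := by
            field_simp; ring
        _ = 0 := by rw [h3, mul_zero])
  set C := integratingFactor β Φ 1 * (v 1 + A / 1)
  have hC0 : C = 0 := by
    by_contra hne
    set K := Real.exp (-2 * β * M) * (1 + 4 / (-β * κ)) ^ 2
    have hp1 : 0 < integratingFactor β Φ 1 := factor_pos one_pos
    have m1 : MemLp (fun r => r ^ (γ + 1 / 2) * (v r + A / r)) 2 (volume.restrict (Ioi 1)) := by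
      refine (h2.add ((memLp_rpow_Ioi_iff (s := γ - 1 / 2).2 (by linarith)).const_mul A)).ae_eq ?_
      filter_upwards [ae_restrict_mem measurableSet_Ioi] with r hr
      have hr0 : 0 < r := one_pos.trans hr
      simp only [Pi.add_apply]
      rw [show γ + 1 / 2 = (γ - 1 / 2) + 1 by ring, Real.rpow_add_one hr0.ne']
      field_simp
    -- If C ≠ 0, the weighted |v + A/r| is bounded below by a positive constant, so the constant 1
    -- would be square integrable on (1, ∞).
    have m2 : MemLp (fun r : ℝ => r ^ (0 : ℝ)) 2 (volume.restrict (Ioi 1)) := by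
      refine memLp_of_abs_le measurableSet_Ioi m1 (C := K * integratingFactor β Φ 1 / |C|)
        (by fun_prop) fun r hr => ?_
      have hr1 : 1 < r := hr
      have hr0 : 0 < r := one_pos.trans hr1
      have h4 := D.factor_le_far hκ hβ hγ le_rfl hr1.le
      have hk : 0 < -β * κ := mul_pos (neg_pos.2 hβ) hκ
      rw [Real.one_rpow, one_mul, div_le_iff₀ hp1] at h4
      have h5 : Real.exp (-(-β * κ / 2) * (r - 1)) ≤ 1 := by
        rw [Real.exp_le_one_iff]; nlinarith
      have hpr : 0 < integratingFactor β Φ r := factor_pos hr0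
      have h6 : integratingFactor β Φ r ≤ K * r ^ (γ + 1 / 2) * integratingFactor β Φ 1 := by
        refine h4.trans (mul_le_mul_of_nonneg_right ?_ hp1.le)
        refine mul_le_mul_of_nonneg_right ?_ (Real.rpow_nonneg hr0.le _)
        exact mul_le_of_le_one_right (by positivity) h5
      have h7 : |v r + A / r| = |C| / integratingFactor β Φ r := by
        rw [eq_div_iff hpr.ne', ← hC r hr0, abs_mul, abs_of_pos hpr, mul_comm]
      rw [Real.rpow_zero, abs_one, abs_mul (r ^ (γ + 1 / 2)), h7, abs_of_nonneg (Real.rpow_nonneg hr0.le _)]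
      have hCp : 0 < |C| := abs_pos.2 hne
      rw [show K * integratingFactor β Φ 1 / |C| * (r ^ (γ + 1 / 2) * (|C| /
        integratingFactor β Φ r)) = K * r ^ (γ + 1 / 2) * integratingFactor β Φ 1 /
          integratingFactor β Φ r by field_simp, one_le_div hpr]
      exact h6
    have := memLp_rpow_Ioi_iff.1 m2
    norm_num at this
  have hvA : ∀ r, 0 < r → v r = -A / r := by
    intro r hr
    have h3 := hC r hr
    rw [hC0, mul_eq_zero, or_iff_right (factor_pos hr).ne'] at h3
    rw [neg_div]
    linarith
  have hA : A = 0 := by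
    by_contra hne
    have m : MemLp (fun r : ℝ => r ^ (a - 3 / 2)) 2 (volume.restrict (Ioc 0 1)) := by
      refine (h1.const_mul (-A⁻¹)).ae_eq ?_
      filter_upwards [ae_restrict_mem measurableSet_Ioc] with r hr
      rw [hvA r hr.1, show a - 1 / 2 = (a - 3 / 2) + 1 by ring, Real.rpow_add_one hr.1.ne']
      have := hr.1.ne'
      field_simp
    have := memLp_rpow_Ioc_iff.1 m
    linarith
  exact ⟨hA, fun r hr => by rw [hvA r hr, hA]; simp⟩

end IsDrift

/-! ### Directness of the sum defining the domain. -/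

theorem eq_zero_of_add_div_add_const {γ a : ℝ} (hγ : -1 < γ) (ha0 : 0 < a) (ha : a < 1)
    {v : ℝ → ℝ} {A c : ℝ}
    (h1 : MemLp (fun r => r ^ (a - 1 / 2) * v r) 2 (volume.restrict (Ioc 0 1)))
    (h2 : MemLp (fun r => r ^ (γ + 1 / 2) * v r) 2 (volume.restrict (Ioi 1)))
    (h : ∀ᵐ r : ℝ, 0 < r → v r + (A / r + c) = 0) : A = 0 ∧ c = 0 := by
  -- At the origin v + c is admissible because a > 0, while A/r is not because r^(a-3/2) fails to be
  -- square integrable for a < 1.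
  have hA : A = 0 := by
    by_contra hne
    have m1 := (memLp_rpow_Ioc_iff (s := a - 1 / 2).2 (by linarith)).const_mul c
    have m : MemLp (fun r : ℝ => r ^ (a - 3 / 2)) 2 (volume.restrict (Ioc 0 1)) := by
      refine ((h1.add m1).const_mul (-A⁻¹)).ae_eq ?_
      filter_upwards [ae_restrict_mem measurableSet_Ioc, ae_restrict_of_ae h] with r hr hv
      have hv' : v r + c = -A / r := by rw [neg_div]; linarith [hv hr.1]
      have := hr.1.ne'
      calc _ = -A⁻¹ * (r ^ (a - 1 / 2) * (v r + c)) := by simp only [Pi.add_apply]; ring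
        _ = _ := by
          rw [hv', show a - 1 / 2 = (a - 3 / 2) + 1 by ring, Real.rpow_add_one hr.1.ne']
          field_simp
    have := memLp_rpow_Ioc_iff.1 m
    linarith
  refine ⟨hA, ?_⟩
  -- At infinity a nonzero constant would require 2γ + 1 < -1, contrary to γ > -1.
  by_contra hne
  have m : MemLp (fun r : ℝ => r ^ (γ + 1 / 2)) 2 (volume.restrict (Ioi 1)) := by
    refine (h2.const_mul (-c⁻¹)).ae_eq ?_
    filter_upwards [ae_restrict_mem measurableSet_Ioi, ae_restrict_of_ae h] with r hr hv
    have hv' := hv (one_pos.trans hr)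
    rw [hA, zero_div, zero_add] at hv'
    rw [eq_neg_of_add_eq_zero_left hv']
    field_simp
  have := memLp_rpow_Ioi_iff.1 m
  linarith

/-! ### Completeness of the radial spaces -/

/-- A function measurable for the σ-algebra generated by |x| factors through |x|. In this form the
radial subspace is known to be closed, hence complete. -/
theorem mem_radialL2_iff {w : Plane → ℝ} (f : Lp ℝ 2 (weightedMeasure w)) :
    f ∈ radialL2 w ↔ AEStronglyMeasurable[MeasurableSpace.comap (fun x : Plane => ‖x‖)
      inferInstance] (f : Plane → ℝ) (weightedMeasure w) := by
  constructor
  · rintro ⟨v, hv, h⟩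
    exact ⟨fun x => v ‖x‖, (hv.comp (comap_measurable _)).stronglyMeasurable, h⟩
  · rintro ⟨g, hg, h⟩
    obtain ⟨v, hv, rfl⟩ := hg.measurable.exists_eq_measurable_comp
    exact ⟨v, hv, h⟩

theorem isClosed_radialL2 (w : Plane → ℝ) :
    IsClosed (radialL2 w : Set (Lp ℝ 2 (weightedMeasure w))) := by
  have h := isClosed_aestronglyMeasurable (F := ℝ) (p := 2) (μ := weightedMeasure w)
    (m := MeasurableSpace.comap (fun x : Plane => ‖x‖) inferInstance) measurable_norm.comap_le
  convert h using 1
  ext f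
  exact mem_radialL2_iff f

theorem isClosed_radialSobolev (s : ℕ) (w : ℕ → Plane → ℝ) :
    IsClosed (radialSobolev s w : Set (Jet s w)) := by
  have h1 : IsClosed (sobolev s w : Set (Jet s w)) := Submodule.isClosed_topologicalClosure _
  have h2 : IsClosed ((fun F : Jet s w => F (MultiIdx.zero s)) ⁻¹'
      (radialL2 (w (MultiIdx.zero s).order) : Set _)) :=
    (isClosed_radialL2 _).preimage (by fun_prop)
  exact h1.inter h2

instance (s : ℕ) (w : ℕ → Plane → ℝ) : CompleteSpace (radialSobolev s w) :=
  (isClosed_radialSobolev s w).completeSpace_coe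

instance (w : Plane → ℝ) : CompleteSpace (radialL2 w) :=
  (isClosed_radialL2 w).completeSpace_coe

/-! ### Multiplication operators -/

theorem exists_mulCLM {w₁ w₂ b : Plane → ℝ} (hw₁ : IsWeight w₁) (hw₂ : IsWeight w₂)
    (hb : Measurable b) {C : ℝ} (h0 : 0 ≤ C)
    (hC : ∀ x, x ≠ 0 → |b x| * w₂ x ≤ C * w₁ x) :
    ∃ T : Lp ℝ 2 (weightedMeasure w₁) →L[ℝ] Lp ℝ 2 (weightedMeasure w₂),
      ∀ f, (T f : Plane → ℝ) =ᵐ[volume] fun x => b x * f x := by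
  have hle : ∀ f : Plane → ℝ, ∀ᵐ x, ‖w₂ x * (b x * f x)‖ ≤ C * ‖w₁ x * f x‖ := by
    intro f
    filter_upwards [ae_ne_zero] with x hx
    rw [norm_mul, norm_mul, norm_mul, Real.norm_of_nonneg (hw₂.pos x hx).le,
      Real.norm_of_nonneg (hw₁.pos x hx).le, Real.norm_eq_abs (b x), ← mul_assoc, ← mul_assoc,
      mul_comm (w₂ x)]
    exact mul_le_mul_of_nonneg_right (hC x hx) (norm_nonneg _)
  have hmeas : ∀ f : Lp ℝ 2 (weightedMeasure w₁), AEStronglyMeasurable f volume := fun f =>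
    hw₁.aestronglyMeasurable_iff.1 (Lp.aestronglyMeasurable f)
  have hmem : ∀ f : Lp ℝ 2 (weightedMeasure w₁),
      MemLp (fun x => b x * f x) 2 (weightedMeasure w₂) := fun f => by
    rw [hw₂.memLp_iff (f := fun x => b x * f x) (hb.aestronglyMeasurable.mul (hmeas f))]
    exact ((hw₁.memLp_iff (hmeas f)).1 (Lp.memLp f)).of_le_mul
      (hw₂.measurable.aestronglyMeasurable.mul (hb.aestronglyMeasurable.mul (hmeas f))) (hle f)
  have hae : ∀ f, ((hmem f).toLp _ : Plane → ℝ) =ᵐ[volume] fun x => b x * f x := fun f => by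
    rw [EventuallyEq, ← hw₂.ae_eq]; exact (hmem f).coeFn_toLp
  let T₀ : Lp ℝ 2 (weightedMeasure w₁) →ₗ[ℝ] Lp ℝ 2 (weightedMeasure w₂) :=
    { toFun := fun f => (hmem f).toLp _
      map_add' := fun f g => by
        rw [← MemLp.toLp_add]
        refine MemLp.toLp_congr _ _ ?_
        have := Lp.coeFn_add f g
        rw [EventuallyEq, hw₁.ae_eq] at this
        rw [EventuallyEq, hw₂.ae_eq]
        filter_upwards [this] with x hx
        simp only [hx, Pi.add_apply, mul_add]
      map_smul' := fun c f => by
        rw [RingHom.id_apply, ← MemLp.toLp_const_smul]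
        refine MemLp.toLp_congr _ _ ?_
        have := Lp.coeFn_smul c f
        rw [EventuallyEq, hw₁.ae_eq] at this
        rw [EventuallyEq, hw₂.ae_eq]
        filter_upwards [this] with x hx
        simp only [hx, Pi.smul_apply, smul_eq_mul]
        ring }
  refine ⟨T₀.mkContinuous C fun f => ?_, hae⟩
  change ‖(hmem f).toLp _‖ ≤ C * ‖f‖
  rw [Lp.norm_toLp, Lp.norm_def, eLpNorm_weightedMeasure hw₂.measurable,
    eLpNorm_weightedMeasure hw₁.measurable, ← ENNReal.toReal_ofReal h0, ← ENNReal.toReal_mul]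
  refine ENNReal.toReal_mono (ENNReal.mul_ne_top ENNReal.ofReal_ne_top
    ((hw₁.memLp_iff (hmeas f)).1 (Lp.memLp f)).2.ne) ?_
  exact eLpNorm_le_mul_eLpNorm_of_ae_le_mul
    (by simpa only [ENNReal.toReal_ofReal h0] using hle f) 2

/-! ### The operator -/

theorem MultiIdx.order_one (i : Fin 2) : (MultiIdx.one i).order = 1 := by
  fin_cases i <;> rfl

variable {χ : RadialCutoff} {γ₁ σ₁ : ℝ}

theorem Jet.memLp_val {s : ℕ} {w : ℕ → Plane → ℝ} (F : Jet s w) :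
    MemLp F.val 2 (weightedMeasure (w 0)) := Lp.memLp (F (MultiIdx.zero s))

/-- The weight exponent σ₁ + 1 at the origin together with 1/2 from the Jacobian is a - 1/2 for a =
σ₁ + 2, the form used in the radial analysis. -/
theorem exists_profile_domain (F : HDouble χ 1 γ₁ (σ₁ + 1)) :
    ∃ v g : ℝ → ℝ, Measurable v ∧ Measurable g ∧ HasRadialDeriv v g ∧
      F.1.val =ᵐ[volume] (fun x => v ‖x‖) ∧ (F.1.radialDeriv =ᵐ[volume] fun x => g ‖x‖) ∧
      MemLp (fun r => r ^ (σ₁ + 2 - 1 / 2) * v r) 2 (volume.restrict (Ioc 0 1)) ∧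
      MemLp (fun r => r ^ (γ₁ + 1 / 2) * v r) 2 (volume.restrict (Ioi 1)) := by
  obtain ⟨v, g, hv, hg, h, h1, h2⟩ := exists_profile (isWeight_doubleWeight χ γ₁ (σ₁ + 1))
    (continuousOn_doubleWeight χ γ₁ (σ₁ + 1) 1) F.2
  have hm : MemLp (fun x : Plane => v ‖x‖) 2 (weightedMeasure (doubleWeight χ γ₁ (σ₁ + 1) 0)) := by
    refine (Jet.memLp_val F.1).ae_eq ?_
    rw [EventuallyEq, (isWeight_doubleWeight χ γ₁ (σ₁ + 1) 0).ae_eq]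
    exact h1
  rw [memLp_radial_iff _ _ _ _ hv] at hm
  refine ⟨v, g, hv, hg, h, h1, h2, ?_, hm.2⟩
  convert hm.1 using 3
  push_cast
  ring_nf

theorem exists_profile_target (N : L2Double χ γ₁ (σ₁ + 2)) :
    ∃ n : ℝ → ℝ, Measurable n ∧ (N.1 : Plane → ℝ) =ᵐ[volume] (fun x => n ‖x‖) ∧
      MemLp (fun r => r ^ (σ₁ + 2 + 1 / 2) * n r) 2 (volume.restrict (Ioc 0 1)) ∧
      MemLp (fun r => r ^ (γ₁ + 1 / 2) * n r) 2 (volume.restrict (Ioi 1)) := by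
  obtain ⟨n, hn, h⟩ := N.2
  have hm := (Lp.memLp N.1).ae_eq h
  rw [memLp_radial_iff _ _ _ _ hn] at hm
  refine ⟨n, hn, ?_, ?_, hm.2⟩
  · rwa [EventuallyEq, (isWeight_doubleWeight χ γ₁ (σ₁ + 2) 0).ae_eq] at h
  · simpa using hm.1

theorem exists_radialL2_of_profile {n : ℝ → ℝ} (hn : Measurable n)
    (h1 : MemLp (fun r => r ^ (σ₁ + 2 + 1 / 2) * n r) 2 (volume.restrict (Ioc 0 1)))
    (h2 : MemLp (fun r => r ^ (γ₁ + 1 / 2) * n r) 2 (volume.restrict (Ioi 1))) :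
    ∃ N : L2Double χ γ₁ (σ₁ + 2), (N.1 : Plane → ℝ) =ᵐ[volume] (fun x => n ‖x‖) := by
  have hm : MemLp (fun x : Plane => n ‖x‖) 2 (weightedMeasure (doubleWeight χ γ₁ (σ₁ + 2) 0)) :=
    (memLp_radial_iff _ _ _ _ hn).2 ⟨by simpa using h1, h2⟩
  have h := hm.coeFn_toLp
  refine ⟨⟨hm.toLp _, n, hn, h⟩, ?_⟩
  rwa [EventuallyEq, (isWeight_doubleWeight χ γ₁ (σ₁ + 2) 0).ae_eq] at h

theorem L2Double.ext_ae {N N' : L2Double χ γ₁ (σ₁ + 2)}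
    (h : (N.1 : Plane → ℝ) =ᵐ[volume] N'.1) : N = N' := by
  refine Subtype.ext (Lp.ext ?_)
  rwa [EventuallyEq, (isWeight_doubleWeight χ γ₁ (σ₁ + 2) 0).ae_eq]

theorem HDouble.ext_ae {γ σ : ℝ} {F F' : HDouble χ 1 γ σ}
    (h : F.1.val =ᵐ[volume] F'.1.val) : F = F' := by
  refine Subtype.ext (sub_eq_zero.1 ?_)
  refine Jet.eq_zero_of_val (isWeight_doubleWeight χ γ σ) (continuousOn_doubleWeight χ γ σ)
    (sub_mem F.2.1 F'.2.1) ?_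
  have hs : (F.1 - F'.1).val =ᵐ[volume] F.1.val - F'.1.val := by
    rw [EventuallyEq, ← (isWeight_doubleWeight χ γ σ 0).ae_eq]
    exact Lp.coeFn_sub (F.1 (MultiIdx.zero 1)) (F'.1 (MultiIdx.zero 1))
  filter_upwards [h, hs] with x h1 h2
  rw [h2, Pi.sub_apply, h1, sub_self, Pi.zero_apply]

theorem YSpace.ext_ae (hγ₁ : γ₁ ∈ Ioo (-1 : ℝ) 0) (hσ₁ : σ₁ ∈ Ioo (-2 : ℝ) (-1))
    {y y' : YSpace χ γ₁ σ₁} (h : y.val =ᵐ[volume] y'.val) : y = y' := by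
  obtain ⟨v, -, hv, -, -, hF, -, h1, h2⟩ := exists_profile_domain y.fst
  obtain ⟨v', -, hv', -, -, hF', -, h1', h2'⟩ := exists_profile_domain y'.fst
  have hr : ∀ᵐ r : ℝ, 0 < r → v r - v' r +
      ((y.snd.fst - y'.snd.fst) / r + (y.snd.snd - y'.snd.snd)) = 0 := by
    refine ae_of_ae_norm ?_
    filter_upwards [h, hF, hF'] with x e1 e2 e3
    simp only [YSpace.val, e2, e3] at e1
    rw [sub_div]
    linarith
  have m1 := h1.sub h1'
  have m2 := h2.sub h2'
  obtain ⟨ha, hc⟩ := eq_zero_of_add_div_add_const (a := σ₁ + 2) (v := fun r => v r - v' r)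
    hγ₁.1 (by linarith [hσ₁.1]) (by linarith [hσ₁.2])
    (by convert m1 using 2 with r; simp only [Pi.sub_apply, mul_sub])
    (by convert m2 using 2 with r; simp only [Pi.sub_apply, mul_sub]) hr
  have hφ : y.fst = y'.fst := by
    refine HDouble.ext_ae ?_
    filter_upwards [h] with x e
    simp only [YSpace.val, sub_eq_zero.1 ha, sub_eq_zero.1 hc] at e
    linarith
  refine WithLp.ofLp_injective 1 (Prod.ext hφ (WithLp.ofLp_injective 1 (Prod.ext ?_ ?_)))
  · exact sub_eq_zero.1 ha
  · exact sub_eq_zero.1 hc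

/-- The two L² parts would differ by a constant, and for γ₁ > -1 a nonzero constant is not in the
weighted space at infinity. -/
theorem ZSpace.ext_ae (hγ₁ : γ₁ ∈ Ioo (-1 : ℝ) 0) {z z' : ZSpace χ γ₁ σ₁}
    (h : z.val =ᵐ[volume] z'.val) : z = z' := by
  obtain ⟨n, hn, hN, -, h2⟩ := exists_profile_target z.fst
  obtain ⟨n', hn', hN', -, h2'⟩ := exists_profile_target z'.fst
  have hr : ∀ᵐ r : ℝ, 0 < r → n r - n' r = z'.snd - z.snd := by
    refine ae_of_ae_norm ?_
    filter_upwards [h, hN, hN'] with x e1 e2 e3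
    simp only [ZSpace.val, e2, e3] at e1
    linarith
  have hc : z.snd = z'.snd := by
    by_contra hne
    have hne' : z'.snd - z.snd ≠ 0 := sub_ne_zero.2 (Ne.symm hne)
    have m : MemLp (fun r : ℝ => r ^ (γ₁ + 1 / 2)) 2 (volume.restrict (Ioi 1)) := by
      refine ((h2.sub h2').const_mul (z'.snd - z.snd)⁻¹).ae_eq ?_
      filter_upwards [ae_restrict_mem measurableSet_Ioi, ae_restrict_of_ae hr] with r hr0 e
      rw [Pi.sub_apply, ← mul_sub, e (one_pos.trans hr0)]
      field_simp
    have := memLp_rpow_Ioi_iff.1 m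
    linarith [hγ₁.1]
  refine WithLp.ofLp_injective 1 (Prod.ext (L2Double.ext_ae ?_) hc)
  filter_upwards [h] with x e
  simp only [ZSpace.val, hc] at e
  change (z.fst.1 : Plane → ℝ) x = (z'.fst.1 : Plane → ℝ) x
  linarith

/-- The weight of a first derivative in the domain has exponent (σ₁ + 1) + 1, which is the exponent
of the target, and the factors xᵢ/|x| are bounded by 1. -/
theorem exists_radialDerivCLM (χ : RadialCutoff) (γ₁ σ₁ : ℝ) :
    ∃ T : Jet 1 (doubleWeight χ γ₁ (σ₁ + 1)) →L[ℝ]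
      Lp ℝ 2 (weightedMeasure (doubleWeight χ γ₁ (σ₁ + 2) 0)),
      ∀ F, (T F : Plane → ℝ) =ᵐ[volume] F.radialDeriv := by
  have hw := isWeight_doubleWeight χ γ₁ (σ₁ + 2) 0
  have h : ∀ i : Fin 2, ∃ T : Lp ℝ 2 (weightedMeasure
      (doubleWeight χ γ₁ (σ₁ + 1) (MultiIdx.one i).order)) →L[ℝ]
      Lp ℝ 2 (weightedMeasure (doubleWeight χ γ₁ (σ₁ + 2) 0)),
      ∀ f, (T f : Plane → ℝ) =ᵐ[volume] fun x => x i / ‖x‖ * f x := fun i => by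
    refine exists_mulCLM (isWeight_doubleWeight χ γ₁ (σ₁ + 1) _) hw
      (measurable_coord_div_norm i) zero_le_one fun x hx => ?_
    have e : doubleWeight χ γ₁ (σ₁ + 1) (MultiIdx.one i).order x =
        doubleWeight χ γ₁ (σ₁ + 2) 0 x := by
      rw [MultiIdx.order_one, doubleWeight, doubleWeight]
      congr 2
      push_cast
      ring
    rw [e]
    exact mul_le_mul_of_nonneg_right (abs_coord_div_norm_le i x) (hw.pos x hx).le
  choose T hT using h
  refine ⟨∑ i : Fin 2, (T i).comp (PiLp.proj 1 _ (MultiIdx.one i)), fun F => ?_⟩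
  have h1 := Lp.coeFn_add (T 0 (F (MultiIdx.one 0))) (T 1 (F (MultiIdx.one 1)))
  rw [EventuallyEq, hw.ae_eq] at h1
  have e : (∑ i : Fin 2, (T i).comp (PiLp.proj 1 _ (MultiIdx.one i))) F =
      T 0 (F (MultiIdx.one 0)) + T 1 (F (MultiIdx.one 1)) := by
    simp [Fin.sum_univ_two]
  rw [e]
  filter_upwards [h1, hT 0 (F (MultiIdx.one 0)), hT 1 (F (MultiIdx.one 1))] with x a b c
  rw [a, Pi.add_apply, b, c, Jet.radialDeriv, Fin.sum_univ_two]

/-- The target weight has one more factor m ≤ 2 min(|x|, 1) than the domain weight: this compensates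
1/|x| near the origin and is harmless for the bounded part. -/
theorem exists_coeffCLM {V Φ : ℝ → ℝ} {κ M : ℝ} (D : IsDrift V Φ κ M) (β : ℝ) (χ : RadialCutoff)
    (γ₁ σ₁ : ℝ) :
    ∃ T : Jet 1 (doubleWeight χ γ₁ (σ₁ + 1)) →L[ℝ]
      Lp ℝ 2 (weightedMeasure (doubleWeight χ γ₁ (σ₁ + 2) 0)),
      ∀ F, (T F : Plane → ℝ) =ᵐ[volume] fun x => (1 / ‖x‖ + 2 * β * V ‖x‖) * F.val x := by
  have hM := D.bound_nonneg
  have hVm := D.measurable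
  have hw := isWeight_doubleWeight χ γ₁ (σ₁ + 1) 0
  have hb : Measurable fun x : Plane => 1 / ‖x‖ + 2 * β * V ‖x‖ := by fun_prop
  obtain ⟨T, hT⟩ := exists_mulCLM hw
    (isWeight_doubleWeight χ γ₁ (σ₁ + 2) 0) hb
    (C := 2 + 2 * (2 * |β| * M)) (by positivity) fun x hx => by
    have hn := norm_pos_iff.2 hx
    have e : doubleWeight χ γ₁ (σ₁ + 2) 0 x = χ.m x * doubleWeight χ γ₁ (σ₁ + 1) 0 x := by
      rw [doubleWeight, doubleWeight, ← mul_assoc, mul_comm (χ.m x),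
        ← Real.rpow_add_one (χ.m_pos hx).ne']
      congr 2
      ring
    rw [e, ← mul_assoc]
    refine mul_le_mul_of_nonneg_right ?_ (hw.pos x hx).le
    have h1 : |1 / ‖x‖ + 2 * β * V ‖x‖| ≤ 1 / ‖x‖ + 2 * |β| * M := by
      refine (abs_add_le _ _).trans (add_le_add (abs_of_pos (one_div_pos.2 hn)).le ?_)
      exact D.abs_coeff_le β hn
    have h2 : χ.m x ≤ 2 * ‖x‖ :=
      (χ.m_le x).trans (mul_le_mul_of_nonneg_left (min_le_left _ _) two_pos.le)
    have h3 : χ.m x ≤ 2 :=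
      (χ.m_le x).trans (by linarith [min_le_right ‖x‖ 1])
    have h4 := (χ.m_pos hx).le
    calc _ ≤ (1 / ‖x‖ + 2 * |β| * M) * χ.m x := by gcongr
      _ = 1 / ‖x‖ * χ.m x + 2 * |β| * M * χ.m x := by ring
      _ ≤ 1 / ‖x‖ * (2 * ‖x‖) + 2 * |β| * M * 2 := by gcongr
      _ = _ := by field_simp
  exact ⟨T.comp (PiLp.proj 1 _ (MultiIdx.zero 1)), fun F => hT (F (MultiIdx.zero 1))⟩

/-- These are the images of 1/S and, after removal of the constant 2βκ, of the function 1. Both are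
O(1/r), and 1/r lies in the target because σ₁ + 2 > 0 at the origin and γ₁ < 0 at infinity. -/
theorem exists_potentials {V Φ : ℝ → ℝ} {κ M : ℝ} (D : IsDrift V Φ κ M) (β : ℝ)
    (χ : RadialCutoff) (hγ₁ : γ₁ ∈ Ioo (-1 : ℝ) 0) (hσ₁ : σ₁ ∈ Ioo (-2 : ℝ) (-1)) :
    ∃ N₁ N₂ : L2Double χ γ₁ (σ₁ + 2),
      (N₁.1 : Plane → ℝ) =ᵐ[volume] (fun x => 2 * β * V ‖x‖ * (1 / ‖x‖)) ∧
      (N₂.1 : Plane → ℝ) =ᵐ[volume] (fun x => 1 / ‖x‖ + 2 * β * (V ‖x‖ - κ)) := by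
  have hVm := D.measurable
  have near : MemLp (fun r : ℝ => r ^ (σ₁ + 2 - 1 / 2)) 2 (volume.restrict (Ioc 0 1)) :=
    memLp_rpow_Ioc_iff.2 (by linarith [hσ₁.1])
  have far : MemLp (fun r : ℝ => r ^ (γ₁ - 1 / 2)) 2 (volume.restrict (Ioi 1)) :=
    memLp_rpow_Ioi_iff.2 (by linarith [hγ₁.2])
  obtain ⟨N₁, h₁⟩ := exists_radialL2_of_profile (χ := χ)
    (n := fun r => 2 * β * V r * (1 / r)) (by fun_prop)
    (D.memLp_coeff_div measurableSet_Ioc (fun r hr => hr.1) 1 near)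
    (D.memLp_coeff_div measurableSet_Ioi (Ioi_subset_Ioi zero_le_one) 1 far)
  have key : ∀ (s r : ℝ), 0 < r → |r ^ (s + 1 / 2) * (1 / r + 2 * β * (V r - κ))| ≤
      (1 + 2 * |β| * M) * |r ^ (s - 1 / 2)| := by
    intro s r hr
    rw [show s + 1 / 2 = (s - 1 / 2) + 1 by ring, Real.rpow_add_one hr.ne', mul_assoc, abs_mul,
      mul_comm]
    refine mul_le_mul_of_nonneg_right ?_ (abs_nonneg _)
    have h1 := D.abs_sub_le r hr
    rw [le_div_iff₀ hr] at h1
    rw [show r * (1 / r + 2 * β * (V r - κ)) = 1 + 2 * β * ((V r - κ) * r) by field_simp]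
    refine (abs_add_le _ _).trans ?_
    rw [abs_one, abs_mul, abs_mul, abs_two, abs_mul (V r - κ), abs_of_pos hr]
    gcongr
  obtain ⟨N₂, h₂⟩ := exists_radialL2_of_profile (χ := χ)
    (n := fun r => 1 / r + 2 * β * (V r - κ)) (by fun_prop)
    (memLp_of_abs_le measurableSet_Ioc near (by fun_prop) fun r hr => key _ r hr.1)
    (memLp_of_abs_le measurableSet_Ioi far (by fun_prop) fun r hr =>
      key _ r (one_pos.trans hr))
  exact ⟨N₁, N₂, h₁, h₂⟩

/-- The operator `∂_S + 1/S + 2 β V` from `Y` to `Z̃`: the constant part `c` of the argument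
contributes the constant `2 β κ c`, and the rest of the image lies in the weighted `L²` space. -/
theorem exists_operator {V Φ : ℝ → ℝ} {κ M : ℝ} (D : IsDrift V Φ κ M) (β : ℝ)
    (χ : RadialCutoff) (hγ₁ : γ₁ ∈ Ioo (-1 : ℝ) 0) (hσ₁ : σ₁ ∈ Ioo (-2 : ℝ) (-1)) :
    ∃ L : YSpace χ γ₁ σ₁ →L[ℝ] ZSpace χ γ₁ σ₁, ∀ y,
      (L y).snd = 2 * β * κ * y.snd.snd ∧
      ((L y).fst.1 : Plane → ℝ) =ᵐ[volume] fun x =>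
        y.fst.1.radialDeriv x + (1 / ‖x‖ + 2 * β * V ‖x‖) * y.fst.1.val x
        + y.snd.fst * (2 * β * V ‖x‖ * (1 / ‖x‖))
        + y.snd.snd * (1 / ‖x‖ + 2 * β * (V ‖x‖ - κ)) := by
  obtain ⟨T₁, h₁⟩ := exists_radialDerivCLM χ γ₁ σ₁
  obtain ⟨T₂, h₂⟩ := exists_coeffCLM D β χ γ₁ σ₁
  obtain ⟨N₁, N₂, hN₁, hN₂⟩ := exists_potentials D β χ hγ₁ hσ₁
  have hw := isWeight_doubleWeight χ γ₁ (σ₁ + 2) 0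
  have hrad : ∀ F : HDouble χ 1 γ₁ (σ₁ + 1),
      ((T₁ + T₂).comp (radialSobolev 1 (doubleWeight χ γ₁ (σ₁ + 1))).subtypeL) F ∈
        radialL2 (doubleWeight χ γ₁ (σ₁ + 2) 0) := by
    intro F
    obtain ⟨v, g, hv, hg, -, hF, hF', -, -⟩ := exists_profile_domain F
    have hVm := D.measurable
    refine ⟨fun r => g r + (1 / r + 2 * β * V r) * v r, by fun_prop, ?_⟩
    have ha := Lp.coeFn_add (T₁ F.1) (T₂ F.1)
    rw [EventuallyEq, hw.ae_eq] at ha ⊢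
    filter_upwards [ha, h₁ F.1, h₂ F.1, hF, hF'] with x e1 e2 e3 e4 e5
    change (T₁ F.1 + T₂ F.1 : Lp ℝ 2 _) x = _
    rw [e1, Pi.add_apply, e2, e3, e4, e5]
  let P : HDouble χ 1 γ₁ (σ₁ + 1) →L[ℝ] L2Double χ γ₁ (σ₁ + 2) :=
    ((T₁ + T₂).comp (radialSobolev 1 (doubleWeight χ γ₁ (σ₁ + 1))).subtypeL).codRestrict _ hrad
  let p₁ : YSpace χ γ₁ σ₁ →L[ℝ] HDouble χ 1 γ₁ (σ₁ + 1) := WithLp.fstL 1 ℝ _ _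
  let p₂ : YSpace χ γ₁ σ₁ →L[ℝ] ℝ := (WithLp.fstL 1 ℝ ℝ ℝ).comp (WithLp.sndL 1 ℝ _ _)
  let p₃ : YSpace χ γ₁ σ₁ →L[ℝ] ℝ := (WithLp.sndL 1 ℝ ℝ ℝ).comp (WithLp.sndL 1 ℝ _ _)
  let N : YSpace χ γ₁ σ₁ →L[ℝ] L2Double χ γ₁ (σ₁ + 2) :=
    P.comp p₁ + p₂.smulRight N₁ + p₃.smulRight N₂
  refine ⟨(WithLp.prodContinuousLinearEquiv 1 ℝ (L2Double χ γ₁ (σ₁ + 2)) ℝ).symm.toContinuousLinearMap.comp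
    (N.prod ((2 * β * κ) • p₃)), fun y => ⟨rfl, ?_⟩⟩
  change (((T₁ y.fst.1 + T₂ y.fst.1) + y.snd.fst • N₁.1 + y.snd.snd • N₂.1 : Lp ℝ 2 _) :
    Plane → ℝ) =ᵐ[volume] _
  have a1 := Lp.coeFn_add (T₁ y.fst.1 + T₂ y.fst.1 + y.snd.fst • N₁.1) (y.snd.snd • N₂.1)
  have a2 := Lp.coeFn_add (T₁ y.fst.1 + T₂ y.fst.1) (y.snd.fst • N₁.1)
  have a3 := Lp.coeFn_add (T₁ y.fst.1) (T₂ y.fst.1)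
  have a4 := Lp.coeFn_smul y.snd.fst N₁.1
  have a5 := Lp.coeFn_smul y.snd.snd N₂.1
  rw [EventuallyEq, hw.ae_eq] at a1 a2 a3 a4 a5
  filter_upwards [a1, a2, a3, a4, a5, h₁ y.fst.1, h₂ y.fst.1, hN₁, hN₂]
    with x e1 e2 e3 e4 e5 e6 e7 e8 e9
  rw [e1, Pi.add_apply, e2, Pi.add_apply, e3, Pi.add_apply, e4, e5, Pi.smul_apply, Pi.smul_apply,
    e6, e7, e8, e9, smul_eq_mul, smul_eq_mul]

theorem YSpace.radialDeriv_eq (y : YSpace χ γ₁ σ₁) {x : Plane} (hx : x ≠ 0) :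
    y.radialDeriv x = y.fst.1.radialDeriv x - y.snd.fst / ‖x‖ ^ 2 := by
  have hn := norm_pos_iff.2 hx
  have h : HasDerivAt (fun S : ℝ => y.snd.fst / S + y.snd.snd) (-y.snd.fst / ‖x‖ ^ 2) ‖x‖ := by
    have := ((hasDerivAt_inv hn.ne').const_mul y.snd.fst).add_const y.snd.snd
    refine this.congr_deriv ?_
    field_simp
  rw [YSpace.radialDeriv, h.deriv]
  ring

/-- The bounded inverse theorem. -/
theorem exists_continuousLinearEquiv {E F : Type*} [NormedAddCommGroup E] [NormedSpace ℝ E]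
    [CompleteSpace E] [NormedAddCommGroup F] [NormedSpace ℝ F] [CompleteSpace F] (L : E →L[ℝ] F)
    (hinj : ∀ x, L x = 0 → x = 0) (hsurj : ∀ z, ∃ y, L y = z) :
    ∃ L' : E ≃L[ℝ] F, ∀ x, L' x = L x :=
  ⟨ContinuousLinearEquiv.ofBijective L (LinearMap.ker_eq_bot'.2 hinj)
    (LinearMap.range_eq_top.2 hsurj), fun _ => rfl⟩

/-! ### Bijectivity of the operator. -/

namespace IsDrift

variable {V Φ : ℝ → ℝ} {κ M β : ℝ} {L : YSpace χ γ₁ σ₁ →L[ℝ] ZSpace χ γ₁ σ₁}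

/-- The constant component of the equation gives 2βκc = 0, hence c = 0; the rest is the homogeneous
radial equation. -/
theorem operator_injective (D : IsDrift V Φ κ M) (hκ : 0 < κ) (hβ : β < 0)
    (hγ₁ : γ₁ ∈ Ioo (-1 : ℝ) 0) (hσ₁ : σ₁ ∈ Ioo (-2 : ℝ) (-1))
    (hL : ∀ y, (L y).snd = 2 * β * κ * y.snd.snd ∧
      ((L y).fst.1 : Plane → ℝ) =ᵐ[volume] fun x =>
        y.fst.1.radialDeriv x + (1 / ‖x‖ + 2 * β * V ‖x‖) * y.fst.1.val x
        + y.snd.fst * (2 * β * V ‖x‖ * (1 / ‖x‖))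
        + y.snd.snd * (1 / ‖x‖ + 2 * β * (V ‖x‖ - κ)))
    {y : YSpace χ γ₁ σ₁} (hy : L y = 0) : y = 0 := by
  obtain ⟨h1, h2⟩ := hL y
  have hc : y.snd.snd = 0 := by
    have h3 : (L y).snd = 0 := by rw [hy]; rfl
    rw [h1] at h3
    simpa [hκ.ne', hβ.ne] using h3
  have h0 : ((L y).fst.1 : Plane → ℝ) =ᵐ[volume] 0 := by
    rw [EventuallyEq, ← (isWeight_doubleWeight χ γ₁ (σ₁ + 2) 0).ae_eq, hy]
    exact Lp.coeFn_zero _ _ _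
  obtain ⟨v, g, -, -, hv, hF, hF', m1, m2⟩ := exists_profile_domain y.fst
  obtain ⟨ha, hv0⟩ := D.homogeneous_eq_zero hκ hβ hγ₁.1 hγ₁.2 (a := σ₁ + 2)
    (by linarith [hσ₁.2]) hv m1 m2 (A := y.snd.fst) (by
      refine ae_of_ae_norm ?_
      filter_upwards [h2, h0, hF, hF'] with x e1 e2 e3 e4
      rw [e2, e3, e4, hc, Pi.zero_apply] at e1
      rw [e1]
      ring)
  refine WithLp.ofLp_injective 1 (Prod.ext (HDouble.ext_ae ?_)
    (WithLp.ofLp_injective 1 (Prod.ext ha hc)))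
  have hz : (0 : HDouble χ 1 γ₁ (σ₁ + 1)).1.val =ᵐ[volume] 0 := by
    rw [EventuallyEq, ← (isWeight_doubleWeight χ γ₁ (σ₁ + 1) 0).ae_eq]
    exact Lp.coeFn_zero _ _ _
  filter_upwards [hF, ae_ne_zero, hz] with x e1 hx e2
  exact (e1.trans (hv0 _ (norm_pos_iff.2 hx))).trans e2.symm

/-- The constant c is determined first by 2βκc = z. Its contribution c N₂ is moved to the right-hand
side, and the radial solution operator supplies the function and the coefficient of 1/S. -/
theorem operator_surjective (D : IsDrift V Φ κ M) (hκ : 0 < κ) (hβ : β < 0)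
    (hγ₁ : γ₁ ∈ Ioo (-1 : ℝ) 0) (hσ₁ : σ₁ ∈ Ioo (-2 : ℝ) (-1))
    (hL : ∀ y, (L y).snd = 2 * β * κ * y.snd.snd ∧
      ((L y).fst.1 : Plane → ℝ) =ᵐ[volume] fun x =>
        y.fst.1.radialDeriv x + (1 / ‖x‖ + 2 * β * V ‖x‖) * y.fst.1.val x
        + y.snd.fst * (2 * β * V ‖x‖ * (1 / ‖x‖))
        + y.snd.snd * (1 / ‖x‖ + 2 * β * (V ‖x‖ - κ)))
    (z : ZSpace χ γ₁ σ₁) : ∃ y, L y = z := by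
  set c : ℝ := z.snd / (2 * β * κ) with hc
  obtain ⟨-, N₂, -, hN₂⟩ := exists_potentials D β χ hγ₁ hσ₁
  obtain ⟨n, hn, hN, m1, m2⟩ := exists_profile_target (z.fst - c • N₂)
  obtain ⟨φ, g, A, hφ, hg, hd, k1, k2, k3, k4, heq⟩ := D.exists_solution hκ hβ hγ₁.1 hγ₁.2
    (a := σ₁ + 2) (by linarith [hσ₁.1]) (by linarith [hσ₁.2]) hn m1 m2
  obtain ⟨F, hF, hF'⟩ := exists_jet_of_profile χ γ₁ (σ₁ + 1) hd hφ hg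
    ((memLp_radial_iff _ _ _ _ hφ).2
      ⟨by convert k1 using 3; push_cast; ring_nf, k2⟩)
    ((memLp_radial_iff _ _ _ _ hg).2
      ⟨by convert k3 using 3; push_cast; ring_nf, k4⟩)
  refine ⟨WithLp.toLp 1 (F, WithLp.toLp 1 (A, c)), ?_⟩
  obtain ⟨e1, e2⟩ := hL (WithLp.toLp 1 (F, WithLp.toLp 1 (A, c)))
  refine WithLp.ofLp_injective 1 (Prod.ext (L2Double.ext_ae (e2.trans ?_)) (e1.trans ?_))
  · have hw := isWeight_doubleWeight χ γ₁ (σ₁ + 2) 0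
    have a1 := Lp.coeFn_sub z.fst.1 (c • N₂.1)
    have a2 := Lp.coeFn_smul c N₂.1
    rw [EventuallyEq, hw.ae_eq] at a1 a2
    filter_upwards [a1, a2, hN, hN₂, hF, hF', ae_ne_zero] with x b1 b2 b3 b4 b5 b6 hx
    have b7 := heq ‖x‖ (norm_pos_iff.2 hx)
    change (z.fst.1 - c • N₂.1 : Lp ℝ 2 _) x = _ at b3
    rw [b1, Pi.sub_apply, b2, Pi.smul_apply, b4, smul_eq_mul, ← b7] at b3
    change F.1.radialDeriv x + (1 / ‖x‖ + 2 * β * V ‖x‖) * F.1.val x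
        + A * (2 * β * V ‖x‖ * (1 / ‖x‖)) + c * (1 / ‖x‖ + 2 * β * (V ‖x‖ - κ)) =
        (z.fst.1 : Plane → ℝ) x
    rw [b5, b6]
    linear_combination -b3
  · change 2 * β * κ * c = z.snd
    have := hκ.ne'
    have := hβ.ne
    rw [hc]
    field_simp

end IsDrift

end RadialSobolev

end

/-! ### The isomorphism theorem. -/

theorem mainTheorem7 (χ : RadialSobolev.RadialCutoff)
    (γ₁ σ₁ : ℝ) (hγ₁ : γ₁ ∈ Set.Ioo (-1 : ℝ) 0) (hσ₁ : σ₁ ∈ Set.Ioo (-2 : ℝ) (-1))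
    (β : ℝ) (hβ : β < 0)
    (φ₀ : ℝ → ℝ) (hφ₀ : DifferentiableOn ℝ φ₀ (Set.Ioi 0))
    (κ : ℝ) (hκ : 0 < κ) (hlim : Filter.Tendsto (deriv φ₀) Filter.atTop (nhds κ))
    (hdecay : Asymptotics.IsBigO Filter.atTop (fun r : ℝ => deriv φ₀ r - κ) (fun r : ℝ => 1 / r))
    (γ' : ℝ) (hγ' : γ' ∈ Set.Ioo (-1 : ℝ) 1)
    (hreg : ∃ F : RadialSobolev.HSingle 3 γ',
      F.1.val =ᵐ[MeasureTheory.volume] fun x : RadialSobolev.Plane => deriv φ₀ ‖x‖ - κ) :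
    (∀ y y' : RadialSobolev.YSpace χ γ₁ σ₁,
        RadialSobolev.YSpace.val y =ᵐ[MeasureTheory.volume] RadialSobolev.YSpace.val y' → y = y') ∧
    (∀ z z' : RadialSobolev.ZSpace χ γ₁ σ₁,
        RadialSobolev.ZSpace.val z =ᵐ[MeasureTheory.volume] RadialSobolev.ZSpace.val z' → z = z') ∧
    ∃ L : RadialSobolev.YSpace χ γ₁ σ₁ ≃L[ℝ] RadialSobolev.ZSpace χ γ₁ σ₁,
      ∀ y : RadialSobolev.YSpace χ γ₁ σ₁,
        RadialSobolev.ZSpace.val (L y) =ᵐ[MeasureTheory.volume] fun x : RadialSobolev.Plane =>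
          RadialSobolev.YSpace.radialDeriv y x + (1 / ‖x‖) * RadialSobolev.YSpace.val y x
            + 2 * β * deriv φ₀ ‖x‖ * RadialSobolev.YSpace.val y x := by
  refine ⟨fun y y' h => RadialSobolev.YSpace.ext_ae hγ₁ hσ₁ h,
    fun z z' h => RadialSobolev.ZSpace.ext_ae hγ₁ h, ?_⟩
  -- The jet representing V - κ is bounded on every ball by the Sobolev embedding.
  have hloc : ∀ R : ℝ, 0 < R → ∃ B : ℝ, ∀ᵐ r : ℝ, 0 < r → r < R → |deriv φ₀ r| ≤ B := by
    intro R hR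
    obtain ⟨F, hF⟩ := hreg
    obtain ⟨B, hB⟩ := RadialSobolev.locally_bounded_of_mem_sobolev F.2.1 hR
    refine ⟨B + |κ|, RadialSobolev.ae_of_ae_norm ?_⟩
    filter_upwards [hF, hB] with x h1 h2 hx
    have h3 := h2 hx
    rw [h1] at h3
    have := abs_add_le (deriv φ₀ ‖x‖ - κ) κ
    rw [sub_add_cancel] at this
    linarith
  obtain ⟨Φ, M, D⟩ := RadialSobolev.exists_isDrift hφ₀ hκ hlim hdecay hloc
  obtain ⟨L, hL⟩ := RadialSobolev.exists_operator D β χ hγ₁ hσ₁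
  obtain ⟨E, hE⟩ := RadialSobolev.exists_continuousLinearEquiv
    (E := RadialSobolev.YSpace χ γ₁ σ₁) (F := RadialSobolev.ZSpace χ γ₁ σ₁) L
    (fun y => D.operator_injective hκ hβ hγ₁ hσ₁ hL) (D.operator_surjective hκ hβ hγ₁ hσ₁ hL)
  refine ⟨E, fun y => ?_⟩
  rw [hE y]
  obtain ⟨h1, h2⟩ := hL y
  filter_upwards [h2, RadialSobolev.ae_ne_zero] with x e hx
  have hn := (norm_pos_iff.2 hx).ne'
  -- The derivative -a/S² of a/S cancels (1/S)(a/S), which reconciles the formula for `L` with the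
  -- differential expression.
  rw [RadialSobolev.YSpace.radialDeriv_eq y hx]
  change ((L y).fst.1 : RadialSobolev.Plane → ℝ) x + (L y).snd = _
  rw [e, h1, RadialSobolev.YSpace.val]
  field_simp
  ring
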